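/- Let $(M,g_0,\omega_1,\omega_2,\omega_3)$ be a hyperkähler 4-manifold: $g_0$ is a Riemannian metric, $J_1,J_2,J_3$ are $g_0$-orthogonal almost-complex structures with $J_1J_2=J_3$, and the forms $\omega_i=g_0(J_i\cdot,\cdot)$ are closed. Let $0<a<b\le\infty$, and let $(t,x,y)$ be the coordinates on $(a,b)\times\mathbb R^2$. Given a family of 2-forms $\tilde\omega_1(t)$ on $M$, affine in $t\in(a,b)$ with $t$-derivative $\tilde\omega_1'$, a function $u=u(t)$, an open set $M'\subseteq M$, a smooth 1-form $\xi_P$ on $(a,b)\times M'$ with $d\xi_P=\tilde\omega_1'$, and a smooth 1-form $\eta_N$ on $(a,b)\times\mathbb R_x\times M'$ with $d\eta_N=-\omega_2$, define the 3-form $$\varphi=\tilde\omega_1\wedge(dy+\eta_N)+dt\wedge(dx+\xi_P)\wedge(dy+\eta_N)+t\big(\omega_2\wedge(dx+\xi_P)+u\,\omega_3\wedge dt\big)\qquad(*)$$ on $(a,b)\times\mathbb R^2_{x,y}\times M'$. A 3-form on a 7-manifold defines a torsion-free $G_2$ structure if it is smooth, at each point is linearly equivalent to the standard $G_2$ 3-form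 on $\mathbb R^7$, and $d\varphi=0=d{*\varphi}$, where $*$ is the Hodge operator of the metric and orientation determined by $\varphi$. (1) Let $k,l\in\mathbb R$ with $k+lt>0$ for all $t\in(a,b)$, and set $$\tilde\omega_1=(k+lt)\,\omega_1,\qquad u=t(k+lt)^2 .$$ Then every point of $M$ has an open neighbourhood $M'$ on which 1-forms $\xi_P,\eta_N$ as above exist, and for every open $M'\subseteq M$ and all such $\xi_P,\eta_N$ the form $(*)$ defines a torsion-free $G_2$ structure on $(a,b)\times\mathbb R^2_{x,y}\times M'$. (2) Suppose furthermore that $(M,g_0)$ admits an almost-Kähler structure $(\omega_0,I)$ (that is, $I$ is a $g_0$-orthogonal almost-complex structure and $\omega_0=g_0(I\cdot,\cdot)$ is closed) which induces the orientation opposite to the one induced by $(\omega_1,\omega_2,\omega_3)$. Let $p,q,k,l\in\mathbb R$ with $k+lt>|p+qt|$ for all $t\in(a,b)$, and set $$\tilde\omega_1=(p+qt)\,\omega_0+(k+lt)\,\omega_1,\qquad u=t\big((k+lt)^2-(p+qt)^2\big).$$ Then the same conclusion holds: every point of $M$ has an open neighbourhood $M'$ on which $\xi_P,\eta_N$ exist,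 and for every open $M'\subseteq M$ and all such $\xi_P,\eta_N$ the form $(*)$ defines a torsion-free $G_2$ structure on $(a,b)\times\mathbb R^2_{x,y}\times M'$. -/

import Mathlib

open scoped Manifold ContDiff

noncomputable section

/-! ### Exterior algebra of a real topological vector space -/

namespace Ext

variable {V : Type*} [AddCommGroup V] [Module ℝ V] [TopologicalSpace V]
  [IsTopologicalAddGroup V] [ContinuousSMul ℝ V]

theorem update_comp {W : Type*} {m n : ℕ} (v : Fin n → W) (f : Fin m → Fin n)
    (hf : Function.Injective f) (j : Fin m) (z : W) :
    (fun a => Function.update v (f j) z (f a)) = Function.update (fun a => v (f a)) j z := by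
  funext a
  by_cases h : a = j
  · subst h; simp
  · simp [h, hf.ne h]

theorem castAdd_ne_natAdd {k l : ℕ} (a : Fin k) (b : Fin l) :
    Fin.castAdd l a ≠ Fin.natAdd k b := by
  intro h
  have := congrArg Fin.val h
  simp at this
  omega

/-- The multilinear map `v ↦ α (v₁, …, v_k) * β (v_{k+1}, …, v_{k+l})`. -/
def tensor {k l : ℕ} (α : V [⋀^Fin k]→L[ℝ] ℝ) (β : V [⋀^Fin l]→L[ℝ] ℝ) :
    ContinuousMultilinearMap ℝ (fun _ : Fin (k + l) => V) ℝ where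
  toFun v := α (fun i => v (Fin.castAdd l i)) * β (fun j => v (Fin.natAdd k j))
  map_update_add' := by
    intro inst v i x y
    obtain rfl : inst = instDecidableEqFin (k + l) := Subsingleton.elim _ _
    induction i using Fin.addCases with
    | left j =>
      simp only [update_comp v _ (Fin.castAdd_injective k l), ne_eq, (castAdd_ne_natAdd _ _).symm, not_false_eq_true,
        Function.update_of_ne, ContinuousAlternatingMap.map_update_add, add_mul]
    | right j =>
      simp only [update_comp v _ (Fin.natAdd_injective l k), ne_eq, castAdd_ne_natAdd, not_false_eq_true,
        Function.update_of_ne, ContinuousAlternatingMap.map_update_add, mul_add]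
  map_update_smul' := by
    intro inst v i c x
    obtain rfl : inst = instDecidableEqFin (k + l) := Subsingleton.elim _ _
    induction i using Fin.addCases with
    | left j =>
      simp only [update_comp v _ (Fin.castAdd_injective k l), ne_eq, (castAdd_ne_natAdd _ _).symm, not_false_eq_true,
        Function.update_of_ne, ContinuousAlternatingMap.map_update_smul, smul_eq_mul, mul_assoc]
    | right j =>
      simp only [update_comp v _ (Fin.natAdd_injective l k), ne_eq, castAdd_ne_natAdd, not_false_eq_true,
        Function.update_of_ne, ContinuousAlternatingMap.map_update_smul, smul_eq_mul,
        mul_left_comm]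
  cont := by
    refine Continuous.mul ?_ ?_
    · exact α.cont.comp (continuous_pi fun i => continuous_apply _)
    · exact β.cont.comp (continuous_pi fun i => continuous_apply _)

/-- The wedge product
`(α ∧ β)(v) = (1 / (k! l!)) ∑_σ sgn(σ) α(v_{σ(1)}, …, v_{σ(k)}) β(v_{σ(k+1)}, …, v_{σ(k+l)})`. -/
def wedge {k l : ℕ} (α : V [⋀^Fin k]→L[ℝ] ℝ) (β : V [⋀^Fin l]→L[ℝ] ℝ) :
    V [⋀^Fin (k + l)]→L[ℝ] ℝ :=
  ((k.factorial * l.factorial : ℕ) : ℝ)⁻¹ • (tensor α β).alternatization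

end Ext

/-- Wedge product of two alternating forms. -/
infixl:70 " ⋏ " => Ext.wedge

/-! ### The model `G₂` structure on `ℝ⁷` -/

/-- The elementary form `dx^{a 1} ∧ ⋯ ∧ dx^{a k}` on `ℝ⁷` (coordinates numbered `0, …, 6`),
i.e. `v ↦ det (v_j (a i))`. -/
def elemForm {k : ℕ} (a : Fin k → Fin 7) : (Fin 7 → ℝ) [⋀^Fin k]→L[ℝ] ℝ :=
  ((ContinuousMultilinearMap.mkPiAlgebra ℝ (Fin k) ℝ).compContinuousLinearMap
    (fun i => ContinuousLinearMap.proj (R := ℝ) (φ := fun _ : Fin 7 => ℝ) (a i))).alternatization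

/-- The standard `G₂` 3-form on `ℝ⁷`; in coordinates `x₁, …, x₇`,
`φ₀ = dx₁₂₃ + dx₁₄₅ + dx₁₆₇ + dx₂₄₆ - dx₂₅₇ - dx₃₄₇ - dx₃₅₆`. -/
def phi0 : (Fin 7 → ℝ) [⋀^Fin 3]→L[ℝ] ℝ :=
  elemForm ![0, 1, 2] + elemForm ![0, 3, 4] + elemForm ![0, 5, 6] + elemForm ![1, 3, 5]
    - elemForm ![1, 4, 6] - elemForm ![2, 3, 6] - elemForm ![2, 4, 5]

/-- The Hodge dual of `φ₀` for the Euclidean metric and the standard orientation of `ℝ⁷`,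
`*φ₀ = dx₄₅₆₇ + dx₂₃₆₇ + dx₂₃₄₅ + dx₁₃₅₇ - dx₁₃₄₆ - dx₁₂₅₆ - dx₁₂₄₇`. -/
def starPhi0 : (Fin 7 → ℝ) [⋀^Fin 4]→L[ℝ] ℝ :=
  elemForm ![3, 4, 5, 6] + elemForm ![1, 2, 5, 6] + elemForm ![1, 2, 3, 4]
    + elemForm ![0, 2, 4, 6] - elemForm ![0, 2, 3, 5] - elemForm ![0, 1, 4, 5]
    - elemForm ![0, 1, 3, 6]

/-- `φ` is an admissible (positive) 3-form and `ψ = *φ`. A linear isomorphism to `ℝ⁷` which takes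
`φ` to `φ₀` is an oriented isometry for the metric and the orientation determined by `φ`, so it
takes `*φ` to `*φ₀`; since the stabiliser of `φ₀` also fixes `*φ₀`, the form `ψ` is determined
by `φ`. -/
def IsG2Pair {V : Type*} [AddCommGroup V] [Module ℝ V] [TopologicalSpace V]
    (φ : V [⋀^Fin 3]→L[ℝ] ℝ) (ψ : V [⋀^Fin 4]→L[ℝ] ℝ) : Prop :=
  ∃ e : V ≃L[ℝ] (Fin 7 → ℝ),
    φ = phi0.compContinuousLinearMap (e : V →L[ℝ] (Fin 7 → ℝ)) ∧
    ψ = starPhi0.compContinuousLinearMap (e : V →L[ℝ] (Fin 7 → ℝ))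

/-! ### Differential forms on manifolds (without boundary) -/

section Forms

variable {E : Type*} [NormedAddCommGroup E] [NormedSpace ℝ E]
  {H : Type*} [TopologicalSpace H] (I : ModelWithCorners ℝ E H)
  (X : Type*) [TopologicalSpace X] [ChartedSpace H X]

/-- (Not necessarily continuous) differential `k`-forms on a manifold `X`. Forms on an open subset
of `X` are represented by forms on `X`, of which only the values on the subset matter. -/
abbrev DiffForm (k : ℕ) : Type _ := ∀ x : X, TangentSpace I x [⋀^Fin k]→L[ℝ] ℝ

variable {I X}

/-- The expression of a form in the preferred chart at `x`: its pullback by the inverse chart. -/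
def DiffForm.inChart {k : ℕ} (α : DiffForm I X k) (x : X) : E → E [⋀^Fin k]→L[ℝ] ℝ :=
  fun y => (α ((extChartAt I x).symm y)).compContinuousLinearMap
    (mfderiv 𝓘(ℝ, E) I (extChartAt I x).symm y)

/-- The form is smooth on the open set `U`: its chart expressions are smooth. -/
def DiffForm.SmoothOn {k : ℕ} (α : DiffForm I X k) (U : Set X) : Prop :=
  ∀ x ∈ U, ContDiffAt ℝ ∞ (α.inChart x) (extChartAt I x x)

/-- The exterior derivative, computed in charts. -/
def DiffForm.d {k : ℕ} (α : DiffForm I X k) : DiffForm I X (k + 1) :=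
  fun x => (extDeriv (α.inChart x) (extChartAt I x x)).compContinuousLinearMap
    (mfderiv I 𝓘(ℝ, E) (extChartAt I x) x)

/-- The pullback of a form by a map. -/
def DiffForm.pullback {E' : Type*} [NormedAddCommGroup E'] [NormedSpace ℝ E']
    {H' : Type*} [TopologicalSpace H'] {I' : ModelWithCorners ℝ E' H'}
    {X' : Type*} [TopologicalSpace X'] [ChartedSpace H' X'] {k : ℕ}
    (f : X → X') (α : DiffForm I' X' k) : DiffForm I X k :=
  fun x => (α (f x)).compContinuousLinearMap (mfderiv I I' f x)

/-- The differential `df` of a real function, as a 1-form. -/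
def DiffForm.ofFun (I : ModelWithCorners ℝ E H) (f : X → ℝ) : DiffForm I X 1 :=
  fun x => ContinuousAlternatingMap.ofSubsingleton ℝ (TangentSpace I x) ℝ (0 : Fin 1)
    (mfderiv I 𝓘(ℝ, ℝ) f x)

/-- The 3-form `φ` defines a torsion-free `G₂` structure on the open subset `U`: it is smooth and
admissible at every point of `U`, and both `φ` and `*φ` are closed on `U`. -/
def IsTorsionFreeG2On (φ : DiffForm I X 3) (U : Set X) : Prop :=
  φ.SmoothOn U ∧ (∀ x ∈ U, φ.d x = 0) ∧
    ∃ ψ : DiffForm I X 4, (∀ x ∈ U, IsG2Pair (φ x) (ψ x)) ∧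
      ψ.SmoothOn U ∧ ∀ x ∈ U, ψ.d x = 0

end Forms

/-! ### Almost-Kähler and hyperkähler 4-manifolds -/

section FourManifolds

variable (M : Type*) [TopologicalSpace M] [ChartedSpace (EuclideanSpace ℝ (Fin 4)) M]
  [IsManifold (𝓡 4) ∞ M]

/-- Smooth Riemannian metrics on a 4-manifold. -/
abbrev SmoothMetric : Type _ :=
  Bundle.ContMDiffRiemannianMetric (𝓡 4) ∞ (EuclideanSpace ℝ (Fin 4))
    (fun x : M => TangentSpace (𝓡 4) x)

variable {M}

/-- An almost-Kähler structure `(J, Ω)` on a Riemannian 4-manifold `(M, g)`: an orthogonal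
almost-complex structure `J` whose fundamental form `Ω = g(J·,·)` is smooth and closed
(smoothness of `J` amounts to that of `Ω`). -/
structure AlmostKahlerStructure (g : SmoothMetric M) where
  /-- the almost-complex structure -/
  J : ∀ x : M, TangentSpace (𝓡 4) x →L[ℝ] TangentSpace (𝓡 4) x
  /-- the fundamental 2-form -/
  Ω : DiffForm (𝓡 4) M 2
  J_J : ∀ (x : M) (v : TangentSpace (𝓡 4) x), J x (J x v) = -v
  orthogonal : ∀ (x : M) (v w : TangentSpace (𝓡 4) x),
    g.inner x (J x v) (J x w) = g.inner x v w
  Ω_apply : ∀ (x : M) (v w : TangentSpace (𝓡 4) x), Ω x ![v, w] = g.inner x (J x v) w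
  smooth : Ω.SmoothOn Set.univ
  closed : ∀ x : M, Ω.d x = 0

variable (M)

/-- A hyperkähler structure `(g₀, ω₁, ω₂, ω₃)` on a 4-manifold: three almost-Kähler structures
`(J₁, ω₁)`, `(J₂, ω₂)`, `(J₃, ω₃)` for the same metric `g₀`, with `J₁ J₂ = J₃` (together with
`Jᵢ² = -1` this gives all the quaternion relations). By a well-known lemma of Hitchin, closedness
of the three forms implies that the `Jᵢ` are integrable and parallel for the Levi-Civita connection
of `g₀`, so this need not be required separately. -/
structure HyperkahlerStructure where
  /-- the hyperkähler metric -/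
  g₀ : SmoothMetric M
  /-- the first almost-Kähler structure -/
  K₁ : AlmostKahlerStructure g₀
  /-- the second almost-Kähler structure -/
  K₂ : AlmostKahlerStructure g₀
  /-- the third almost-Kähler structure -/
  K₃ : AlmostKahlerStructure g₀
  quaternion : ∀ (x : M) (v : TangentSpace (𝓡 4) x), K₁.J x (K₂.J x v) = K₃.J x v

variable {M}

/-- Two almost-Kähler structures induce opposite orientations: the volume forms `Ω ∧ Ω` and
`Ω' ∧ Ω'` have opposite signs on every basis of every tangent space. -/
def AlmostKahlerStructure.OppositelyOriented {g g' : SmoothMetric M}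
    (A : AlmostKahlerStructure g) (B : AlmostKahlerStructure g') : Prop :=
  ∀ (x : M) (v : Fin 4 → TangentSpace (𝓡 4) x), LinearIndependent ℝ v →
    ((A.Ω x ⋏ A.Ω x) v) * ((B.Ω x ⋏ B.Ω x) v) < 0

end FourManifolds

/-! ### The construction of the 3-form -/

section Construction

/-- The model of `P = ℝ_t × M`. -/
abbrev IP := 𝓘(ℝ, ℝ).prod (𝓡 4)

/-- The model of `N = ℝ_t × ℝ_x × M`. -/
abbrev IN := 𝓘(ℝ, ℝ).prod (𝓘(ℝ, ℝ).prod (𝓡 4))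

/-- The model of `Y = ℝ_t × ℝ_x × ℝ_y × M`. -/
abbrev IY := 𝓘(ℝ, ℝ).prod (𝓘(ℝ, ℝ).prod (𝓘(ℝ, ℝ).prod (𝓡 4)))

variable {M : Type*} [TopologicalSpace M] [ChartedSpace (EuclideanSpace ℝ (Fin 4)) M]

/-- The projection `Y → P`, `(t, x, y, m) ↦ (t, m)`. -/
def projP (z : ℝ × ℝ × ℝ × M) : ℝ × M := (z.1, z.2.2.2)

/-- The projection `Y → N`, `(t, x, y, m) ↦ (t, x, m)`. -/
def projN (z : ℝ × ℝ × ℝ × M) : ℝ × ℝ × M := (z.1, z.2.1, z.2.2.2)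

/-- The projection `Y → M`, `(t, x, y, m) ↦ m`. -/
def projM (z : ℝ × ℝ × ℝ × M) : M := z.2.2.2

/-- The 3-form
`φ = ω̃(t) ∧ (dy + η) + dt ∧ (dx + ξ) ∧ (dy + η) + t (ω₂ ∧ (dx + ξ) + u ω₃ ∧ dt)`
on `Y = ℝ_t × ℝ_x × ℝ_y × M`, for a family `ω̃(t)` of 2-forms on `M`, a function `u = u(t)`,
2-forms `ω₂`, `ω₃` on `M`, a 1-form `ξ` on `P` and a 1-form `η` on `N`. -/
def phiForm (ωt : ℝ → DiffForm (𝓡 4) M 2) (u : ℝ → ℝ) (ω₂ ω₃ : DiffForm (𝓡 4) M 2)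
    (ξ : DiffForm IP (ℝ × M) 1) (η : DiffForm IN (ℝ × ℝ × M) 1) :
    DiffForm IY (ℝ × ℝ × ℝ × M) 3 := fun z =>
  let t : ℝ := z.1
  let dt := DiffForm.ofFun IY (fun z' : ℝ × ℝ × ℝ × M => z'.1) z
  let dx := DiffForm.ofFun IY (fun z' : ℝ × ℝ × ℝ × M => z'.2.1) z
  let dy := DiffForm.ofFun IY (fun z' : ℝ × ℝ × ℝ × M => z'.2.2.1) z
  let Ωt := DiffForm.pullback (I := IY) projM (ωt t) z
  let Ω₂ := DiffForm.pullback (I := IY) projM ω₂ z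
  let Ω₃ := DiffForm.pullback (I := IY) projM ω₃ z
  let Ξ := dx + DiffForm.pullback (I := IY) projP ξ z
  let Η := dy + DiffForm.pullback (I := IY) projN η z
  Ωt ⋏ Η + dt ⋏ Ξ ⋏ Η + t • (Ω₂ ⋏ Ξ + u t • (Ω₃ ⋏ dt))

/-- The smooth 1-forms `ξ` on `P = T × M'` and `η` on `N = T × ℝ_x × M'` satisfy `dη = -ω₂` and
`dξ = (d^c_M u) ∧ dt + ω̃'`, where `u` depends only on `t`, so that `d^c_M u = 0`, and
`β = ω̃'` is the (constant) `t`-derivative of `ω̃(t)`. -/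
structure AreConnectionForms (T : Set ℝ) (M' : Set M) (β ω₂ : DiffForm (𝓡 4) M 2)
    (ξ : DiffForm IP (ℝ × M) 1) (η : DiffForm IN (ℝ × ℝ × M) 1) : Prop where
  smooth_ξ : ξ.SmoothOn {z | z.1 ∈ T ∧ z.2 ∈ M'}
  smooth_η : η.SmoothOn {z | z.1 ∈ T ∧ z.2.2 ∈ M'}
  d_ξ : ∀ z : ℝ × M, z.1 ∈ T → z.2 ∈ M' →
    ξ.d z = DiffForm.pullback (I := IP) (fun z' : ℝ × M => z'.2) β z
  d_η : ∀ z : ℝ × ℝ × M, z.1 ∈ T → z.2.2 ∈ M' →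
    η.d z = -DiffForm.pullback (I := IN) (fun z' : ℝ × ℝ × M => z'.2.2) ω₂ z

/-- The form `φ` built from `ω̃(t)` (with `t`-derivative `β`), `u`, `ω₂`, `ω₃` defines a
torsion-free `G₂` structure on `T × ℝ² × M'` for suitable open subsets `M'` of `M`: each point of
`M` has an open neighbourhood `M'` on which the required 1-forms `ξ`, `η` exist, and for every open
`M'` and every choice of these 1-forms `φ` is a torsion-free `G₂` structure. -/
def YieldsTorsionFreeG2 (T : Set ℝ) (ωt : ℝ → DiffForm (𝓡 4) M 2) (β : DiffForm (𝓡 4) M 2)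
    (u : ℝ → ℝ) (ω₂ ω₃ : DiffForm (𝓡 4) M 2) : Prop :=
  (∀ m : M, ∃ M' : Set M, IsOpen M' ∧ m ∈ M' ∧
    ∃ (ξ : DiffForm IP (ℝ × M) 1) (η : DiffForm IN (ℝ × ℝ × M) 1),
      AreConnectionForms T M' β ω₂ ξ η) ∧
  ∀ M' : Set M, IsOpen M' →
    ∀ (ξ : DiffForm IP (ℝ × M) 1) (η : DiffForm IN (ℝ × ℝ × M) 1),
      AreConnectionForms T M' β ω₂ ξ η →
      IsTorsionFreeG2On (phiForm ωt u ω₂ ω₃ ξ η) {z | z.1 ∈ T ∧ z.2.2.2 ∈ M'}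

end Construction

end

/-!
At a point of `M` the statement is linear algebra. A hyperkähler structure has a unit vector `v`
with orthonormal basis `v, J₁ v, J₂ v, J₃ v`, and in the dual coframe `ω₁, ω₂, ω₃` are the self-dual
2-forms `σ₁, σ₂, σ₃` which are the coefficients in the standard `G₂` form. If `I` is an orthogonal
complex structure of the opposite orientation, then `I` commutes with `J₁` and `I ≠ -J₁`, so
`I v = J₁ v` for some unit vector `v`; the coframe defined by this `v` makes `ω₀` equal to `σ₀`, the
anti-self-dual counterpart of `σ₁` (`HyperkahlerStructure.exists_coframe`,
`HyperkahlerStructure.exists_coframe_of_oppositelyOriented`). So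
`ω̃ = (p + q t) ω₀ + (k + l t) ω₁` is diagonal, with entries `(k + l t) ± (p + q t) > 0`. Rescaling
the coframe by their square roots, and `dt`, `dx + ξ`, `dy + η` by powers of `t` and of
`f = (k + l t)² - (p + q t)²`, takes `φ` to the standard form, and gives (`isG2Pair_of_coframe`)
`*φ = ½ t² f ω₂² - t² ω̃ ∧ (dx + ξ) ∧ dt + t f ω₂ ∧ (dy + η) ∧ dt - ω₃ ∧ (dy + η) ∧ (dx + ξ)`.

Both forms are closed by the Leibniz rule (`hasExtDerivAt_phi`, `hasExtDerivAt_starPhi`), in view of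
the pointwise identities `ω̃ ∧ ω₂ = ω₂ ∧ ω̃' = ω₃ ∧ ω̃' = ω₃ ∧ ω₂ = 0` and
`ω̃ ∧ ω̃' = ½ f' ω₂ ∧ ω₂`, read off in the adapted coframe; the choice `u = t f` is what makes the
coefficients of `dt ∧ ω₂ ∧ ω₂` in `d*φ` cancel. On the manifold this is
`isTorsionFreeG2On_phiForm`. The 1-forms exist locally because `ω̃'` and `ω₂` are closed: they are
pulled back from primitives on `M`, given by the Poincaré lemma (`exists_extDeriv_eq`). The statement
without `ω₀` is the case `p = q = 0`.

The calculus of forms is developed as far as needed: associativity, graded commutativity and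
naturality of the wedge product, the Leibniz rule (`Ext.extDeriv_wedge`), and `d` of a pullback
between manifolds (`DiffForm.d_pullback`).
-/

noncomputable section

/-! ### Signed sums over permutations -/

/-- The antisymmetrisation `v ↦ ∑ σ, sgn σ * f (v ∘ σ)` of an arbitrary function of `n` vectors.
Working with plain functions rather than multilinear maps makes block permutations and
the reindexing of `Fin` sums painless. -/
def altSum {V : Type*} {n : ℕ} (f : (Fin n → V) → ℝ) (v : Fin n → V) : ℝ :=
  ∑ σ : Equiv.Perm (Fin n), ((Equiv.Perm.sign σ : ℤ) : ℝ) * f (v ∘ σ)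

section AltSum

variable {V : Type*} {n k l : ℕ}

theorem altSum_comp_perm (f : (Fin n → V) → ℝ) (ρ : Equiv.Perm (Fin n)) (v : Fin n → V) :
    altSum (fun w => f (w ∘ ρ)) v = ((Equiv.Perm.sign ρ : ℤ) : ℝ) * altSum f v := by
  unfold altSum
  rw [Finset.mul_sum]
  conv_rhs => rw [← Equiv.sum_comp (Equiv.mulRight ρ)]
  refine Finset.sum_congr rfl fun σ _ => ?_
  have h : (((Equiv.Perm.sign ρ : ℤ) : ℝ)) * ((Equiv.Perm.sign ρ : ℤ) : ℝ) = 1 := by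
    rw [← Int.cast_mul, ← Units.val_mul, Int.units_mul_self]; simp
  simp only [Equiv.coe_mulRight, Equiv.Perm.sign_mul, Units.val_mul, Int.cast_mul,
    Equiv.Perm.coe_mul, Function.comp_assoc]
  linear_combination (-((Equiv.Perm.sign σ : ℤ) : ℝ) * f (v ∘ σ ∘ ρ)) * h

theorem altSum_const_mul (c : ℝ) (f : (Fin n → V) → ℝ) (v : Fin n → V) :
    altSum (fun w => c * f w) v = c * altSum f v := by
  simp only [altSum, Finset.mul_sum, mul_left_comm]

theorem altSum_sum {ι : Type*} (s : Finset ι) (f : ι → (Fin n → V) → ℝ) (v : Fin n → V) :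
    altSum (fun w => ∑ i ∈ s, f i w) v = ∑ i ∈ s, altSum (f i) v := by
  simp only [altSum, Finset.mul_sum]
  rw [Finset.sum_comm]

theorem altSum_cast {m : ℕ} (h : m = n) (f : (Fin m → V) → ℝ) (v : Fin n → V) :
    altSum f (v ∘ Fin.cast h) = altSum (fun w => f (w ∘ Fin.cast h)) v := by
  subst h; rfl

/-- Antisymmetrising first in a block of `k` of the arguments contributes only a factor `k!`. -/
theorem altSum_block (ι : Fin k ↪ Fin n) (f : (Fin n → V) → ℝ) (v : Fin n → V) :
    altSum (fun w => ∑ τ : Equiv.Perm (Fin k), ((Equiv.Perm.sign τ : ℤ) : ℝ) *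
      f (w ∘ τ.viaFintypeEmbedding ι)) v = k.factorial * altSum f v := by
  have h : ∀ τ : Equiv.Perm (Fin k), altSum (fun w => ((Equiv.Perm.sign τ : ℤ) : ℝ) *
      f (w ∘ τ.viaFintypeEmbedding ι)) v = altSum f v := by
    intro τ
    rw [altSum_const_mul, altSum_comp_perm, Equiv.Perm.viaFintypeEmbedding_sign, ← mul_assoc,
      ← Int.cast_mul, ← Units.val_mul, Int.units_mul_self]
    simp
  rw [altSum_sum, Finset.sum_congr rfl fun τ _ => h τ]
  simp [Fintype.card_perm]

theorem viaFintypeEmbedding_comp (ι : Fin k ↪ Fin n) (τ : Equiv.Perm (Fin k)) :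
    (τ.viaFintypeEmbedding ι : Fin n → Fin n) ∘ ι = ι ∘ τ := by
  funext a
  simp [Equiv.Perm.viaFintypeEmbedding_apply_image]

theorem viaFintypeEmbedding_comp_of_disjoint (ι : Fin k ↪ Fin n) (j : Fin l → Fin n)
    (hj : ∀ a b, ι a ≠ j b) (τ : Equiv.Perm (Fin k)) :
    (τ.viaFintypeEmbedding ι : Fin n → Fin n) ∘ j = j := by
  funext b
  refine Equiv.Perm.viaFintypeEmbedding_apply_notMem_range _ _ ?_
  rintro ⟨a, ha⟩
  exact hj a b ha

/-- An inner antisymmetrisation, over a block of arguments which the other factor does not involve,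
is absorbed by the outer one. -/
theorem altSum_altSum_mul (ι : Fin k ↪ Fin n) (j : Fin l → Fin n) (hj : ∀ a b, ι a ≠ j b)
    (f : (Fin k → V) → ℝ) (g : (Fin l → V) → ℝ) (v : Fin n → V) :
    altSum (fun w => altSum f (w ∘ ι) * g (w ∘ j)) v =
      k.factorial * altSum (fun w => f (w ∘ ι) * g (w ∘ j)) v := by
  rw [← altSum_block ι]
  congr 1
  funext w
  rw [altSum, Finset.sum_mul]
  refine Finset.sum_congr rfl fun τ _ => ?_
  simp only [Function.comp_assoc, viaFintypeEmbedding_comp,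
    viaFintypeEmbedding_comp_of_disjoint ι j hj]
  ring

end AltSum

namespace Ext

variable {V : Type*} [AddCommGroup V] [Module ℝ V] [TopologicalSpace V]
variable {k l m : ℕ}

theorem altSum_alternating (α : V [⋀^Fin k]→L[ℝ] ℝ) (v : Fin k → V) :
    altSum α v = k.factorial * α v := by
  have h : ∀ σ : Equiv.Perm (Fin k), ((Equiv.Perm.sign σ : ℤ) : ℝ) * α (v ∘ σ) = α v := by
    intro σ
    have h1 : α (v ∘ σ) = Equiv.Perm.sign σ • α v := α.toAlternatingMap.map_perm v σ
    rw [h1, Units.smul_def, zsmul_eq_mul, ← mul_assoc, ← Int.cast_mul, ← Units.val_mul,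
      Int.units_mul_self]
    simp
  rw [altSum, Finset.sum_congr rfl fun σ _ => h σ]
  simp [Fintype.card_perm]

theorem alternatization_eq_altSum (f : ContinuousMultilinearMap ℝ (fun _ : Fin k => V) ℝ)
    (v : Fin k → V) : f.alternatization v = altSum f v := by
  rw [ContinuousMultilinearMap.alternatization_apply_apply, altSum]
  simp [Units.smul_def]

theorem wedge_apply (α : V [⋀^Fin k]→L[ℝ] ℝ) (β : V [⋀^Fin l]→L[ℝ] ℝ) (v : Fin (k + l) → V) :
    (α ⋏ β) v = ((k.factorial : ℝ) * l.factorial)⁻¹ *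
      altSum (fun w => α (w ∘ Fin.castAdd l) * β (w ∘ Fin.natAdd k)) v := by
  rw [wedge, ContinuousAlternatingMap.smul_apply, alternatization_eq_altSum, smul_eq_mul]
  push_cast
  rfl

/-- The wedge product of the antisymmetrisations of `f` and `g` is the antisymmetrisation of the
product of `f` and `g`, with no numerical factor. -/
theorem wedge_apply_of_altSum {α : V [⋀^Fin k]→L[ℝ] ℝ} {β : V [⋀^Fin l]→L[ℝ] ℝ}
    {f : (Fin k → V) → ℝ} {g : (Fin l → V) → ℝ} {a b : ℝ} (hα : ∀ v, α v = a * altSum f v)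
    (hβ : ∀ v, β v = b * altSum g v) (v : Fin (k + l) → V) :
    (α ⋏ β) v = a * b * altSum (fun w => f (w ∘ Fin.castAdd l) * g (w ∘ Fin.natAdd k)) v := by
  have h1 := altSum_altSum_mul ⟨Fin.castAdd l, Fin.castAdd_injective k l⟩ (Fin.natAdd k)
    (fun a b => castAdd_ne_natAdd a b) f (altSum g) v
  have h2 := altSum_altSum_mul ⟨Fin.natAdd k, Fin.natAdd_injective l k⟩ (Fin.castAdd l)
    (fun a b => (castAdd_ne_natAdd b a).symm) g f v
  simp only [Function.Embedding.coeFn_mk] at h1 h2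
  rw [wedge_apply]
  simp only [hα, hβ]
  have h3 : (fun w : Fin (k + l) → V => a * altSum f (w ∘ Fin.castAdd l) *
      (b * altSum g (w ∘ Fin.natAdd k))) = fun w => (a * b) *
      (altSum f (w ∘ Fin.castAdd l) * altSum g (w ∘ Fin.natAdd k)) := by
    funext w; ring
  rw [h3, altSum_const_mul, h1]
  simp only [mul_comm (f _)]
  rw [h2]
  have hk : (k.factorial : ℝ) ≠ 0 := by positivity
  have hl : (l.factorial : ℝ) ≠ 0 := by positivity
  field_simp

theorem apply_eq_altSum (α : V [⋀^Fin k]→L[ℝ] ℝ) (v : Fin k → V) :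
    α v = (k.factorial : ℝ)⁻¹ * altSum α v := by
  rw [altSum_alternating, inv_mul_cancel_left₀ (by positivity)]

theorem wedge_assoc_apply (α : V [⋀^Fin k]→L[ℝ] ℝ) (β : V [⋀^Fin l]→L[ℝ] ℝ)
    (γ : V [⋀^Fin m]→L[ℝ] ℝ) (v : Fin (k + l + m) → V) :
    (α ⋏ β ⋏ γ) v = (α ⋏ (β ⋏ γ)) (v ∘ Fin.cast (Nat.add_assoc k l m).symm) := by
  rw [wedge_apply_of_altSum (wedge_apply α β) (apply_eq_altSum γ),
    wedge_apply_of_altSum (apply_eq_altSum α) (wedge_apply β γ), altSum_cast]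
  congr 1
  · field_simp
  · congr 1
    funext w
    have h : (Fin.cast (Nat.add_assoc k l m).symm ∘ Fin.natAdd k) ∘ Fin.natAdd l =
        (Fin.natAdd (k + l) : Fin m → Fin (k + l + m)) := by
      funext i
      simp [Fin.ext_iff, Nat.add_assoc]
    rw [mul_assoc, ← h]
    rfl

/-- The permutation of `Fin (k + l)` exchanging the first `k` with the last `l` places. -/
def blockSwap (k l : ℕ) : Equiv.Perm (Fin (k + l)) :=
  finAddFlip.trans (finCongr (Nat.add_comm l k))

theorem wedge_comm_apply (α : V [⋀^Fin k]→L[ℝ] ℝ) (β : V [⋀^Fin l]→L[ℝ] ℝ)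
    (v : Fin (k + l) → V) :
    (β ⋏ α) (v ∘ Fin.cast (Nat.add_comm l k)) =
      ((Equiv.Perm.sign (blockSwap k l) : ℤ) : ℝ) * (α ⋏ β) v := by
  have h1 : Fin.cast (Nat.add_comm l k) ∘ Fin.castAdd k = blockSwap k l ∘ Fin.natAdd k := by
    funext i
    simp [blockSwap]
  have h2 : Fin.cast (Nat.add_comm l k) ∘ Fin.natAdd l = blockSwap k l ∘ Fin.castAdd l := by
    funext i
    simp [blockSwap]
  rw [wedge_apply, wedge_apply, altSum_cast, mul_left_comm, ← altSum_comp_perm, mul_comm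
    (l.factorial : ℝ)]
  simp only [Function.comp_assoc, h1, h2, mul_comm (β _)]

theorem wedge_add_left (α α' : V [⋀^Fin k]→L[ℝ] ℝ) (β : V [⋀^Fin l]→L[ℝ] ℝ) :
    (α + α') ⋏ β = α ⋏ β + α' ⋏ β := by
  ext v
  simp [wedge_apply, altSum, add_mul, mul_add, Finset.sum_add_distrib]

theorem wedge_add_right (α : V [⋀^Fin k]→L[ℝ] ℝ) (β β' : V [⋀^Fin l]→L[ℝ] ℝ) :
    α ⋏ (β + β') = α ⋏ β + α ⋏ β' := by
  ext v
  simp [wedge_apply, altSum, mul_add, Finset.sum_add_distrib]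

theorem smul_wedge (c : ℝ) (α : V [⋀^Fin k]→L[ℝ] ℝ) (β : V [⋀^Fin l]→L[ℝ] ℝ) :
    (c • α) ⋏ β = c • (α ⋏ β) := by
  ext v
  simp only [wedge_apply, ContinuousAlternatingMap.smul_apply, smul_eq_mul, mul_assoc,
    altSum_const_mul]
  ring

theorem wedge_smul (c : ℝ) (α : V [⋀^Fin k]→L[ℝ] ℝ) (β : V [⋀^Fin l]→L[ℝ] ℝ) :
    α ⋏ (c • β) = c • (α ⋏ β) := by
  ext v
  simp only [wedge_apply, ContinuousAlternatingMap.smul_apply, smul_eq_mul, mul_left_comm _ c,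
    altSum_const_mul]

theorem neg_wedge (α : V [⋀^Fin k]→L[ℝ] ℝ) (β : V [⋀^Fin l]→L[ℝ] ℝ) :
    (-α) ⋏ β = -(α ⋏ β) := by
  have h : -α = (-1 : ℝ) • α := by ext; simp
  ext v
  simp [h, smul_wedge]

theorem wedge_neg (α : V [⋀^Fin k]→L[ℝ] ℝ) (β : V [⋀^Fin l]→L[ℝ] ℝ) :
    α ⋏ (-β) = -(α ⋏ β) := by
  have h : -β = (-1 : ℝ) • β := by ext; simp
  ext v
  simp [h, wedge_smul]

theorem zero_wedge (β : V [⋀^Fin l]→L[ℝ] ℝ) : (0 : V [⋀^Fin k]→L[ℝ] ℝ) ⋏ β = 0 := by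
  rw [← zero_smul ℝ (0 : V [⋀^Fin k]→L[ℝ] ℝ), smul_wedge, zero_smul]

theorem wedge_zero (α : V [⋀^Fin k]→L[ℝ] ℝ) : α ⋏ (0 : V [⋀^Fin l]→L[ℝ] ℝ) = 0 := by
  rw [← zero_smul ℝ (0 : V [⋀^Fin l]→L[ℝ] ℝ), wedge_smul, zero_smul]

/-- Pullback by a linear map is multiplicative. -/
theorem wedge_compContinuousLinearMap {V' : Type*} [AddCommGroup V'] [Module ℝ V']
    [TopologicalSpace V']
    (α : V [⋀^Fin k]→L[ℝ] ℝ) (β : V [⋀^Fin l]→L[ℝ] ℝ) (L : V' →L[ℝ] V) :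
    (α ⋏ β).compContinuousLinearMap L =
      α.compContinuousLinearMap L ⋏ β.compContinuousLinearMap L := by
  ext v
  rw [ContinuousAlternatingMap.compContinuousLinearMap_apply, wedge_apply, wedge_apply]
  rfl

/-- Transport of a form along an equality of degrees. For numerals it is the identity by `rfl`. -/
def degCast {m n : ℕ} (h : m = n) (α : V [⋀^Fin m]→L[ℝ] ℝ) : V [⋀^Fin n]→L[ℝ] ℝ := h ▸ α

theorem degCast_apply {m n : ℕ} (h : m = n) (α : V [⋀^Fin m]→L[ℝ] ℝ) (v : Fin n → V) :
    degCast h α v = α (v ∘ Fin.cast h) := by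
  subst h; rfl

theorem wedge_assoc (h : k + (l + m) = k + l + m) (α : V [⋀^Fin k]→L[ℝ] ℝ)
    (β : V [⋀^Fin l]→L[ℝ] ℝ) (γ : V [⋀^Fin m]→L[ℝ] ℝ) :
    α ⋏ β ⋏ γ = degCast h (α ⋏ (β ⋏ γ)) := by
  ext v
  rw [wedge_assoc_apply, degCast_apply]

theorem wedge_comm (h : l + k = k + l) (α : V [⋀^Fin k]→L[ℝ] ℝ) (β : V [⋀^Fin l]→L[ℝ] ℝ) :
    degCast h (β ⋏ α) = ((Equiv.Perm.sign (blockSwap k l) : ℤ) : ℝ) • (α ⋏ β) := by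
  ext v
  rw [degCast_apply, wedge_comm_apply, ContinuousAlternatingMap.smul_apply, smul_eq_mul]

theorem wedge_comm_one_one (α β : V [⋀^Fin 1]→L[ℝ] ℝ) :
    (β ⋏ α : V [⋀^Fin 2]→L[ℝ] ℝ) = -(α ⋏ β) := by
  have hs : Equiv.Perm.sign (blockSwap 1 1) = -1 := by
    rw [show blockSwap 1 1 = finRotate 2 by ext i; fin_cases i <;> rfl, sign_finRotate]
    simp
  refine (wedge_comm rfl α β).trans ?_
  rw [hs]
  ext v
  simp

theorem wedge_comm_two_one (α : V [⋀^Fin 1]→L[ℝ] ℝ) (β : V [⋀^Fin 2]→L[ℝ] ℝ) :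
    (β ⋏ α : V [⋀^Fin 3]→L[ℝ] ℝ) = α ⋏ β := by
  have hs : Equiv.Perm.sign (blockSwap 1 2) = 1 := by
    rw [show blockSwap 1 2 = (finRotate 3)⁻¹ by ext i; fin_cases i <;> rfl,
      Equiv.Perm.sign_inv, sign_finRotate]
    rfl
  refine (wedge_comm (k := 1) (l := 2) rfl α β).trans ?_
  rw [hs]
  ext v
  simp

theorem wedge_self_one (α : V [⋀^Fin 1]→L[ℝ] ℝ) : (α ⋏ α : V [⋀^Fin 2]→L[ℝ] ℝ) = 0 := by
  ext v
  have h := congrArg (· v) (wedge_comm_one_one α α)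
  simp only [ContinuousAlternatingMap.neg_apply] at h
  exact self_eq_neg.mp h

/-! Identities in the degrees that occur below; as the degrees are numerals, both sides have the
same type. -/

section LowDegree

variable (τ ξ η : V [⋀^Fin 1]→L[ℝ] ℝ) (α β : V [⋀^Fin 2]→L[ℝ] ℝ)

theorem one_one_wedge_two : (τ ⋏ ξ ⋏ α : V [⋀^Fin 4]→L[ℝ] ℝ) = τ ⋏ (α ⋏ ξ) := by
  rw [wedge_comm_two_one]
  exact wedge_assoc rfl τ ξ α

theorem wedge_two_wedge_self : (τ ⋏ (α ⋏ τ) : V [⋀^Fin 4]→L[ℝ] ℝ) = 0 := by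
  rw [← one_one_wedge_two, wedge_self_one]
  exact zero_wedge α

theorem wedge_one_wedge_self : (τ ⋏ (ξ ⋏ τ) : V [⋀^Fin 3]→L[ℝ] ℝ) = 0 := by
  have h : (τ ⋏ (ξ ⋏ τ) : V [⋀^Fin 3]→L[ℝ] ℝ) = τ ⋏ -(τ ⋏ ξ) := by
    rw [wedge_comm_one_one]
  rw [h, wedge_neg]
  have h' : (τ ⋏ (τ ⋏ ξ) : V [⋀^Fin 3]→L[ℝ] ℝ) = τ ⋏ τ ⋏ ξ := (wedge_assoc rfl τ τ ξ).symm
  rw [h', wedge_self_one]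
  ext v
  rw [zero_wedge]
  simp

theorem one_two_wedge_one_self : (τ ⋏ α ⋏ (ξ ⋏ τ) : V [⋀^Fin 5]→L[ℝ] ℝ) = 0 := by
  rw [← wedge_comm_two_one]
  have h : (α ⋏ τ ⋏ (ξ ⋏ τ) : V [⋀^Fin 5]→L[ℝ] ℝ) = α ⋏ (τ ⋏ (ξ ⋏ τ)) :=
    wedge_assoc rfl α τ (ξ ⋏ τ)
  rw [h, wedge_one_wedge_self]
  exact wedge_zero α

theorem wedge_two_wedge_one_self : (τ ⋏ (α ⋏ (ξ ⋏ τ)) : V [⋀^Fin 5]→L[ℝ] ℝ) = 0 := by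
  have h : (τ ⋏ (α ⋏ (ξ ⋏ τ)) : V [⋀^Fin 5]→L[ℝ] ℝ) = τ ⋏ α ⋏ (ξ ⋏ τ) :=
    (wedge_assoc rfl τ α (ξ ⋏ τ)).symm
  rw [h, one_two_wedge_one_self]

theorem two_wedge_two_one : (α ⋏ (β ⋏ τ) : V [⋀^Fin 5]→L[ℝ] ℝ) = α ⋏ β ⋏ τ :=
  (wedge_assoc rfl α β τ).symm

theorem two_wedge_one_two : (α ⋏ (τ ⋏ β) : V [⋀^Fin 5]→L[ℝ] ℝ) = α ⋏ β ⋏ τ := by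
  rw [← wedge_comm_two_one, two_wedge_two_one]

theorem one_wedge_two_two : (τ ⋏ (α ⋏ β) : V [⋀^Fin 5]→L[ℝ] ℝ) = α ⋏ β ⋏ τ := by
  have h : (τ ⋏ (α ⋏ β) : V [⋀^Fin 5]→L[ℝ] ℝ) = τ ⋏ α ⋏ β := (wedge_assoc rfl τ α β).symm
  have h' : (α ⋏ τ ⋏ β : V [⋀^Fin 5]→L[ℝ] ℝ) = α ⋏ (τ ⋏ β) := wedge_assoc rfl α τ β
  rw [h, ← wedge_comm_two_one, h', two_wedge_one_two]

end LowDegree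

end Ext

/-! ### The wedge product of forms on a normed space and the Leibniz rule -/

namespace Ext

variable {E : Type*} [NormedAddCommGroup E] [NormedSpace ℝ E] {k l n : ℕ}

theorem norm_wedge_apply_le (α : E [⋀^Fin k]→L[ℝ] ℝ) (β : E [⋀^Fin l]→L[ℝ] ℝ)
    (v : Fin (k + l) → E) :
    ‖(α ⋏ β) v‖ ≤ (((k.factorial : ℝ) * l.factorial)⁻¹ * (k + l).factorial) * ‖α‖ * ‖β‖ *
      ∏ i, ‖v i‖ := by
  rw [wedge_apply, norm_mul, altSum, Real.norm_of_nonneg (by positivity)]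
  have h : ∀ σ : Equiv.Perm (Fin (k + l)),
      ‖((Equiv.Perm.sign σ : ℤ) : ℝ) * (α ((v ∘ σ) ∘ Fin.castAdd l) *
        β ((v ∘ σ) ∘ Fin.natAdd k))‖ ≤ ‖α‖ * ‖β‖ * ∏ i, ‖v i‖ := by
    intro σ
    have hs : ‖((Equiv.Perm.sign σ : ℤ) : ℝ)‖ = 1 := by
      rcases Int.units_eq_one_or (Equiv.Perm.sign σ) with h | h <;> simp [h]
    rw [norm_mul, hs, one_mul, norm_mul, ← Equiv.prod_comp σ, Fin.prod_univ_add]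
    calc _ ≤ (‖α‖ * ∏ i, ‖((v ∘ σ) ∘ Fin.castAdd l) i‖) *
        (‖β‖ * ∏ i, ‖((v ∘ σ) ∘ Fin.natAdd k) i‖) :=
          mul_le_mul (α.le_opNorm _) (β.le_opNorm _) (norm_nonneg _) (by positivity)
      _ = _ := by simp only [Function.comp_apply]; ring
  calc _ ≤ ((k.factorial : ℝ) * l.factorial)⁻¹ *
      ∑ _σ : Equiv.Perm (Fin (k + l)), ‖α‖ * ‖β‖ * ∏ i, ‖v i‖ := by
        gcongr
        exact norm_sum_le_of_le _ fun σ _ => h σ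
    _ = _ := by
        rw [Finset.sum_const, Finset.card_univ, Fintype.card_perm, Fintype.card_fin, nsmul_eq_mul]
        ring

theorem isBoundedBilinearMap_wedge (E : Type*) [NormedAddCommGroup E] [NormedSpace ℝ E]
    (k l : ℕ) : IsBoundedBilinearMap ℝ
      (fun p : (E [⋀^Fin k]→L[ℝ] ℝ) × (E [⋀^Fin l]→L[ℝ] ℝ) => p.1 ⋏ p.2) where
  add_left := wedge_add_left
  smul_left := smul_wedge
  add_right := wedge_add_right
  smul_right := wedge_smul
  bound := ⟨((k.factorial : ℝ) * l.factorial)⁻¹ * (k + l).factorial, by positivity,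
    fun α β => ContinuousAlternatingMap.opNorm_le_bound _ (by positivity)
      (norm_wedge_apply_le α β)⟩

theorem _root_.ContDiffAt.wedge {F : Type*} [NormedAddCommGroup F] [NormedSpace ℝ F]
    {r : WithTop ℕ∞} {α : F → E [⋀^Fin k]→L[ℝ] ℝ} {β : F → E [⋀^Fin l]→L[ℝ] ℝ} {x : F}
    (hα : ContDiffAt ℝ r α x) (hβ : ContDiffAt ℝ r β x) :
    ContDiffAt ℝ r (fun y => α y ⋏ β y) x := by
  have h₁ : ContDiff ℝ r
      (fun p : (E [⋀^Fin k]→L[ℝ] ℝ) × (E [⋀^Fin l]→L[ℝ] ℝ) => p.1 ⋏ p.2) :=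
    (isBoundedBilinearMap_wedge E k l).contDiff
  have h₂ : ContDiffAt ℝ r (fun y => (α y, β y)) x := hα.prodMk hβ
  have h₃ := h₁.contDiffAt (x := (α x, β x))
  have h₄ := ContDiffAt.comp
    (g := fun p : (E [⋀^Fin k]→L[ℝ] ℝ) × (E [⋀^Fin l]→L[ℝ] ℝ) => p.1 ⋏ p.2) x h₃ h₂
  exact h₄

/-- In terms of antisymmetrisations, `alternatizeUncurryFin` antisymmetrises over all
`n + 1` arguments. -/
theorem alternatizeUncurryFin_eq_altSum (g : E →L[ℝ] E [⋀^Fin n]→L[ℝ] ℝ) (v : Fin (n + 1) → E) :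
    ContinuousAlternatingMap.alternatizeUncurryFin g v =
      (n.factorial : ℝ)⁻¹ * altSum (fun w => g (w 0) (w ∘ Fin.succ)) v := by
  have h1 : ∀ w : Fin (n + 1) → E, ContinuousAlternatingMap.alternatizeUncurryFin g w =
      ∑ p : Fin (n + 1), ((Equiv.Perm.sign (p.cycleRange)⁻¹ : ℤ) : ℝ) *
        g ((w ∘ ⇑(p.cycleRange)⁻¹) 0) ((w ∘ ⇑(p.cycleRange)⁻¹) ∘ Fin.succ) := by
    intro w
    rw [ContinuousAlternatingMap.alternatizeUncurryFin_apply]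
    refine Finset.sum_congr rfl fun p _ => ?_
    have h0 : (w ∘ ⇑(p.cycleRange)⁻¹) 0 = w p := by
      simp [Equiv.Perm.inv_def]
    have h2 : (w ∘ ⇑(p.cycleRange)⁻¹) ∘ Fin.succ = p.removeNth w := by
      funext i
      simp [Equiv.Perm.inv_def, Fin.removeNth_apply]
    rw [h0, h2, Equiv.Perm.sign_inv, Fin.sign_cycleRange]
    simp
  have h3 := altSum_alternating (ContinuousAlternatingMap.alternatizeUncurryFin g) v
  have h4 : altSum (fun w => ContinuousAlternatingMap.alternatizeUncurryFin g w) v =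
      (n + 1) * altSum (fun w => g (w 0) (w ∘ Fin.succ)) v := by
    simp only [h1]
    rw [altSum_sum]
    simp only [altSum_const_mul]
    have h5 : ∀ p : Fin (n + 1), ((Equiv.Perm.sign (p.cycleRange)⁻¹ : ℤ) : ℝ) *
        altSum (fun w : Fin (n + 1) → E => g ((w ∘ ⇑(p.cycleRange)⁻¹) 0)
          ((w ∘ ⇑(p.cycleRange)⁻¹) ∘ Fin.succ)) v =
        altSum (fun w => g (w 0) (w ∘ Fin.succ)) v := by
      intro p
      rw [altSum_comp_perm (fun w : Fin (n + 1) → E => g (w 0) (w ∘ Fin.succ)), ← mul_assoc,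
        ← Int.cast_mul, ← Units.val_mul, Int.units_mul_self]
      simp
    rw [Finset.sum_congr rfl fun p _ => h5 p]
    simp
  rw [h4, Nat.factorial_succ] at h3
  have hn : (n.factorial : ℝ) ≠ 0 := by positivity
  have hn' : (n + 1 : ℝ) ≠ 0 := by positivity
  push_cast at h3
  rw [mul_assoc] at h3
  rw [mul_left_cancel₀ hn' h3]
  field_simp

theorem cycleRange_castAdd (i : Fin k) :
    Fin.cycleRange (⟨k, by omega⟩ : Fin (k + l + 1)) (Fin.castAdd (l + 1) i) =
      (Fin.castAdd l i).succ := by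
  rw [Fin.cycleRange_of_lt (Fin.lt_def.2 i.2)]
  ext
  rw [Fin.val_add_one_of_lt' (by simp only [Fin.val_castAdd]; omega)]
  simp

theorem cycleRange_natAdd_succ (i : Fin l) :
    Fin.cycleRange (⟨k, by omega⟩ : Fin (k + l + 1)) (Fin.natAdd k i.succ) =
      (Fin.natAdd k i).succ := by
  rw [Fin.cycleRange_of_gt (Fin.lt_def.2 (by simp))]
  ext
  simp [Nat.add_assoc]

/-- The Leibniz rule `d(α ∧ β) = dα ∧ β + (-1)^k α ∧ dβ`. -/
theorem extDeriv_wedge (h : k + 1 + l = k + l + 1) {α : E → E [⋀^Fin k]→L[ℝ] ℝ}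
    {β : E → E [⋀^Fin l]→L[ℝ] ℝ} {x : E}
    (hα : DifferentiableAt ℝ α x) (hβ : DifferentiableAt ℝ β x) :
    extDeriv (fun y => α y ⋏ β y) x =
      degCast h (extDeriv α x ⋏ β x) + (-1 : ℝ) ^ k • (α x ⋏ extDeriv β x) := by
  have hd : ∀ u : E, fderiv ℝ (fun y => α y ⋏ β y) x u =
      fderiv ℝ α x u ⋏ β x + α x ⋏ fderiv ℝ β x u := by
    intro u
    have := ((isBoundedBilinearMap_wedge E k l).hasFDerivAt (α x, β x)).comp x
      (hα.hasFDerivAt.prodMk hβ.hasFDerivAt)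
    have h' : HasFDerivAt (fun y => α y ⋏ β y) _ x := this
    rw [h'.fderiv]
    simp [IsBoundedBilinearMap.deriv_apply, add_comm]
  have hk : (k.factorial : ℝ) ≠ 0 := by positivity
  have hl : (l.factorial : ℝ) ≠ 0 := by positivity
  have hkl : ((k + l).factorial : ℝ) ≠ 0 := by positivity
  set A := fderiv ℝ α x with hA
  set B := fderiv ℝ β x with hB
  ext v
  have e0 : (fun w : Fin (k + l + 1) → E =>
      fderiv ℝ (fun y => α y ⋏ β y) x (w 0) (w ∘ Fin.succ)) = fun w =>
      ((k.factorial : ℝ) * l.factorial)⁻¹ *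
        (altSum (fun u => A (w 0) (u ∘ Fin.castAdd l) * β x (u ∘ Fin.natAdd k)) (w ∘ Fin.succ) +
        altSum (fun u => α x (u ∘ Fin.castAdd l) * B (w 0) (u ∘ Fin.natAdd k))
          (w ∘ Fin.succ)) := by
    funext w
    rw [hd, ContinuousAlternatingMap.add_apply, wedge_apply, wedge_apply]
    ring
  -- both terms are antisymmetrisations over the last `k + l` arguments of a function of all
  -- `k + l + 1` arguments, so the inner antisymmetrisation is absorbed by the outer one
  have e1 := altSum_block (Fin.succEmb (k + l)) (fun w : Fin (k + l + 1) → E =>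
    A (w 0) (w ∘ Fin.succ ∘ Fin.castAdd l) * β x (w ∘ Fin.succ ∘ Fin.natAdd k)) v
  have e2 := altSum_block (Fin.succEmb (k + l)) (fun w : Fin (k + l + 1) → E =>
    α x (w ∘ Fin.succ ∘ Fin.castAdd l) * B (w 0) (w ∘ Fin.succ ∘ Fin.natAdd k)) v
  have hz : ∀ (w : Fin (k + l + 1) → E) (τ : Equiv.Perm (Fin (k + l))),
      (w ∘ ⇑(τ.viaFintypeEmbedding (Fin.succEmb (k + l)))) 0 = w 0 := by
    intro w τ
    have := congrFun (viaFintypeEmbedding_comp_of_disjoint (Fin.succEmb (k + l))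
      (fun _ : Fin 1 => 0) (fun a _ => Fin.succ_ne_zero a) τ) 0
    exact congrArg w this
  have hsucc : ∀ (w : Fin (k + l + 1) → E) (τ : Equiv.Perm (Fin (k + l))),
      (w ∘ ⇑(τ.viaFintypeEmbedding (Fin.succEmb (k + l)))) ∘ Fin.succ = (w ∘ Fin.succ) ∘ τ := by
    intro w τ
    have := viaFintypeEmbedding_comp (Fin.succEmb (k + l)) τ
    rw [Fin.coe_succEmb] at this
    rw [Function.comp_assoc, this]
    rfl
  simp only [hz, ← Function.comp_assoc, hsucc] at e1 e2
  have e3 : ∀ f g : (Fin (k + l + 1) → E) → ℝ,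
      altSum (fun w => f w + g w) v = altSum f v + altSum g v := by
    intro f g
    simp [altSum, mul_add, Finset.sum_add_distrib]
  have e4 := alternatizeUncurryFin_eq_altSum A
  have e5 := alternatizeUncurryFin_eq_altSum B
  rw [show extDeriv α x = ContinuousAlternatingMap.alternatizeUncurryFin A from rfl,
    show extDeriv β x = ContinuousAlternatingMap.alternatizeUncurryFin B from rfl,
    extDeriv, alternatizeUncurryFin_eq_altSum, e0, altSum_const_mul, e3,
    ContinuousAlternatingMap.add_apply, degCast_apply, ContinuousAlternatingMap.smul_apply,
    wedge_apply_of_altSum (f := fun w => A (w 0) (w ∘ Fin.succ)) e4 (apply_eq_altSum (β x)),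
    wedge_apply_of_altSum (g := fun w => B (w 0) (w ∘ Fin.succ)) (apply_eq_altSum (α x)) e5,
    altSum_cast]
  refine (congrArg₂ (fun a b => ((k + l).factorial : ℝ)⁻¹ *
    (((k.factorial : ℝ) * l.factorial)⁻¹ * (a + b))) e1 e2).trans ?_
  -- moving the argument of `B` past the `k` arguments of `α` costs the sign `(-1) ^ k`
  have e6 := altSum_comp_perm (fun w : Fin (k + l + 1) → E => α x (w ∘ Fin.castAdd (l + 1)) *
    B (w (Fin.natAdd k (0 : Fin (l + 1)))) ((w ∘ Fin.natAdd k) ∘ Fin.succ))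
      (Fin.cycleRange ⟨k, by omega⟩) v
  rw [Fin.sign_cycleRange] at e6
  have e7 : (fun w : Fin (k + l + 1) → E => α x ((w ∘ Fin.succ) ∘ Fin.castAdd l) *
      B (w 0) ((w ∘ Fin.succ) ∘ Fin.natAdd k)) = fun w =>
      α x ((w ∘ Fin.cycleRange ⟨k, by omega⟩) ∘ Fin.castAdd (l + 1)) *
    B ((w ∘ Fin.cycleRange ⟨k, by omega⟩) (Fin.natAdd k (0 : Fin (l + 1))))
      (((w ∘ Fin.cycleRange ⟨k, by omega⟩) ∘ Fin.natAdd k) ∘ Fin.succ) := by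
    funext w
    have c1 : (w ∘ Fin.cycleRange ⟨k, by omega⟩) ∘ Fin.castAdd (l + 1) =
        (w ∘ Fin.succ) ∘ Fin.castAdd l := funext fun i => congrArg w (cycleRange_castAdd i)
    have c2 : (w ∘ Fin.cycleRange ⟨k, by omega⟩) (Fin.natAdd k (0 : Fin (l + 1))) =
        w 0 :=
      congrArg w (Fin.cycleRange_self _)
    have c3 : ((w ∘ Fin.cycleRange ⟨k, by omega⟩) ∘ Fin.natAdd k) ∘ Fin.succ =
        (w ∘ Fin.succ) ∘ Fin.natAdd k := funext fun i => congrArg w (cycleRange_natAdd_succ i)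
    rw [c1, c2, c3]
  have e8 : (fun w : Fin (k + l + 1) → E => A (w 0) ((w ∘ Fin.succ) ∘ Fin.castAdd l) *
      β x ((w ∘ Fin.succ) ∘ Fin.natAdd k)) = fun w =>
      A ((w ∘ Fin.cast h) ∘ Fin.castAdd l <| 0) (((w ∘ Fin.cast h) ∘ Fin.castAdd l) ∘ Fin.succ) *
        β x ((w ∘ Fin.cast h) ∘ Fin.natAdd (k + 1)) := by
    funext w
    have c1 : (w ∘ Fin.cast h) ∘ Fin.natAdd (k + 1) = (w ∘ Fin.succ) ∘ Fin.natAdd k := by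
      funext i
      simp only [Function.comp_apply]
      congr 1
      ext
      simp only [Fin.val_cast, Fin.val_natAdd, Fin.val_succ]
      omega
    rw [c1]
    rfl
  have e9 : altSum (fun w : Fin (k + l + 1) → E => α x ((w ∘ Fin.succ) ∘ Fin.castAdd l) *
      B (w 0) ((w ∘ Fin.succ) ∘ Fin.natAdd k)) v = (-1 : ℝ) ^ k *
      altSum (fun w : Fin (k + (l + 1)) → E => α x (w ∘ Fin.castAdd (l + 1)) *
        B ((w ∘ Fin.natAdd k) 0) ((w ∘ Fin.natAdd k) ∘ Fin.succ)) v := by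
    refine (congrArg (altSum · v) e7).trans (e6.trans ?_)
    push_cast
    rfl
  rw [e9, e8, smul_eq_mul]
  field_simp

/-- The Leibniz rule for the product of a function and a form. -/
theorem extDeriv_smul_fun (h : 1 + k = k + 1) {g : E → ℝ} {α : E → E [⋀^Fin k]→L[ℝ] ℝ} {x : E}
    {g' : E →L[ℝ] ℝ} (hg : HasFDerivAt g g' x) (hα : DifferentiableAt ℝ α x) :
    extDeriv (fun y => g y • α y) x =
      degCast h (ContinuousAlternatingMap.ofSubsingleton ℝ E ℝ (0 : Fin 1) g' ⋏ α x) +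
        g x • extDeriv α x := by
  have hd : fderiv ℝ (fun y => g y • α y) x = g x • fderiv ℝ α x + g'.smulRight (α x) :=
    (hg.smul hα.hasFDerivAt).fderiv
  rw [extDeriv, hd, ContinuousAlternatingMap.alternatizeUncurryFin_add,
    ContinuousAlternatingMap.alternatizeUncurryFin_smul, add_comm (g x • _), extDeriv]
  congr 1
  ext v
  rw [alternatizeUncurryFin_eq_altSum, degCast_apply, wedge_apply, altSum_cast]
  congr 1
  · simp
  · congr 1
    funext w
    have h1 : (w ∘ Fin.cast h) ∘ Fin.natAdd 1 = w ∘ Fin.succ := by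
      funext i
      simp only [Function.comp_apply]
      congr 1
      ext
      simp
    rw [h1]
    rfl

end Ext

/-! ### Elementary forms on `ℝ⁷` and the model `G₂` structure -/

/-- The factor `1` gives the identity the shape expected by `Ext.wedge_apply_of_altSum`. -/
theorem elemForm_apply {k : ℕ} (a : Fin k → Fin 7) (v : Fin k → Fin 7 → ℝ) :
    elemForm a v = 1 * altSum (fun w : Fin k → Fin 7 → ℝ => ∏ i, w i (a i)) v := by
  rw [elemForm, Ext.alternatization_eq_altSum, one_mul]
  rfl

theorem elemForm_wedge {k l : ℕ} (a : Fin k → Fin 7) (b : Fin l → Fin 7) :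
    elemForm a ⋏ elemForm b = elemForm (Fin.append a b) := by
  ext v
  rw [Ext.wedge_apply_of_altSum (elemForm_apply a) (elemForm_apply b), elemForm_apply, one_mul]
  simp only [Fin.prod_univ_add, Fin.append_left, Fin.append_right]
  rfl

theorem elemForm_apply_det {k : ℕ} (a : Fin k → Fin 7) (v : Fin k → Fin 7 → ℝ) :
    elemForm a v = Matrix.det (Matrix.of fun i j => v i (a j)) := by
  rw [elemForm_apply, one_mul, altSum, Matrix.det_apply']
  rfl

theorem elemForm_three (a b c : Fin 7) (v : Fin 3 → Fin 7 → ℝ) :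
    elemForm ![a, b, c] v =
      v 0 a * v 1 b * v 2 c - v 0 a * v 1 c * v 2 b - v 0 b * v 1 a * v 2 c
        + v 0 b * v 1 c * v 2 a + v 0 c * v 1 a * v 2 b - v 0 c * v 1 b * v 2 a := by
  rw [elemForm_apply_det, Matrix.det_fin_three]
  rfl

theorem elemForm_four (a b c d : Fin 7) (v : Fin 4 → Fin 7 → ℝ) :
    elemForm ![a, b, c, d] v =
      v 0 a * elemForm ![b, c, d] ![v 1, v 2, v 3] - v 0 b * elemForm ![a, c, d] ![v 1, v 2, v 3]
        + v 0 c * elemForm ![a, b, d] ![v 1, v 2, v 3]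
        - v 0 d * elemForm ![a, b, c] ![v 1, v 2, v 3] := by
  rw [elemForm_apply_det, Matrix.det_succ_row_zero]
  simp only [elemForm_three]
  simp [Fin.sum_univ_succ, Matrix.det_fin_three, Fin.succAbove]
  ring

theorem elemForm_one_one (a b : Fin 7) : (elemForm ![a] ⋏ elemForm ![b] :
    (Fin 7 → ℝ) [⋀^Fin 2]→L[ℝ] ℝ) = elemForm ![a, b] :=
  (elemForm_wedge _ _).trans (congrArg elemForm (by ext i; fin_cases i <;> rfl))

theorem elemForm_two_one (a b c : Fin 7) : (elemForm ![a, b] ⋏ elemForm ![c] :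
    (Fin 7 → ℝ) [⋀^Fin 3]→L[ℝ] ℝ) = elemForm ![a, b, c] :=
  (elemForm_wedge _ _).trans (congrArg elemForm (by ext i; fin_cases i <;> rfl))

theorem elemForm_one_one_one (a b c : Fin 7) : (elemForm ![a] ⋏ elemForm ![b] ⋏ elemForm ![c] :
    (Fin 7 → ℝ) [⋀^Fin 3]→L[ℝ] ℝ) = elemForm ![a, b, c] := by
  rw [elemForm_one_one]
  exact elemForm_two_one a b c

theorem elemForm_two_two (a b c d : Fin 7) : (elemForm ![a, b] ⋏ elemForm ![c, d] :
    (Fin 7 → ℝ) [⋀^Fin 4]→L[ℝ] ℝ) = elemForm ![a, b, c, d] :=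
  (elemForm_wedge _ _).trans (congrArg elemForm (by ext i; fin_cases i <;> rfl))

namespace G2Model

/-- `dx₄₅ + dx₆₇`, the factor of `dx₁` in `φ₀`. -/
def σ₁ : (Fin 7 → ℝ) [⋀^Fin 2]→L[ℝ] ℝ := elemForm ![3, 4] + elemForm ![5, 6]

/-- `dx₄₆ - dx₅₇`, the factor of `dx₂` in `φ₀`. -/
def σ₂ : (Fin 7 → ℝ) [⋀^Fin 2]→L[ℝ] ℝ := elemForm ![3, 5] - elemForm ![4, 6]

/-- `dx₄₇ + dx₅₆`, the opposite of the factor of `dx₃` in `φ₀`. -/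
def σ₃ : (Fin 7 → ℝ) [⋀^Fin 2]→L[ℝ] ℝ := elemForm ![3, 6] + elemForm ![4, 5]

/-- `dx₄₅ - dx₆₇`, a form of the orientation opposite to that of `σ₁`, `σ₂`, `σ₃`. -/
def σ₀ : (Fin 7 → ℝ) [⋀^Fin 2]→L[ℝ] ℝ := elemForm ![3, 4] - elemForm ![5, 6]

theorem sub_wedge {k l : ℕ} {V : Type*} [AddCommGroup V] [Module ℝ V] [TopologicalSpace V]
    (α α' : V [⋀^Fin k]→L[ℝ] ℝ) (β : V [⋀^Fin l]→L[ℝ] ℝ) :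
    (α - α') ⋏ β = α ⋏ β - α' ⋏ β := by
  rw [sub_eq_add_neg, Ext.wedge_add_left, Ext.neg_wedge, ← sub_eq_add_neg]

theorem phi0_eq : phi0 = σ₁ ⋏ elemForm ![0] - elemForm ![2] ⋏ elemForm ![1] ⋏ elemForm ![0]
    + σ₂ ⋏ elemForm ![1] - σ₃ ⋏ elemForm ![2] := by
  rw [elemForm_one_one_one]
  ext v
  rw [σ₁, σ₂, σ₃, Ext.wedge_add_left, Ext.wedge_add_left, sub_wedge]
  simp only [elemForm_two_one]
  simp only [phi0, ContinuousAlternatingMap.add_apply, ContinuousAlternatingMap.sub_apply,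
    elemForm_three]
  erw [elemForm_three 2 1 0 v]
  ring

theorem starPhi0_eq : starPhi0 = (1 / 2 : ℝ) • (σ₂ ⋏ σ₂)
    + σ₁ ⋏ (elemForm ![1] ⋏ elemForm ![2]) - σ₂ ⋏ (elemForm ![0] ⋏ elemForm ![2])
    - σ₃ ⋏ (elemForm ![0] ⋏ elemForm ![1]) := by
  ext v
  simp only [σ₁, σ₂, σ₃, sub_eq_add_neg, Ext.wedge_add_left, Ext.wedge_add_right, Ext.neg_wedge,
    Ext.wedge_neg, elemForm_one_one]
  simp only [elemForm_two_two]
  simp only [starPhi0, ContinuousAlternatingMap.add_apply, ContinuousAlternatingMap.sub_apply,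
    ContinuousAlternatingMap.neg_apply, ContinuousAlternatingMap.smul_apply, smul_eq_mul,
    elemForm_four, elemForm_three]
  simp
  ring

variable {V : Type*} [AddCommGroup V] [Module ℝ V] [TopologicalSpace V]

/-- `φ₀` in the coframe `η / t, ξ / s, -t s τ`, completed by a coframe in which `σ₁`, `σ₂`, `σ₃`
are `t ω₁`, `t s ω₂`, `t s ω₃`. The powers of `t` and `s` are forced by the coefficients of `φ`. -/
theorem phi0_comp (L : V →L[ℝ] (Fin 7 → ℝ)) {t s : ℝ} (ht : 0 < t) (hs : 0 < s)
    {τ ξ η : V [⋀^Fin 1]→L[ℝ] ℝ} {ω₁ ω₂ ω₃ : V [⋀^Fin 2]→L[ℝ] ℝ}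
    (hη : (elemForm ![0]).compContinuousLinearMap L = t⁻¹ • η)
    (hξ : (elemForm ![1]).compContinuousLinearMap L = s⁻¹ • ξ)
    (hτ : (elemForm ![2]).compContinuousLinearMap L = (-(t * s)) • τ)
    (h₁ : σ₁.compContinuousLinearMap L = t • ω₁)
    (h₂ : σ₂.compContinuousLinearMap L = (t * s) • ω₂)
    (h₃ : σ₃.compContinuousLinearMap L = (t * s) • ω₃) :
    ω₁ ⋏ η + τ ⋏ ξ ⋏ η + t • (ω₂ ⋏ ξ + (t * s ^ 2) • (ω₃ ⋏ τ)) =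
      phi0.compContinuousLinearMap L := by
  have e₁ : (σ₁ ⋏ elemForm ![0]).compContinuousLinearMap L = ω₁ ⋏ η := by
    rw [Ext.wedge_compContinuousLinearMap, h₁, hη, Ext.smul_wedge, Ext.wedge_smul, smul_smul,
      mul_inv_cancel₀ ht.ne', one_smul]
  have e₂ : (σ₂ ⋏ elemForm ![1]).compContinuousLinearMap L = t • (ω₂ ⋏ ξ) := by
    rw [Ext.wedge_compContinuousLinearMap, h₂, hξ, Ext.smul_wedge, Ext.wedge_smul, smul_smul]
    congr 1
    field_simp
  have e₃ : (σ₃ ⋏ elemForm ![2]).compContinuousLinearMap L =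
      (-(t * (t * s ^ 2))) • (ω₃ ⋏ τ) := by
    rw [Ext.wedge_compContinuousLinearMap, h₃, hτ, Ext.smul_wedge, Ext.wedge_smul, smul_smul]
    congr 1
    ring
  have e₄ : (elemForm ![2] ⋏ elemForm ![1] ⋏ elemForm ![0]).compContinuousLinearMap L =
      (-1 : ℝ) • (τ ⋏ ξ ⋏ η) := by
    rw [Ext.wedge_compContinuousLinearMap, Ext.wedge_compContinuousLinearMap, hη, hξ, hτ,
      Ext.smul_wedge, Ext.smul_wedge, Ext.wedge_smul, Ext.wedge_smul, Ext.smul_wedge, smul_smul,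
      smul_smul]
    congr 1
    field_simp
  have e : phi0.compContinuousLinearMap L = (σ₁ ⋏ elemForm ![0]).compContinuousLinearMap L -
      (elemForm ![2] ⋏ elemForm ![1] ⋏ elemForm ![0]).compContinuousLinearMap L +
      (σ₂ ⋏ elemForm ![1]).compContinuousLinearMap L -
      (σ₃ ⋏ elemForm ![2]).compContinuousLinearMap L := by
    rw [phi0_eq]; rfl
  rw [e, e₁, e₂, e₃, e₄]
  ext v
  simp only [ContinuousAlternatingMap.add_apply, ContinuousAlternatingMap.sub_apply,
    ContinuousAlternatingMap.smul_apply, smul_eq_mul]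
  ring

/-- `*φ₀` in the coframe of `phi0_comp`. -/
theorem starPhi0_comp (L : V →L[ℝ] (Fin 7 → ℝ)) {t s : ℝ} (ht : 0 < t) (hs : 0 < s)
    {τ ξ η : V [⋀^Fin 1]→L[ℝ] ℝ} {ω₁ ω₂ ω₃ : V [⋀^Fin 2]→L[ℝ] ℝ}
    (hη : (elemForm ![0]).compContinuousLinearMap L = t⁻¹ • η)
    (hξ : (elemForm ![1]).compContinuousLinearMap L = s⁻¹ • ξ)
    (hτ : (elemForm ![2]).compContinuousLinearMap L = (-(t * s)) • τ)
    (h₁ : σ₁.compContinuousLinearMap L = t • ω₁)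
    (h₂ : σ₂.compContinuousLinearMap L = (t * s) • ω₂)
    (h₃ : σ₃.compContinuousLinearMap L = (t * s) • ω₃) :
    (t ^ 2 * s ^ 2 / 2) • (ω₂ ⋏ ω₂) - t ^ 2 • (ω₁ ⋏ (ξ ⋏ τ)) + (t * s ^ 2) • (ω₂ ⋏ (η ⋏ τ))
      - ω₃ ⋏ (η ⋏ ξ) = starPhi0.compContinuousLinearMap L := by
  have e₀ : (σ₂ ⋏ σ₂).compContinuousLinearMap L = (t ^ 2 * s ^ 2) • (ω₂ ⋏ ω₂) := by
    rw [Ext.wedge_compContinuousLinearMap, h₂, Ext.smul_wedge, Ext.wedge_smul, smul_smul]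
    congr 1
    ring
  have e₁ : (σ₁ ⋏ (elemForm ![1] ⋏ elemForm ![2])).compContinuousLinearMap L =
      (-t ^ 2) • (ω₁ ⋏ (ξ ⋏ τ)) := by
    rw [Ext.wedge_compContinuousLinearMap, Ext.wedge_compContinuousLinearMap, h₁, hξ, hτ]
    simp only [Ext.smul_wedge, Ext.wedge_smul, smul_smul]
    congr 1
    field_simp
  have e₂ : (σ₂ ⋏ (elemForm ![0] ⋏ elemForm ![2])).compContinuousLinearMap L =
      (-(t * s ^ 2)) • (ω₂ ⋏ (η ⋏ τ)) := by
    rw [Ext.wedge_compContinuousLinearMap, Ext.wedge_compContinuousLinearMap, h₂, hη, hτ]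
    simp only [Ext.smul_wedge, Ext.wedge_smul, smul_smul]
    congr 1
    field_simp
  have e₃ : (σ₃ ⋏ (elemForm ![0] ⋏ elemForm ![1])).compContinuousLinearMap L =
      ω₃ ⋏ (η ⋏ ξ) := by
    rw [Ext.wedge_compContinuousLinearMap, Ext.wedge_compContinuousLinearMap, h₃, hη, hξ]
    simp only [Ext.smul_wedge, Ext.wedge_smul, smul_smul]
    rw [show s⁻¹ * t⁻¹ * (t * s) = 1 by field_simp, one_smul]
  have e : starPhi0.compContinuousLinearMap L =
      (1 / 2 : ℝ) • (σ₂ ⋏ σ₂).compContinuousLinearMap L +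
      (σ₁ ⋏ (elemForm ![1] ⋏ elemForm ![2])).compContinuousLinearMap L -
      (σ₂ ⋏ (elemForm ![0] ⋏ elemForm ![2])).compContinuousLinearMap L -
      (σ₃ ⋏ (elemForm ![0] ⋏ elemForm ![1])).compContinuousLinearMap L := by
    rw [starPhi0_eq]; rfl
  rw [e, e₀, e₁, e₂, e₃]
  ext v
  simp only [ContinuousAlternatingMap.add_apply, ContinuousAlternatingMap.sub_apply,
    ContinuousAlternatingMap.smul_apply, smul_eq_mul]
  ring

/-- The 2-form on `ℝ⁷` in `dx₄, …, dx₇` with the given coefficients. -/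
def skewForm (a b c d e f : ℝ) : (Fin 7 → ℝ) [⋀^Fin 2]→L[ℝ] ℝ :=
  a • elemForm ![3, 4] + b • elemForm ![3, 5] + c • elemForm ![3, 6] + d • elemForm ![4, 5]
    + e • elemForm ![4, 6] + f • elemForm ![5, 6]

theorem σ₀_eq : σ₀ = skewForm 1 0 0 0 0 (-1) := by
  ext v; simp [σ₀, skewForm, sub_eq_add_neg]

theorem σ₁_eq : σ₁ = skewForm 1 0 0 0 0 1 := by
  ext v; simp [σ₁, skewForm]

theorem σ₂_eq : σ₂ = skewForm 0 1 0 0 (-1) 0 := by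
  ext v; simp [σ₂, skewForm, sub_eq_add_neg]

theorem σ₃_eq : σ₃ = skewForm 0 0 1 1 0 0 := by
  ext v; simp [σ₃, skewForm]

theorem skewForm_wedge (a b c d e f a' b' c' d' e' f' : ℝ) :
    skewForm a b c d e f ⋏ skewForm a' b' c' d' e' f' =
      (a * f' - b * e' + c * d' + d * c' - e * b' + f * a') • elemForm ![3, 4, 5, 6] := by
  ext v
  simp only [skewForm, Ext.wedge_add_left, Ext.wedge_add_right, Ext.smul_wedge, Ext.wedge_smul,
    elemForm_two_two]
  simp only [ContinuousAlternatingMap.add_apply, ContinuousAlternatingMap.smul_apply,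
    elemForm_four, elemForm_three]
  simp
  ring

end G2Model

/-! ### Frames adapted to a quaternionic triple -/

section Quaternionic

variable {V : Type*} [AddCommGroup V] [Module ℝ V]

/-- A positive definite inner product `B` on `V` with orthogonal complex structures
`J₁`, `J₂`, `J₃` such that `J₁ J₂ = J₃`. -/
structure IsQuaternionicTriple (B : V →ₗ[ℝ] V →ₗ[ℝ] ℝ) (J₁ J₂ J₃ : V →ₗ[ℝ] V) : Prop where
  symm : ∀ v w, B v w = B w v
  pos : ∀ v, v ≠ 0 → 0 < B v v
  sq₁ : ∀ v, J₁ (J₁ v) = -v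
  sq₂ : ∀ v, J₂ (J₂ v) = -v
  sq₃ : ∀ v, J₃ (J₃ v) = -v
  orth₁ : ∀ v w, B (J₁ v) (J₁ w) = B v w
  orth₂ : ∀ v w, B (J₂ v) (J₂ w) = B v w
  orth₃ : ∀ v w, B (J₃ v) (J₃ w) = B v w
  mul : ∀ v, J₁ (J₂ v) = J₃ v

theorem apply_complexStructure_self {B : V →ₗ[ℝ] V →ₗ[ℝ] ℝ} {J : V →ₗ[ℝ] V}
    (symm : ∀ v w, B v w = B w v) (sq : ∀ v, J (J v) = -v)
    (orth : ∀ v w, B (J v) (J w) = B v w) (v w : V) : B (J v) w = -B (J w) v := by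
  have h := orth v (J w)
  rw [sq, map_neg] at h
  rw [symm (J w) v, ← h, neg_neg]

namespace IsQuaternionicTriple

variable {B : V →ₗ[ℝ] V →ₗ[ℝ] ℝ} {J₁ J₂ J₃ : V →ₗ[ℝ] V}
  (h : IsQuaternionicTriple B J₁ J₂ J₃)

include h

theorem exists_unit_smul {w : V} (hw : w ≠ 0) : ∃ c : ℝ, B (c • w) (c • w) = 1 := by
  refine ⟨(√(B w w))⁻¹, ?_⟩
  have h1 := h.pos w hw
  have h2 := Real.sq_sqrt h1.le
  have h3 : √(B w w) ≠ 0 := (Real.sqrt_pos.2 h1).ne'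
  simp only [map_smul, LinearMap.smul_apply, smul_eq_mul]
  field_simp
  linarith

theorem J₂_J₁ (v : V) : J₂ (J₁ v) = -J₃ v := by
  have h1 : J₂ (J₁ (J₂ (J₂ v))) = J₁ (J₂ v) := by
    have h2 := h.sq₃ (J₂ v)
    rw [← h.mul, ← h.mul] at h2
    have h3 := congrArg J₁ h2
    rw [h.sq₁, map_neg] at h3
    exact neg_injective h3
  rw [h.sq₂, map_neg, map_neg] at h1
  rw [← h.mul, ← h1, neg_neg]

theorem J₁_J₃ (v : V) : J₁ (J₃ v) = -J₂ v := by rw [← h.mul, h.sq₁]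

theorem J₃_J₂ (v : V) : J₃ (J₂ v) = -J₁ v := by rw [← h.mul, h.sq₂, map_neg]

theorem J₃_J₁ (v : V) : J₃ (J₁ v) = J₂ v := by
  rw [← h.mul, h.J₂_J₁, map_neg, h.J₁_J₃, neg_neg]

theorem J₂_J₃ (v : V) : J₂ (J₃ v) = J₁ v := by
  rw [← h.mul, h.J₂_J₁, h.J₃_J₂, neg_neg]

/-- Every unit vector `v` gives an orthonormal basis `v, J₁ v, J₂ v, J₃ v`. -/
theorem exists_basis (hV : Module.finrank ℝ V = 4) {v : V} (hv : B v v = 1) :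
    ∃ b : Module.Basis (Fin 4) ℝ V, b 0 = v ∧ b 1 = J₁ v ∧ b 2 = J₂ v ∧ b 3 = J₃ v ∧
      ∀ i j, B (b i) (b j) = if i = j then 1 else 0 := by
  have self : ∀ {J : V →ₗ[ℝ] V}, (∀ v, J (J v) = -v) → (∀ v w, B (J v) (J w) = B v w) →
      B (J v) v = 0 := by
    intro J sq orth
    have := apply_complexStructure_self h.symm sq orth v v
    linarith
  have a₁ := self h.sq₁ h.orth₁
  have a₂ := self h.sq₂ h.orth₂
  have a₃ := self h.sq₃ h.orth₃
  have a₁₂ : B (J₁ v) (J₂ v) = 0 := by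
    rw [← h.orth₁, h.sq₁, h.mul, map_neg, LinearMap.neg_apply, h.symm, a₃, neg_zero]
  have a₁₃ : B (J₁ v) (J₃ v) = 0 := by rw [← h.mul, h.orth₁, h.symm, a₂]
  have a₂₃ : B (J₂ v) (J₃ v) = 0 := by
    rw [← h.orth₂, h.sq₂, h.J₂_J₃, map_neg, LinearMap.neg_apply, h.symm, a₁, neg_zero]
  have n₁ : B (J₁ v) (J₁ v) = 1 := by rw [h.orth₁, hv]
  have n₂ : B (J₂ v) (J₂ v) = 1 := by rw [h.orth₂, hv]
  have n₃ : B (J₃ v) (J₃ v) = 1 := by rw [h.orth₃, hv]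
  have hon : ∀ i j : Fin 4, B (![v, J₁ v, J₂ v, J₃ v] i) (![v, J₁ v, J₂ v, J₃ v] j) =
      if i = j then 1 else 0 := by
    have b₁ := h.symm v (J₁ v)
    have b₂ := h.symm v (J₂ v)
    have b₃ := h.symm v (J₃ v)
    have b₁₂ := h.symm (J₂ v) (J₁ v)
    have b₁₃ := h.symm (J₃ v) (J₁ v)
    have b₂₃ := h.symm (J₃ v) (J₂ v)
    intro i j
    fin_cases i <;> fin_cases j <;> simp [*]
  have hli : LinearIndependent ℝ ![v, J₁ v, J₂ v, J₃ v] := by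
    rw [Fintype.linearIndependent_iff]
    intro g hg i
    have := congrArg (B (![v, J₁ v, J₂ v, J₃ v] i)) hg
    rw [map_sum, map_zero] at this
    simpa only [map_smul, hon, smul_eq_mul, mul_ite, mul_one, mul_zero, Finset.sum_ite_eq,
      Finset.mem_univ, if_true] using this
  refine ⟨basisOfLinearIndependentOfCardEqFinrank hli (by simp [hV]), ?_, ?_, ?_, ?_, ?_⟩
  all_goals simp only [coe_basisOfLinearIndependentOfCardEqFinrank]
  · rfl
  · rfl
  · rfl
  · rfl
  · exact hon

end IsQuaternionicTriple

/-- A bilinear function in the coordinates of an orthonormal basis. -/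
theorem bilin_apply_basis (b : Module.Basis (Fin 4) ℝ V) (C : V →ₗ[ℝ] V →ₗ[ℝ] ℝ) (x y : V) :
    C x y = ∑ i, ∑ j, b.repr x i * b.repr y j * C (b i) (b j) := by
  conv_lhs => rw [← b.sum_repr x, ← b.sum_repr y]
  simp only [map_sum, map_smul, LinearMap.sum_apply, LinearMap.smul_apply, smul_eq_mul,
    Finset.mul_sum]
  rw [Finset.sum_comm]
  exact Finset.sum_congr rfl fun i _ => Finset.sum_congr rfl fun j _ => by ring

theorem repr_eq_of_orthonormal {B : V →ₗ[ℝ] V →ₗ[ℝ] ℝ} {b : Module.Basis (Fin 4) ℝ V}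
    (hb : ∀ i j, B (b i) (b j) = if i = j then 1 else 0) (x : V) (k : Fin 4) :
    B x (b k) = b.repr x k := by
  have := congrArg (fun z => B z (b k)) (b.sum_repr x)
  simp only [map_sum, map_smul, LinearMap.sum_apply, LinearMap.smul_apply, hb, smul_eq_mul,
    mul_ite, mul_one, mul_zero, Finset.sum_ite_eq', Finset.mem_univ, if_true] at this
  exact this.symm

theorem inner_eq_sum_of_orthonormal {B : V →ₗ[ℝ] V →ₗ[ℝ] ℝ} {b : Module.Basis (Fin 4) ℝ V}
    (hb : ∀ i j, B (b i) (b j) = if i = j then 1 else 0) (x y : V) :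
    B x y = ∑ k, B x (b k) * B y (b k) := by
  rw [bilin_apply_basis b B x y]
  simp [hb, repr_eq_of_orthonormal hb]

/-- The entries above the diagonal of an orthogonal skew-symmetric 4×4 matrix with negative
Pfaffian: the matrix is anti-self-dual. -/
theorem antiSelfDual_of_pfaffian_neg {a b c d e f : ℝ}
    (h₀ : a ^ 2 + b ^ 2 + c ^ 2 = 1) (h₁ : a ^ 2 + f ^ 2 + e ^ 2 = 1)
    (h₂ : b ^ 2 + f ^ 2 + d ^ 2 = 1) (h₃ : c ^ 2 + e ^ 2 + d ^ 2 = 1)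
    (h₀₁ : b * f + c * e = 0) (h₀₂ : -(a * f) + c * d = 0) (h₀₃ : a * e + b * d = 0)
    (h₁₂ : a * b + e * d = 0) (h₁₃ : a * c - f * d = 0) (h₂₃ : b * c + f * e = 0)
    (hp : a * d - b * e + c * f < 0) : d = -a ∧ e = b ∧ f = -c := by
  have k₀ : d ^ 2 + e ^ 2 + f ^ 2 = 1 := by linarith
  -- the Pfaffian intertwines the matrix and its dual, so it is `±1`
  set p := a * d - b * e + c * f with hpdef
  have e₁ : p * a = d := by
    rw [hpdef]; linear_combination d * h₁ - e * h₁₂ + f * h₁₃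
  have e₂ : p * d = a := by
    rw [hpdef]; linear_combination a * k₀ - e * h₀₃ + f * h₀₂
  have e₃ : p * b = -e := by
    rw [hpdef]; linear_combination (-e) * h₂ + d * h₁₂ + f * h₂₃
  have e₄ : p * e = -b := by
    rw [hpdef]; linear_combination (-b) * k₀ + d * h₀₃ + f * h₀₁
  have e₅ : p * c = f := by
    rw [hpdef]; linear_combination f * h₃ + d * h₁₃ - e * h₂₃
  have e₆ : p * f = c := by
    rw [hpdef]; linear_combination c * k₀ - d * h₀₂ - e * h₀₁
  have hsq : p ^ 2 = 1 := by
    linear_combination (p ^ 2 - 1) * (-h₀) + p * a * e₁ + a * e₂ + p * b * e₃ - b * e₄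
      + p * c * e₅ + c * e₆
  have hp1 : p = -1 := by nlinarith
  rw [hp1] at e₁ e₃ e₅
  exact ⟨by linarith, by linarith, by linarith⟩

namespace IsQuaternionicTriple

variable {B : V →ₗ[ℝ] V →ₗ[ℝ] ℝ} {J₁ J₂ J₃ : V →ₗ[ℝ] V}

/-- The matrix of an orthogonal complex structure inducing the opposite orientation (its Pfaffian
is negative) is anti-self-dual, and its first row is a unit vector. -/
theorem antiSelfDual {B : V →ₗ[ℝ] V →ₗ[ℝ] ℝ} (symm : ∀ v w, B v w = B w v) {I : V →ₗ[ℝ] V}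
    (sq : ∀ v, I (I v) = -v) (orth : ∀ v w, B (I v) (I w) = B v w)
    {b : Module.Basis (Fin 4) ℝ V} (hb : ∀ i j, B (b i) (b j) = if i = j then 1 else 0)
    (hp : B (I (b 0)) (b 1) * B (I (b 2)) (b 3) - B (I (b 0)) (b 2) * B (I (b 1)) (b 3)
      + B (I (b 0)) (b 3) * B (I (b 1)) (b 2) < 0) :
    (B (I (b 2)) (b 3) = -B (I (b 0)) (b 1) ∧ B (I (b 1)) (b 3) = B (I (b 0)) (b 2) ∧
      B (I (b 1)) (b 2) = -B (I (b 0)) (b 3)) ∧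
      B (I (b 0)) (b 1) ^ 2 + B (I (b 0)) (b 2) ^ 2 + B (I (b 0)) (b 3) ^ 2 = 1 := by
  have skew := fun v w => apply_complexStructure_self symm sq orth v w
  have diag : ∀ i, B (I (b i)) (b i) = 0 := fun i => by linarith [skew (b i) (b i)]
  have key : ∀ i j, ∑ k, B (I (b i)) (b k) * B (I (b j)) (b k) = if i = j then 1 else 0 := by
    intro i j
    rw [← inner_eq_sum_of_orthonormal hb, orth, hb]
  have s₁₀ := skew (b 1) (b 0)
  have s₂₀ := skew (b 2) (b 0)
  have s₃₀ := skew (b 3) (b 0)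
  have s₂₁ := skew (b 2) (b 1)
  have s₃₁ := skew (b 3) (b 1)
  have s₃₂ := skew (b 3) (b 2)
  have k₀ := key 0 0
  have k₁ := key 1 1
  have k₂ := key 2 2
  have k₃ := key 3 3
  have k₀₁ := key 0 1
  have k₀₂ := key 0 2
  have k₀₃ := key 0 3
  have k₁₂ := key 1 2
  have k₁₃ := key 1 3
  have k₂₃ := key 2 3
  simp [Fin.sum_univ_four, diag, s₁₀, s₂₀, s₃₀, s₂₁, s₃₁, s₃₂] at k₀ k₁ k₂ k₃ k₀₁ k₀₂ k₀₃ k₁₂ k₁₃ k₂₃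
  refine ⟨antiSelfDual_of_pfaffian_neg ?_ ?_ ?_ ?_ ?_ ?_ ?_ ?_ ?_ ?_ hp, ?_⟩ <;> linarith

variable (h : IsQuaternionicTriple B J₁ J₂ J₃)

include h

theorem exists_unit (hV : Module.finrank ℝ V = 4) : ∃ v, B v v = 1 := by
  have : Nontrivial V := Module.nontrivial_of_finrank_pos (R := ℝ) (by omega)
  obtain ⟨w, hw⟩ := exists_ne (0 : V)
  obtain ⟨c, hc⟩ := h.exists_unit_smul hw
  exact ⟨_, hc⟩

/-- An orthogonal complex structure `I` inducing the opposite orientation agrees with `J₁` on some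
unit vector: `I` commutes with `J₁`, so `I J₁` is an involution, it is not the identity, and its
`-1`-eigenvectors qualify. The opposite orientation is expressed by the sign of the Pfaffian of
`I`. -/
theorem exists_unit_eq (hV : Module.finrank ℝ V = 4) {I : V →ₗ[ℝ] V} (sq : ∀ v, I (I v) = -v)
    (orth : ∀ v w, B (I v) (I w) = B v w)
    (hp : ∀ b : Module.Basis (Fin 4) ℝ V, b 1 = J₁ (b 0) → b 2 = J₂ (b 0) → b 3 = J₃ (b 0) →
      (∀ i j, B (b i) (b j) = if i = j then 1 else 0) →
      B (I (b 0)) (b 1) * B (I (b 2)) (b 3) - B (I (b 0)) (b 2) * B (I (b 1)) (b 3)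
      + B (I (b 0)) (b 3) * B (I (b 1)) (b 2) < 0) :
    ∃ v, B v v = 1 ∧ I v = J₁ v := by
  suffices hw : ∃ w, w ≠ 0 ∧ I w = J₁ w by
    obtain ⟨w, hw, hI⟩ := hw
    obtain ⟨c, hc⟩ := h.exists_unit_smul hw
    exact ⟨c • w, hc, by rw [map_smul, map_smul, hI]⟩
  obtain ⟨v, hv⟩ := h.exists_unit hV
  obtain ⟨b, b₀, b₁, b₂, b₃, hb⟩ := h.exists_basis hV hv
  rw [← b₀] at b₁ b₂ b₃
  obtain ⟨⟨e₂₃, e₁₃, e₁₂⟩, hn⟩ := antiSelfDual h.symm sq orth hb (hp b b₁ b₂ b₃ hb)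
  have skew := fun v w => apply_complexStructure_self h.symm sq orth v w
  have diag : ∀ i, B (I (b i)) (b i) = 0 := fun i => by linarith [skew (b i) (b i)]
  set p := B (I (b 0)) (b 1)
  set q := B (I (b 0)) (b 2)
  set r := B (I (b 0)) (b 3)
  have exp : ∀ i, I (b i) = ∑ k, B (I (b i)) (b k) • b k := fun i => by
    simp only [repr_eq_of_orthonormal hb]
    exact (b.sum_repr _).symm
  have i₀ : I (b 0) = p • b 1 + q • b 2 + r • b 3 := by
    rw [exp, Fin.sum_univ_four, diag, zero_smul, zero_add]
  have i₂ : I (b 2) = (-q) • b 0 + r • b 1 + (-p) • b 3 := by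
    rw [exp, Fin.sum_univ_four, diag, zero_smul, add_zero, e₂₃, skew (b 2) (b 1), e₁₂, neg_neg,
      skew (b 2) (b 0)]
  have i₃ : I (b 3) = (-r) • b 0 + (-q) • b 1 + p • b 2 := by
    rw [exp, Fin.sum_univ_four, diag, zero_smul, add_zero, skew (b 3) (b 2), e₂₃, neg_neg,
      skew (b 3) (b 1), e₁₃, skew (b 3) (b 0)]
  have j₀ : J₁ (b 0) = b 1 := b₁.symm
  have j₂ : J₁ (b 2) = b 3 := by rw [b₂, b₃, h.mul]
  have j₃ : J₁ (b 3) = -b 2 := by rw [b₂, b₃, h.J₁_J₃]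
  by_cases hp1 : p = -1
  -- here `I` is `-J₁` on the span of `b 0`, `b 1`, and `J₁` on its orthogonal complement
  · have hq : q = 0 := by rw [hp1] at hn; nlinarith [sq_nonneg q, sq_nonneg r]
    have hr : r = 0 := by rw [hp1] at hn; nlinarith [sq_nonneg q, sq_nonneg r]
    refine ⟨b 2, b.ne_zero 2, ?_⟩
    rw [i₂, j₂, hq, hr, hp1]
    simp
  -- otherwise `b 0 - I (J₁ (b 0))` is a nonzero eigenvector
  · refine ⟨(1 + p) • b 0 + r • b 2 + (-q) • b 3, ?_, ?_⟩
    · intro h0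
      have h1 := congrArg (fun z => B z (b 0)) h0
      simp [hb] at h1
      exact hp1 (by linarith)
    · simp only [map_add, map_smul, i₀, i₂, i₃, j₀, j₂, j₃]
      have h1 : (p ^ 2 + q ^ 2 + r ^ 2) • b 1 = b 1 := by rw [hn, one_smul]
      linear_combination (norm := module) h1

end IsQuaternionicTriple

end Quaternionic

/-! ### Normal forms of the fundamental 2-forms at a point -/

open G2Model

section Coframe

variable {V : Type*} [AddCommGroup V] [Module ℝ V] [TopologicalSpace V]

/-- The map `V → ℝ⁷` with components `0, 0, 0, F₀, F₁, F₂, F₃`, which transports the model 2-forms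
`σᵢ` to a four-dimensional space `V`. -/
def coframeMap (F : V →L[ℝ] (Fin 4 → ℝ)) : V →L[ℝ] (Fin 7 → ℝ) :=
  ContinuousLinearMap.pi fun j =>
    ![0, 0, 0, (ContinuousLinearMap.proj 0).comp F, (ContinuousLinearMap.proj 1).comp F,
      (ContinuousLinearMap.proj 2).comp F, (ContinuousLinearMap.proj 3).comp F] j

theorem elemForm_one (a : Fin 7) (v : Fin 1 → Fin 7 → ℝ) : elemForm ![a] v = v 0 a := by
  rw [elemForm_apply_det]
  simp

theorem elemForm_two (a b : Fin 7) (v : Fin 2 → Fin 7 → ℝ) :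
    elemForm ![a, b] v = v 0 a * v 1 b - v 0 b * v 1 a := by
  rw [elemForm_apply_det, Matrix.det_fin_two]
  rfl

theorem skewForm_comp_coframeMap_apply (F : V →L[ℝ] (Fin 4 → ℝ)) (a b c d e f : ℝ)
    (v : Fin 2 → V) :
    (skewForm a b c d e f).compContinuousLinearMap (coframeMap F) v =
      a * (F (v 0) 0 * F (v 1) 1 - F (v 0) 1 * F (v 1) 0) +
      b * (F (v 0) 0 * F (v 1) 2 - F (v 0) 2 * F (v 1) 0) +
      c * (F (v 0) 0 * F (v 1) 3 - F (v 0) 3 * F (v 1) 0) +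
      d * (F (v 0) 1 * F (v 1) 2 - F (v 0) 2 * F (v 1) 1) +
      e * (F (v 0) 1 * F (v 1) 3 - F (v 0) 3 * F (v 1) 1) +
      f * (F (v 0) 2 * F (v 1) 3 - F (v 0) 3 * F (v 1) 2) := by
  simp only [skewForm, ContinuousAlternatingMap.compContinuousLinearMap_apply,
    ContinuousAlternatingMap.add_apply, ContinuousAlternatingMap.smul_apply, elemForm_two,
    smul_eq_mul]
  rfl

/-- A 2-form in the coframe dual to a basis, with coefficients the entries above the diagonal of its
matrix. -/
theorem eq_skewForm_comp (b : Module.Basis (Fin 4) ℝ V) (F : V →L[ℝ] (Fin 4 → ℝ))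
    (hF : ∀ x i, F x i = b.repr x i) (θ : V [⋀^Fin 2]→L[ℝ] ℝ) (C : V →ₗ[ℝ] V →ₗ[ℝ] ℝ)
    (hC : ∀ x y, θ ![x, y] = C x y) (skew : ∀ x y, C x y = -C y x) :
    θ = (skewForm (C (b 0) (b 1)) (C (b 0) (b 2)) (C (b 0) (b 3)) (C (b 1) (b 2))
      (C (b 1) (b 3)) (C (b 2) (b 3))).compContinuousLinearMap (coframeMap F) := by
  ext v
  have hv : v = ![v 0, v 1] := by ext i; fin_cases i <;> rfl
  have diag : ∀ i, C (b i) (b i) = 0 := fun i => by linarith [skew (b i) (b i)]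
  rw [skewForm_comp_coframeMap_apply]
  conv_lhs => rw [hv]
  rw [hC, bilin_apply_basis b C]
  simp only [Fin.sum_univ_four, diag, skew (b 1) (b 0), skew (b 2) (b 0), skew (b 3) (b 0),
    skew (b 2) (b 1), skew (b 3) (b 1), skew (b 3) (b 2), hF]
  ring

/-- The square of a 2-form is twice its Pfaffian, so the Pfaffian detects the orientation. -/
theorem skewForm_comp_wedge_self_apply (b : Module.Basis (Fin 4) ℝ V) (F : V →L[ℝ] (Fin 4 → ℝ))
    (hF : ∀ x i, F x i = b.repr x i) (p q r s t u : ℝ) :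
    ((skewForm p q r s t u).compContinuousLinearMap (coframeMap F) ⋏
      (skewForm p q r s t u).compContinuousLinearMap (coframeMap F)) b =
        2 * (p * u - q * t + r * s) := by
  rw [← Ext.wedge_compContinuousLinearMap, skewForm_wedge]
  have h : ∀ i j, F (b i) j = if i = j then 1 else 0 := fun i j => by
    rw [hF, b.repr_self, Finsupp.single_apply]
  have h1 : ∀ i, coframeMap F (b i) = ![0, 0, 0, F (b i) 0, F (b i) 1, F (b i) 2, F (b i) 3] := by
    intro i
    ext j
    fin_cases j <;> rfl
  have h2 : elemForm ![3, 4, 5, 6] (coframeMap F ∘ b) = 1 := by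
    rw [elemForm_four]
    simp [elemForm_three, h1, h]
  rw [ContinuousAlternatingMap.compContinuousLinearMap_apply, ContinuousAlternatingMap.smul_apply,
    smul_eq_mul]
  refine (congrArg (_ * ·) h2).trans ?_
  ring

end Coframe

section Pointwise

variable {M : Type*} [TopologicalSpace M] [ChartedSpace (EuclideanSpace ℝ (Fin 4)) M]

theorem finrank_tangentSpace (m : M) : Module.finrank ℝ (TangentSpace (𝓡 4) m) = 4 :=
  finrank_euclideanSpace_fin

instance (m : M) : FiniteDimensional ℝ (TangentSpace (𝓡 4) m) :=
  inferInstanceAs (FiniteDimensional ℝ (EuclideanSpace ℝ (Fin 4)))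

instance (m : M) : T2Space (TangentSpace (𝓡 4) m) :=
  inferInstanceAs (T2Space (EuclideanSpace ℝ (Fin 4)))

variable [IsManifold (𝓡 4) ∞ M]

/-- The inner product on a tangent space as a bilinear map. -/
def SmoothMetric.bilin (g : SmoothMetric M) (m : M) :
    TangentSpace (𝓡 4) m →ₗ[ℝ] TangentSpace (𝓡 4) m →ₗ[ℝ] ℝ :=
  LinearMap.mk₂ ℝ (fun v w => g.inner m v w) (by simp) (by simp) (by simp) (by simp)

theorem SmoothMetric.bilin_apply (g : SmoothMetric M) (m : M) (v w : TangentSpace (𝓡 4) m) :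
    SmoothMetric.bilin g m v w = g.inner m v w := rfl

theorem HyperkahlerStructure.isQuaternionicTriple (S : HyperkahlerStructure M) (m : M) :
    IsQuaternionicTriple (SmoothMetric.bilin S.g₀ m) (S.K₁.J m).toLinearMap
      (S.K₂.J m).toLinearMap (S.K₃.J m).toLinearMap where
  symm := S.g₀.symm m
  pos := S.g₀.pos m
  sq₁ := S.K₁.J_J m
  sq₂ := S.K₂.J_J m
  sq₃ := S.K₃.J_J m
  orth₁ := S.K₁.orthogonal m
  orth₂ := S.K₂.orthogonal m
  orth₃ := S.K₃.orthogonal m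
  mul := S.quaternion m

/-- The fundamental form in terms of its matrix with respect to a basis. -/
theorem AlmostKahlerStructure.Ω_eq {g : SmoothMetric M} (A : AlmostKahlerStructure g) (m : M)
    (b : Module.Basis (Fin 4) ℝ (TangentSpace (𝓡 4) m)) :
    A.Ω m = (skewForm (g.inner m (A.J m (b 0)) (b 1)) (g.inner m (A.J m (b 0)) (b 2))
      (g.inner m (A.J m (b 0)) (b 3)) (g.inner m (A.J m (b 1)) (b 2))
      (g.inner m (A.J m (b 1)) (b 3))
      (g.inner m (A.J m (b 2)) (b 3))).compContinuousLinearMap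
        (coframeMap (b.equivFunL : TangentSpace (𝓡 4) m →L[ℝ] (Fin 4 → ℝ))) :=
  eq_skewForm_comp b _ (fun _ _ => rfl) _
    ((SmoothMetric.bilin g m).comp (A.J m).toLinearMap) (A.Ω_apply m)
    (apply_complexStructure_self (B := SmoothMetric.bilin g m) (g.symm m) (A.J_J m)
      (A.orthogonal m))

/-- The three Kähler forms in an adapted basis. -/
theorem HyperkahlerStructure.Ω_eq (S : HyperkahlerStructure M) (m : M)
    (b : Module.Basis (Fin 4) ℝ (TangentSpace (𝓡 4) m)) (b₁ : b 1 = S.K₁.J m (b 0))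
    (b₂ : b 2 = S.K₂.J m (b 0)) (b₃ : b 3 = S.K₃.J m (b 0))
    (hb : ∀ i j, S.g₀.inner m (b i) (b j) = if i = j then 1 else 0) :
    S.K₁.Ω m = σ₁.compContinuousLinearMap
        (coframeMap (b.equivFunL : TangentSpace (𝓡 4) m →L[ℝ] (Fin 4 → ℝ))) ∧
    S.K₂.Ω m = σ₂.compContinuousLinearMap
        (coframeMap (b.equivFunL : TangentSpace (𝓡 4) m →L[ℝ] (Fin 4 → ℝ))) ∧
    S.K₃.Ω m = σ₃.compContinuousLinearMap
        (coframeMap (b.equivFunL : TangentSpace (𝓡 4) m →L[ℝ] (Fin 4 → ℝ))) := by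
  have h := S.isQuaternionicTriple m
  have j₁₁ : S.K₁.J m (b 1) = -b 0 := by rw [b₁]; exact h.sq₁ _
  have j₁₂ : S.K₁.J m (b 2) = b 3 := by rw [b₂, b₃]; exact h.mul _
  have j₂₁ : S.K₂.J m (b 1) = -b 3 := by rw [b₁, b₃]; exact h.J₂_J₁ _
  have j₂₂ : S.K₂.J m (b 2) = -b 0 := by rw [b₂]; exact h.sq₂ _
  have j₃₁ : S.K₃.J m (b 1) = b 2 := by rw [b₁, b₂]; exact h.J₃_J₁ _
  have j₃₂ : S.K₃.J m (b 2) = -b 1 := by rw [b₁, b₂]; exact h.J₃_J₂ _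
  refine ⟨?_, ?_, ?_⟩
  · rw [S.K₁.Ω_eq m b, σ₁_eq, ← b₁, j₁₁, j₁₂]
    simp [hb]
  · rw [S.K₂.Ω_eq m b, σ₂_eq, ← b₂, j₂₁, j₂₂]
    simp [hb]
  · rw [S.K₃.Ω_eq m b, σ₃_eq, ← b₃, j₃₁, j₃₂]
    simp [hb]

/-- A coframe of a tangent space in which the Kähler forms are the model forms. -/
theorem HyperkahlerStructure.exists_coframe (S : HyperkahlerStructure M) (m : M) :
    ∃ F : TangentSpace (𝓡 4) m ≃L[ℝ] (Fin 4 → ℝ),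
      S.K₁.Ω m = σ₁.compContinuousLinearMap (coframeMap F.toContinuousLinearMap) ∧
      S.K₂.Ω m = σ₂.compContinuousLinearMap (coframeMap F.toContinuousLinearMap) ∧
      S.K₃.Ω m = σ₃.compContinuousLinearMap (coframeMap F.toContinuousLinearMap) := by
  have h := S.isQuaternionicTriple m
  obtain ⟨v, hv⟩ := h.exists_unit (finrank_tangentSpace m)
  obtain ⟨b, b₀, b₁, b₂, b₃, hb⟩ := h.exists_basis (finrank_tangentSpace m) hv
  rw [← b₀] at b₁ b₂ b₃
  exact ⟨b.equivFunL, S.Ω_eq m b b₁ b₂ b₃ hb⟩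

/-- A coframe adapted simultaneously to the hyperkähler structure and to an almost-Kähler structure
of the opposite orientation: the one defined by a unit vector on which `I` and `J₁` agree. -/
theorem HyperkahlerStructure.exists_coframe_of_oppositelyOriented (S : HyperkahlerStructure M)
    (A : AlmostKahlerStructure S.g₀) (hA : A.OppositelyOriented S.K₁) (m : M) :
    ∃ F : TangentSpace (𝓡 4) m ≃L[ℝ] (Fin 4 → ℝ),
      A.Ω m = σ₀.compContinuousLinearMap (coframeMap F.toContinuousLinearMap) ∧
      S.K₁.Ω m = σ₁.compContinuousLinearMap (coframeMap F.toContinuousLinearMap) ∧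
      S.K₂.Ω m = σ₂.compContinuousLinearMap (coframeMap F.toContinuousLinearMap) ∧
      S.K₃.Ω m = σ₃.compContinuousLinearMap (coframeMap F.toContinuousLinearMap) := by
  have h := S.isQuaternionicTriple m
  have hV := finrank_tangentSpace m
  have hp : ∀ b : Module.Basis (Fin 4) ℝ (TangentSpace (𝓡 4) m), b 1 = S.K₁.J m (b 0) →
      b 2 = S.K₂.J m (b 0) → b 3 = S.K₃.J m (b 0) →
      (∀ i j, S.g₀.inner m (b i) (b j) = if i = j then 1 else 0) →
      S.g₀.inner m (A.J m (b 0)) (b 1) * S.g₀.inner m (A.J m (b 2)) (b 3)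
        - S.g₀.inner m (A.J m (b 0)) (b 2) * S.g₀.inner m (A.J m (b 1)) (b 3)
        + S.g₀.inner m (A.J m (b 0)) (b 3) * S.g₀.inner m (A.J m (b 1)) (b 2) < 0 := by
    intro b b₁ b₂ b₃ hb
    have := hA m b b.linearIndependent
    rw [(S.Ω_eq m b b₁ b₂ b₃ hb).1, σ₁_eq, A.Ω_eq m b,
      skewForm_comp_wedge_self_apply b _ (fun _ _ => rfl),
      skewForm_comp_wedge_self_apply b _ (fun _ _ => rfl)] at this
    linarith
  obtain ⟨v, hv, hI⟩ := h.exists_unit_eq hV (I := (A.J m).toLinearMap) (A.J_J m)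
    (A.orthogonal m) hp
  obtain ⟨b, b₀, b₁, b₂, b₃, hb⟩ := h.exists_basis hV hv
  rw [← b₀] at b₁ b₂ b₃ hI
  refine ⟨b.equivFunL, ?_, S.Ω_eq m b b₁ b₂ b₃ hb⟩
  obtain ⟨⟨e₂₃, e₁₃, e₁₂⟩, hn⟩ := IsQuaternionicTriple.antiSelfDual (B := SmoothMetric.bilin S.g₀ m)
    (S.g₀.symm m) (I := (A.J m).toLinearMap) (A.J_J m) (A.orthogonal m) hb (hp b b₁ b₂ b₃ hb)
  have e₀₁ : SmoothMetric.bilin S.g₀ m (A.J m (b 0)) (b 1) = 1 := by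
    have : A.J m (b 0) = b 1 := hI.trans b₁.symm
    rw [this, hb]
    simp
  have e₀₂ : SmoothMetric.bilin S.g₀ m (A.J m (b 0)) (b 2) = 0 := by
    have : A.J m (b 0) = b 1 := hI.trans b₁.symm
    rw [this, hb]
    simp
  have e₀₃ : SmoothMetric.bilin S.g₀ m (A.J m (b 0)) (b 3) = 0 := by
    have : A.J m (b 0) = b 1 := hI.trans b₁.symm
    rw [this, hb]
    simp
  simp only [ContinuousLinearMap.coe_coe, e₀₁, e₀₂, e₀₃, neg_zero] at e₂₃ e₁₃ e₁₂
  rw [SmoothMetric.bilin_apply] at e₀₁ e₀₂ e₀₃ e₂₃ e₁₃ e₁₂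
  rw [A.Ω_eq m b, σ₀_eq, e₀₁, e₀₂, e₀₃, e₁₂, e₁₃, e₂₃]

end Pointwise

/-! ### Admissibility of the 3-form -/

section Admissible

variable {V : Type*} [AddCommGroup V] [Module ℝ V] [TopologicalSpace V]

/-- A 1-form, given as an alternating map in one variable, as a linear functional. -/
def toFunctional (θ : V [⋀^Fin 1]→L[ℝ] ℝ) : V →L[ℝ] ℝ :=
  (ContinuousAlternatingMap.ofSubsingleton ℝ V ℝ (0 : Fin 1)).symm θ

theorem toFunctional_apply (θ : V [⋀^Fin 1]→L[ℝ] ℝ) (v : Fin 1 → V) :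
    toFunctional θ (v 0) = θ v := by
  have h : v = fun _ => v 0 := by ext i; fin_cases i; rfl
  conv_rhs => rw [h]
  rfl

variable [IsTopologicalAddGroup V] [ContinuousSMul ℝ V] [T2Space V] [FiniteDimensional ℝ V]

/-- Admissibility of `φ`, and the formula for `*φ`. The coframe which identifies it with
`φ₀` is `η / t`, `ξ / s`, `-t s τ`, `√(t (b + a)) G₀`, `√(t (b + a)) G₁`, `√(t (b - a)) G₂`,
`√(t (b - a)) G₃`, where `s = √(b² - a²)`. -/
theorem isG2Pair_of_coframe (hV : Module.finrank ℝ V = 7) (τ ξ η : V [⋀^Fin 1]→L[ℝ] ℝ)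
    (G : V →L[ℝ] (Fin 4 → ℝ))
    (hinj : ∀ v, toFunctional τ v = 0 → toFunctional ξ v = 0 → toFunctional η v = 0 → G v = 0 →
      v = 0)
    {a b t : ℝ} (ht : 0 < t) (hab : |a| < b) {ω₁ ω₂ ω₃ : V [⋀^Fin 2]→L[ℝ] ℝ}
    (h₁ : ω₁ = (a • σ₀ + b • σ₁).compContinuousLinearMap (coframeMap G))
    (h₂ : ω₂ = σ₂.compContinuousLinearMap (coframeMap G))
    (h₃ : ω₃ = σ₃.compContinuousLinearMap (coframeMap G)) :
    IsG2Pair (ω₁ ⋏ η + τ ⋏ ξ ⋏ η + t • (ω₂ ⋏ ξ + (t * (b ^ 2 - a ^ 2)) • (ω₃ ⋏ τ)))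
      ((t ^ 2 * (b ^ 2 - a ^ 2) / 2) • (ω₂ ⋏ ω₂) - t ^ 2 • (ω₁ ⋏ (ξ ⋏ τ))
        + (t * (b ^ 2 - a ^ 2)) • (ω₂ ⋏ (η ⋏ τ)) - ω₃ ⋏ (η ⋏ ξ)) := by
  obtain ⟨hab₁, hab₂⟩ := abs_lt.1 hab
  have hp : 0 < b + a := by linarith
  have hm : 0 < b - a := by linarith
  have hs : 0 < b ^ 2 - a ^ 2 := by nlinarith
  obtain ⟨s, hs0, hs2⟩ : ∃ s : ℝ, 0 < s ∧ s ^ 2 = b ^ 2 - a ^ 2 :=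
    ⟨√(b ^ 2 - a ^ 2), Real.sqrt_pos.2 hs, Real.sq_sqrt hs.le⟩
  obtain ⟨α, hα0, hα2⟩ : ∃ α : ℝ, 0 < α ∧ α ^ 2 = t * (b + a) :=
    ⟨√(t * (b + a)), Real.sqrt_pos.2 (by positivity), Real.sq_sqrt (by positivity)⟩
  obtain ⟨β, hβ0, hβ2⟩ : ∃ β : ℝ, 0 < β ∧ β ^ 2 = t * (b - a) :=
    ⟨√(t * (b - a)), Real.sqrt_pos.2 (by positivity), Real.sq_sqrt (by positivity)⟩
  have hαβ : α * β = t * s := by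
    have : (α * β) ^ 2 = (t * s) ^ 2 := by
      rw [mul_pow, mul_pow, hα2, hβ2, hs2]; ring
    exact (pow_left_inj₀ (by positivity) (by positivity) two_ne_zero).1 this
  let L : V →L[ℝ] (Fin 7 → ℝ) := ContinuousLinearMap.pi fun j =>
    ![t⁻¹ • toFunctional η, s⁻¹ • toFunctional ξ, (-(t * s)) • toFunctional τ,
      α • (ContinuousLinearMap.proj 0).comp G, α • (ContinuousLinearMap.proj 1).comp G,
      β • (ContinuousLinearMap.proj 2).comp G, β • (ContinuousLinearMap.proj 3).comp G] j
  have L₀ : ∀ v, L v 0 = t⁻¹ * toFunctional η v := fun _ => rfl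
  have L₁ : ∀ v, L v 1 = s⁻¹ * toFunctional ξ v := fun _ => rfl
  have L₂ : ∀ v, L v 2 = (-(t * s)) * toFunctional τ v := fun _ => rfl
  have L₃ : ∀ v, L v 3 = α * G v 0 := fun _ => rfl
  have L₄ : ∀ v, L v 4 = α * G v 1 := fun _ => rfl
  have L₅ : ∀ v, L v 5 = β * G v 2 := fun _ => rfl
  have L₆ : ∀ v, L v 6 = β * G v 3 := fun _ => rfl
  have C₃ : ∀ v, coframeMap G v 3 = G v 0 := fun _ => rfl
  have C₄ : ∀ v, coframeMap G v 4 = G v 1 := fun _ => rfl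
  have C₅ : ∀ v, coframeMap G v 5 = G v 2 := fun _ => rfl
  have C₆ : ∀ v, coframeMap G v 6 = G v 3 := fun _ => rfl
  have hL : Function.Injective L.toLinearMap := by
    rw [← LinearMap.ker_eq_bot, LinearMap.ker_eq_bot']
    intro v hv
    have hv' : ∀ j, L v j = 0 := fun j => congrFun hv j
    refine hinj v ?_ ?_ ?_ ?_
    · have := hv' 2
      rw [L₂] at this
      exact (mul_eq_zero.1 this).resolve_left (by simp [ht.ne', hs0.ne'])
    · have := hv' 1
      rw [L₁] at this
      exact (mul_eq_zero.1 this).resolve_left (by simp [hs0.ne'])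
    · have := hv' 0
      rw [L₀] at this
      exact (mul_eq_zero.1 this).resolve_left (by simp [ht.ne'])
    · have g₀ := hv' 3
      have g₁ := hv' 4
      have g₂ := hv' 5
      have g₃ := hv' 6
      rw [L₃] at g₀
      rw [L₄] at g₁
      rw [L₅] at g₂
      rw [L₆] at g₃
      ext i
      fin_cases i
      · exact (mul_eq_zero.1 g₀).resolve_left hα0.ne'
      · exact (mul_eq_zero.1 g₁).resolve_left hα0.ne'
      · exact (mul_eq_zero.1 g₂).resolve_left hβ0.ne'
      · exact (mul_eq_zero.1 g₃).resolve_left hβ0.ne'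
  let e : V ≃L[ℝ] (Fin 7 → ℝ) :=
    (LinearEquiv.ofInjectiveOfFinrankEq L.toLinearMap hL (by simp [hV])).toContinuousLinearEquiv
  have he : (e : V →L[ℝ] (Fin 7 → ℝ)) = L := by
    ext v j
    rfl
  have k₀ : (elemForm ![0]).compContinuousLinearMap L = t⁻¹ • η := by
    ext v
    rw [ContinuousAlternatingMap.compContinuousLinearMap_apply, elemForm_one,
      ContinuousAlternatingMap.smul_apply, ← toFunctional_apply]
    rfl
  have k₁ : (elemForm ![1]).compContinuousLinearMap L = s⁻¹ • ξ := by
    ext v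
    rw [ContinuousAlternatingMap.compContinuousLinearMap_apply, elemForm_one,
      ContinuousAlternatingMap.smul_apply, ← toFunctional_apply]
    rfl
  have k₂ : (elemForm ![2]).compContinuousLinearMap L = (-(t * s)) • τ := by
    ext v
    rw [ContinuousAlternatingMap.compContinuousLinearMap_apply, elemForm_one,
      ContinuousAlternatingMap.smul_apply, ← toFunctional_apply]
    rfl
  have k₃ : σ₁.compContinuousLinearMap L = t • ω₁ := by
    ext v
    rw [h₁]
    simp only [σ₀, σ₁, ContinuousAlternatingMap.compContinuousLinearMap_apply,
      ContinuousAlternatingMap.smul_apply, ContinuousAlternatingMap.add_apply,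
      ContinuousAlternatingMap.sub_apply, elemForm_two, Function.comp_apply, L₃, L₄, L₅, L₆,
      C₃, C₄, C₅, C₆, smul_eq_mul]
    linear_combination (G (v 0) 0 * G (v 1) 1 - G (v 0) 1 * G (v 1) 0) * hα2 +
      (G (v 0) 2 * G (v 1) 3 - G (v 0) 3 * G (v 1) 2) * hβ2
  have k₄ : σ₂.compContinuousLinearMap L = (t * s) • ω₂ := by
    ext v
    rw [h₂]
    simp only [σ₂, ContinuousAlternatingMap.compContinuousLinearMap_apply,
      ContinuousAlternatingMap.smul_apply,
      ContinuousAlternatingMap.sub_apply, elemForm_two, Function.comp_apply, L₃, L₄, L₅, L₆,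
      C₃, C₄, C₅, C₆, smul_eq_mul]
    linear_combination (G (v 0) 0 * G (v 1) 2 - G (v 0) 2 * G (v 1) 0 -
      (G (v 0) 1 * G (v 1) 3 - G (v 0) 3 * G (v 1) 1)) * hαβ
  have k₅ : σ₃.compContinuousLinearMap L = (t * s) • ω₃ := by
    ext v
    rw [h₃]
    simp only [σ₃, ContinuousAlternatingMap.compContinuousLinearMap_apply,
      ContinuousAlternatingMap.smul_apply, ContinuousAlternatingMap.add_apply,
      elemForm_two, Function.comp_apply, L₃, L₄, L₅, L₆,
      C₃, C₄, C₅, C₆, smul_eq_mul]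
    linear_combination (G (v 0) 0 * G (v 1) 3 - G (v 0) 3 * G (v 1) 0 +
      (G (v 0) 1 * G (v 1) 2 - G (v 0) 2 * G (v 1) 1)) * hαβ
  refine ⟨e, ?_, ?_⟩
  · rw [he, ← hs2]
    exact phi0_comp L ht hs0 k₀ k₁ k₂ k₃ k₄ k₅
  · rw [he, ← hs2]
    exact starPhi0_comp L ht hs0 k₀ k₁ k₂ k₃ k₄ k₅

end Admissible

/-! ### Closedness in a chart -/

section Calculus

variable {E : Type*} [NormedAddCommGroup E] [NormedSpace ℝ E] {k : ℕ} {x : E}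

/-- The form `α` is differentiable at `x`, with exterior derivative `α'` there. -/
structure HasExtDerivAt (α : E → E [⋀^Fin k]→L[ℝ] ℝ) (α' : E [⋀^Fin (k + 1)]→L[ℝ] ℝ) (x : E) :
    Prop where
  differentiableAt : DifferentiableAt ℝ α x
  extDeriv_eq : extDeriv α x = α'

namespace HasExtDerivAt

theorem congr_deriv {α : E → E [⋀^Fin k]→L[ℝ] ℝ} {α' α'' : E [⋀^Fin (k + 1)]→L[ℝ] ℝ}
    (hα : HasExtDerivAt α α' x) (h : α' = α'') : HasExtDerivAt α α'' x :=
  h ▸ hα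

theorem add {α β : E → E [⋀^Fin k]→L[ℝ] ℝ} {α' β' : E [⋀^Fin (k + 1)]→L[ℝ] ℝ}
    (hα : HasExtDerivAt α α' x) (hβ : HasExtDerivAt β β' x) :
    HasExtDerivAt (fun y => α y + β y) (α' + β') x :=
  ⟨hα.1.add hβ.1, by rw [extDeriv_fun_add hα.1 hβ.1, hα.2, hβ.2]⟩

theorem const_smul {α : E → E [⋀^Fin k]→L[ℝ] ℝ} {α' : E [⋀^Fin (k + 1)]→L[ℝ] ℝ} (c : ℝ)
    (hα : HasExtDerivAt α α' x) : HasExtDerivAt (fun y => c • α y) (c • α') x :=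
  ⟨hα.1.const_smul c, by
    rw [← hα.2]
    exact extDeriv_smul c α⟩

theorem sub {α β : E → E [⋀^Fin k]→L[ℝ] ℝ} {α' β' : E [⋀^Fin (k + 1)]→L[ℝ] ℝ}
    (hα : HasExtDerivAt α α' x) (hβ : HasExtDerivAt β β' x) :
    HasExtDerivAt (fun y => α y - β y) (α' - β') x := by
  have h := hα.add (hβ.const_smul (-1))
  have h1 : (fun y => α y + (-1 : ℝ) • β y) = fun y => α y - β y := by
    funext y; ext v; simp [sub_eq_add_neg]
  have h2 : α' + (-1 : ℝ) • β' = α' - β' := by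
    ext v; simp [sub_eq_add_neg]
  rwa [h1, h2] at h

theorem const (α : E [⋀^Fin k]→L[ℝ] ℝ) : HasExtDerivAt (fun _ : E => α) 0 x :=
  ⟨differentiableAt_const α, by
    ext v
    simp [extDeriv, ContinuousAlternatingMap.alternatizeUncurryFin_apply]⟩

theorem smul {g : E → ℝ} {g' : E →L[ℝ] ℝ} {α : E → E [⋀^Fin k]→L[ℝ] ℝ}
    {α' : E [⋀^Fin (k + 1)]→L[ℝ] ℝ} (h : 1 + k = k + 1) (hg : HasFDerivAt g g' x)
    (hα : HasExtDerivAt α α' x) : HasExtDerivAt (fun y => g y • α y)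
      (Ext.degCast h (ContinuousAlternatingMap.ofSubsingleton ℝ E ℝ (0 : Fin 1) g' ⋏ α x) +
        g x • α') x :=
  ⟨hg.differentiableAt.smul hα.1, by rw [Ext.extDeriv_smul_fun h hg hα.1, hα.2]⟩

theorem wedge {l : ℕ} {α : E → E [⋀^Fin k]→L[ℝ] ℝ} {α' : E [⋀^Fin (k + 1)]→L[ℝ] ℝ}
    {β : E → E [⋀^Fin l]→L[ℝ] ℝ} {β' : E [⋀^Fin (l + 1)]→L[ℝ] ℝ} (h : k + 1 + l = k + l + 1)
    (hα : HasExtDerivAt α α' x) (hβ : HasExtDerivAt β β' x) :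
    HasExtDerivAt (fun y => α y ⋏ β y)
      (Ext.degCast h (α' ⋏ β x) + (-1 : ℝ) ^ k • (α x ⋏ β')) x := by
  refine ⟨?_, by rw [Ext.extDeriv_wedge h hα.1 hβ.1, hα.2, hβ.2]⟩
  exact ((Ext.isBoundedBilinearMap_wedge E k l).hasFDerivAt (α x, β x)).comp x
      (hα.1.hasFDerivAt.prodMk hβ.1.hasFDerivAt) |>.differentiableAt

/-! Leibniz rules in the degrees needed. A product of which the degree is a numeral, as `5` in
place of `3 + 2`, is introduced by an equation `α' ⋏ β x = γ`, in which `γ` has the numeral as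
degree. -/

theorem wedge_one_one {α β : E → E [⋀^Fin 1]→L[ℝ] ℝ} {α' β' : E [⋀^Fin 2]→L[ℝ] ℝ}
    (hα : HasExtDerivAt α α' x) (hβ : HasExtDerivAt β β' x) :
    HasExtDerivAt (k := 2) (fun y => α y ⋏ β y) (α' ⋏ β x - α x ⋏ β') x := by
  have h := wedge rfl hα hβ
  refine ⟨h.1, h.2.trans ?_⟩
  ext v
  simp [Ext.degCast_apply, sub_eq_add_neg]

theorem wedge_two_one {α : E → E [⋀^Fin 2]→L[ℝ] ℝ} {α' : E [⋀^Fin 3]→L[ℝ] ℝ}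
    {β : E → E [⋀^Fin 1]→L[ℝ] ℝ} {β' : E [⋀^Fin 2]→L[ℝ] ℝ}
    (hα : HasExtDerivAt α α' x) (hβ : HasExtDerivAt β β' x) :
    HasExtDerivAt (k := 3) (fun y => α y ⋏ β y) (α' ⋏ β x + α x ⋏ β') x := by
  have h := wedge rfl hα hβ
  refine ⟨h.1, h.2.trans ?_⟩
  ext v
  simp [Ext.degCast_apply]

theorem wedge_two_two {α : E → E [⋀^Fin 2]→L[ℝ] ℝ} {α' : E [⋀^Fin 3]→L[ℝ] ℝ}
    {β : E → E [⋀^Fin 2]→L[ℝ] ℝ} {β' : E [⋀^Fin 3]→L[ℝ] ℝ} {γ γ' : E [⋀^Fin 5]→L[ℝ] ℝ}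
    (hα : HasExtDerivAt α α' x) (hβ : HasExtDerivAt β β' x) (hγ : α' ⋏ β x = γ)
    (hγ' : α x ⋏ β' = γ') : HasExtDerivAt (k := 4) (fun y => α y ⋏ β y) (γ + γ') x := by
  subst hγ hγ'
  have h := wedge (k := 2) (l := 2) rfl hα hβ
  refine ⟨h.1, h.2.trans ?_⟩
  ext v
  simp [Ext.degCast_apply]

section FunctionOfLinear

variable {ℓ : E →L[ℝ] ℝ} {g : ℝ → ℝ} {c : ℝ}

/-- The Leibniz rule for a function of a linear coordinate times a form. -/
theorem smul_comp (hg : HasDerivAt g c (ℓ x)) (h : 1 + k = k + 1)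
    {α : E → E [⋀^Fin k]→L[ℝ] ℝ} {α' : E [⋀^Fin (k + 1)]→L[ℝ] ℝ} (hα : HasExtDerivAt α α' x) :
    HasExtDerivAt (fun y => g (ℓ y) • α y)
      (c • Ext.degCast h (ContinuousAlternatingMap.ofSubsingleton ℝ E ℝ (0 : Fin 1) ℓ ⋏ α x) +
        g (ℓ x) • α') x := by
  have h1 := hα.smul h (hg.comp_hasFDerivAt x ℓ.hasFDerivAt)
  refine ⟨h1.1, h1.2.trans ?_⟩
  congr 1
  have h2 : ContinuousAlternatingMap.ofSubsingleton ℝ E ℝ (0 : Fin 1) (c • ℓ) =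
      c • ContinuousAlternatingMap.ofSubsingleton ℝ E ℝ (0 : Fin 1) ℓ := by
    ext v; simp
  rw [h2, Ext.smul_wedge]
  ext v
  simp [Ext.degCast_apply]

theorem smul_comp_two (hg : HasDerivAt g c (ℓ x)) {α : E → E [⋀^Fin 2]→L[ℝ] ℝ}
    {α' γ : E [⋀^Fin 3]→L[ℝ] ℝ} (hα : HasExtDerivAt α α' x)
    (hγ : ContinuousAlternatingMap.ofSubsingleton ℝ E ℝ (0 : Fin 1) ℓ ⋏ α x = γ) :
    HasExtDerivAt (k := 2) (fun y => g (ℓ y) • α y) (c • γ + g (ℓ x) • α') x := by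
  subst hγ
  have h := smul_comp (k := 2) hg rfl hα
  refine ⟨h.1, h.2.trans ?_⟩
  ext v
  simp [Ext.degCast_apply]

theorem smul_comp_three (hg : HasDerivAt g c (ℓ x)) {α : E → E [⋀^Fin 3]→L[ℝ] ℝ}
    {α' γ : E [⋀^Fin 4]→L[ℝ] ℝ} (hα : HasExtDerivAt α α' x)
    (hγ : ContinuousAlternatingMap.ofSubsingleton ℝ E ℝ (0 : Fin 1) ℓ ⋏ α x = γ) :
    HasExtDerivAt (k := 3) (fun y => g (ℓ y) • α y) (c • γ + g (ℓ x) • α') x := by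
  subst hγ
  have h := smul_comp (k := 3) hg rfl hα
  refine ⟨h.1, h.2.trans ?_⟩
  ext v
  simp [Ext.degCast_apply]

theorem smul_comp_four (hg : HasDerivAt g c (ℓ x)) {α : E → E [⋀^Fin 4]→L[ℝ] ℝ}
    {α' γ : E [⋀^Fin 5]→L[ℝ] ℝ} (hα : HasExtDerivAt α α' x)
    (hγ : ContinuousAlternatingMap.ofSubsingleton ℝ E ℝ (0 : Fin 1) ℓ ⋏ α x = γ) :
    HasExtDerivAt (k := 4) (fun y => g (ℓ y) • α y) (c • γ + g (ℓ x) • α') x := by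
  subst hγ
  have h := smul_comp (k := 4) hg rfl hα
  refine ⟨h.1, h.2.trans ?_⟩
  ext v
  simp [Ext.degCast_apply]

end FunctionOfLinear

end HasExtDerivAt

section Closedness

variable {ℓ : E →L[ℝ] ℝ} {p q k l : ℝ} {ω₀ ω₁ ω₂ ω₃ : E → E [⋀^Fin 2]→L[ℝ] ℝ}
  {ξ η : E → E [⋀^Fin 1]→L[ℝ] ℝ} {x : E}

local notation "τ" => ContinuousAlternatingMap.ofSubsingleton ℝ E ℝ (0 : Fin 1) ℓ

theorem hasDerivAt_affine (p q t : ℝ) : HasDerivAt (fun t : ℝ => p + q * t) q t := by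
  simpa using ((hasDerivAt_id t).const_mul q).const_add p

theorem hasExtDerivAt_affine_family (h₀ : HasExtDerivAt ω₀ 0 x) (h₁ : HasExtDerivAt ω₁ 0 x) :
    HasExtDerivAt (fun y => (p + q * ℓ y) • ω₀ y + (k + l * ℓ y) • ω₁ y)
      (τ ⋏ (q • ω₀ x + l • ω₁ x) : E [⋀^Fin 3]→L[ℝ] ℝ) x := by
  have h := (h₀.smul_comp_two (hasDerivAt_affine p q (ℓ x)) rfl).add
    (h₁.smul_comp_two (hasDerivAt_affine k l (ℓ x)) rfl)
  refine ⟨h.1, h.2.trans ?_⟩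
  rw [Ext.wedge_add_right, Ext.wedge_smul, Ext.wedge_smul, smul_zero, add_zero, smul_zero,
    add_zero]

/-- Closedness of `φ`: the terms `±(dt ∧ ω̃') ∧ (dy + η)` and `±dt ∧ ω₂ ∧ (dx + ξ)` cancel, and
what remains contains `ω̃ ∧ ω₂`, `ω₂ ∧ ω̃'` or `dt ∧ dt`. -/
theorem hasExtDerivAt_phi {u : ℝ → ℝ} (hu : DifferentiableAt ℝ u (ℓ x))
    (h₀ : HasExtDerivAt ω₀ 0 x) (h₁ : HasExtDerivAt ω₁ 0 x)
    (h₂ : HasExtDerivAt ω₂ 0 x) (h₃ : HasExtDerivAt ω₃ 0 x)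
    (hξ : HasExtDerivAt ξ (q • ω₀ x + l • ω₁ x) x) (hη : HasExtDerivAt η (-ω₂ x) x)
    (hW₂ : ((p + q * ℓ x) • ω₀ x + (k + l * ℓ x) • ω₁ x) ⋏ ω₂ x = 0)
    (hW₂' : ω₂ x ⋏ (q • ω₀ x + l • ω₁ x) = 0) :
    HasExtDerivAt (k := 3) (fun y => ((p + q * ℓ y) • ω₀ y + (k + l * ℓ y) • ω₁ y) ⋏ η y
      + τ ⋏ ξ y ⋏ η y + ℓ y • (ω₂ y ⋏ ξ y + u (ℓ y) • (ω₃ y ⋏ τ))) 0 x := by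
  have hτ : HasExtDerivAt (fun _ : E => τ) 0 x := HasExtDerivAt.const _
  set W' := q • ω₀ x + l • ω₁ x with hW'
  have hA : HasExtDerivAt (k := 3)
      (fun y => ((p + q * ℓ y) • ω₀ y + (k + l * ℓ y) • ω₁ y) ⋏ η y)
      (τ ⋏ W' ⋏ η x : E [⋀^Fin 4]→L[ℝ] ℝ) x := by
    refine ((hasExtDerivAt_affine_family h₀ h₁).wedge_two_one hη).congr_deriv ?_
    rw [Ext.wedge_neg, hW₂, neg_zero]
    exact add_zero _
  have hB : HasExtDerivAt (k := 3) (fun y => τ ⋏ ξ y ⋏ η y)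
      (-(τ ⋏ W' ⋏ η x) - τ ⋏ (ω₂ x ⋏ ξ x) : E [⋀^Fin 4]→L[ℝ] ℝ) x := by
    refine ((hτ.wedge_one_one hξ).wedge_two_one hη).congr_deriv ?_
    rw [← Ext.one_one_wedge_two, Ext.wedge_neg, Ext.zero_wedge, sub_eq_add_neg, sub_eq_add_neg]
    refine congrArg (· + _) ?_
    rw [zero_add, Ext.neg_wedge]
  have hC : HasExtDerivAt (k := 3) (fun y => ω₂ y ⋏ ξ y) 0 x := by
    refine (h₂.wedge_two_one hξ).congr_deriv ?_
    rw [hW₂', Ext.zero_wedge]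
    exact add_zero _
  have hD : HasExtDerivAt (k := 3) (fun y => u (ℓ y) • (ω₃ y ⋏ τ)) 0 x := by
    refine ((h₃.wedge_two_one hτ).smul_comp_three hu.hasDerivAt rfl).congr_deriv ?_
    have e : ((0 : E [⋀^Fin 3]→L[ℝ] ℝ) ⋏ τ : E [⋀^Fin 4]→L[ℝ] ℝ) +
        ω₃ x ⋏ (0 : E [⋀^Fin 2]→L[ℝ] ℝ) = 0 := by
      rw [Ext.zero_wedge, Ext.wedge_zero]
      exact add_zero _
    rw [Ext.wedge_two_wedge_self, smul_zero]
    exact (zero_add _).trans ((congrArg _ e).trans (smul_zero _))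
  have hE : HasExtDerivAt (k := 3) (fun y => ℓ y • (ω₂ y ⋏ ξ y + u (ℓ y) • (ω₃ y ⋏ τ)))
      (τ ⋏ (ω₂ x ⋏ ξ x) : E [⋀^Fin 4]→L[ℝ] ℝ) x := by
    refine ((hC.add hD).smul_comp_three (hasDerivAt_id (ℓ x)) rfl).congr_deriv ?_
    rw [Ext.wedge_add_right, Ext.wedge_smul, Ext.wedge_two_wedge_self, smul_zero, one_smul,
      add_zero, add_zero, smul_zero]
    exact add_zero _
  refine ((hA.add hB).add hE).congr_deriv ?_
  have e (A B : E [⋀^Fin 4]→L[ℝ] ℝ) : A + (-A - B) + B = 0 := by abel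
  exact e _ _

/-- Closedness of `*φ`. With `f = (k + l t)² - (p + q t)²` one has `ω̃ ∧ ω̃' = ½ f' ω₂ ∧ ω₂`, and
the coefficient of `dt ∧ ω₂ ∧ ω₂` is `(½ t² f)' - t² (½ f') - t f = 0`. -/
theorem hasExtDerivAt_starPhi
    (h₀ : HasExtDerivAt ω₀ 0 x) (h₁ : HasExtDerivAt ω₁ 0 x)
    (h₂ : HasExtDerivAt ω₂ 0 x) (h₃ : HasExtDerivAt ω₃ 0 x)
    (hξ : HasExtDerivAt ξ (q • ω₀ x + l • ω₁ x) x) (hη : HasExtDerivAt η (-ω₂ x) x)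
    (hWW : ((p + q * ℓ x) • ω₀ x + (k + l * ℓ x) • ω₁ x) ⋏ (q • ω₀ x + l • ω₁ x) =
      (l * (k + l * ℓ x) - q * (p + q * ℓ x)) • (ω₂ x ⋏ ω₂ x))
    (h₃₂ : ω₃ x ⋏ ω₂ x = 0) (h₃W' : ω₃ x ⋏ (q • ω₀ x + l • ω₁ x) = 0) :
    HasExtDerivAt (k := 4) (fun y =>
      (ℓ y ^ 2 * ((k + l * ℓ y) ^ 2 - (p + q * ℓ y) ^ 2) / 2) • (ω₂ y ⋏ ω₂ y)
      - ℓ y ^ 2 • (((p + q * ℓ y) • ω₀ y + (k + l * ℓ y) • ω₁ y) ⋏ (ξ y ⋏ τ))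
      + (ℓ y * ((k + l * ℓ y) ^ 2 - (p + q * ℓ y) ^ 2)) • (ω₂ y ⋏ (η y ⋏ τ))
      - ω₃ y ⋏ (η y ⋏ ξ y)) 0 x := by
  have hτ : HasExtDerivAt (fun _ : E => τ) 0 x := HasExtDerivAt.const _
  set W' := q • ω₀ x + l • ω₁ x with hW'
  set t := ℓ x with ht
  set f := (k + l * t) ^ 2 - (p + q * t) ^ 2 with hf
  set c := l * (k + l * t) - q * (p + q * t) with hc
  have hdf : HasDerivAt (fun t : ℝ => (k + l * t) ^ 2 - (p + q * t) ^ 2) (2 * c) t := by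
    refine (((hasDerivAt_affine k l t).pow 2).sub ((hasDerivAt_affine p q t).pow 2)).congr_deriv ?_
    rw [hc]; norm_num; ring
  have hdsq : HasDerivAt (fun t : ℝ => t ^ 2) (2 * t) t := by simpa using hasDerivAt_pow 2 t
  have hdu : HasDerivAt (fun t : ℝ => t * ((k + l * t) ^ 2 - (p + q * t) ^ 2))
      (f + t * (2 * c)) t := by
    exact ((hasDerivAt_id' t).mul hdf).congr_deriv (by rw [one_mul])
  have hdg : HasDerivAt (fun t : ℝ => t ^ 2 * ((k + l * t) ^ 2 - (p + q * t) ^ 2) / 2)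
      ((2 * t * f + t ^ 2 * (2 * c)) / 2) t :=
    (hdsq.mul hdf).div_const 2
  set vol : E [⋀^Fin 5]→L[ℝ] ℝ := ω₂ x ⋏ ω₂ x ⋏ τ with hvol
  have hA : HasExtDerivAt (k := 4) (fun y =>
      (ℓ y ^ 2 * ((k + l * ℓ y) ^ 2 - (p + q * ℓ y) ^ 2) / 2) • (ω₂ y ⋏ ω₂ y))
      (((2 * t * f + t ^ 2 * (2 * c)) / 2) • vol) x := by
    have h := (h₂.wedge_two_two h₂ (Ext.zero_wedge _) (Ext.wedge_zero _)).smul_comp_four hdg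
      (Ext.one_wedge_two_two (τ) (ω₂ x) (ω₂ x))
    have e (r s : ℝ) : r • vol + s • (0 + 0) = r • vol := by simp
    exact h.congr_deriv (e _ _)
  have hB : HasExtDerivAt (k := 4) (fun y =>
      ℓ y ^ 2 • (((p + q * ℓ y) • ω₀ y + (k + l * ℓ y) • ω₁ y) ⋏ (ξ y ⋏ τ)))
      (t ^ 2 • c • vol) x := by
    have e₁ : HasExtDerivAt (k := 2) (fun y => ξ y ⋏ τ) (W' ⋏ τ : E [⋀^Fin 3]→L[ℝ] ℝ) x := by
      refine (hξ.wedge_one_one hτ).congr_deriv ?_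
      rw [Ext.wedge_zero]
      exact sub_zero _
    have e₂ : (((p + q * ℓ x) • ω₀ x + (k + l * ℓ x) • ω₁ x) ⋏ (W' ⋏ τ) :
        E [⋀^Fin 5]→L[ℝ] ℝ) = c • vol := by
      refine (Ext.two_wedge_two_one (τ) _ W').trans ?_
      rw [hWW, Ext.smul_wedge]
    have h := ((hasExtDerivAt_affine_family h₀ h₁).wedge_two_two e₁
      (Ext.one_two_wedge_one_self (τ) (ξ x) W') e₂).smul_comp_four hdsq
      (Ext.wedge_two_wedge_one_self (τ) (ξ x) _)
    have e (r s : ℝ) : r • (0 : E [⋀^Fin 5]→L[ℝ] ℝ) + s • (0 + c • vol) = s • c • vol := by simp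
    exact h.congr_deriv (e _ _)
  have hC : HasExtDerivAt (k := 4) (fun y =>
      (ℓ y * ((k + l * ℓ y) ^ 2 - (p + q * ℓ y) ^ 2)) • (ω₂ y ⋏ (η y ⋏ τ)))
      ((t * f) • -vol) x := by
    have e₁ : HasExtDerivAt (k := 2) (fun y => η y ⋏ τ)
        (-(ω₂ x ⋏ τ) : E [⋀^Fin 3]→L[ℝ] ℝ) x := by
      refine (hη.wedge_one_one hτ).congr_deriv ?_
      rw [Ext.wedge_zero, Ext.neg_wedge]
      exact sub_zero _
    have e₂ : (ω₂ x ⋏ -(ω₂ x ⋏ τ) : E [⋀^Fin 5]→L[ℝ] ℝ) = -vol := by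
      rw [Ext.wedge_neg]
      exact congrArg Neg.neg (Ext.two_wedge_two_one (τ) (ω₂ x) (ω₂ x))
    have h := (h₂.wedge_two_two e₁ (Ext.zero_wedge _) e₂).smul_comp_four hdu
      (Ext.wedge_two_wedge_one_self (τ) (η x) _)
    have e (r s : ℝ) : r • (0 : E [⋀^Fin 5]→L[ℝ] ℝ) + s • (0 + -vol) = s • -vol := by simp
    exact h.congr_deriv (e _ _)
  have hD : HasExtDerivAt (k := 4) (fun y => ω₃ y ⋏ (η y ⋏ ξ y)) 0 x := by
    have e₁ : (ω₃ x ⋏ (ω₂ x ⋏ ξ x) : E [⋀^Fin 5]→L[ℝ] ℝ) = 0 := by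
      refine (Ext.two_wedge_two_one (ξ x) (ω₃ x) (ω₂ x)).trans ?_
      rw [h₃₂, Ext.zero_wedge]
    have e₂ : (ω₃ x ⋏ (η x ⋏ W') : E [⋀^Fin 5]→L[ℝ] ℝ) = 0 := by
      refine (Ext.two_wedge_one_two (η x) (ω₃ x) W').trans ?_
      rw [h₃W', Ext.zero_wedge]
    have e₃ : HasExtDerivAt (k := 2) (fun y => η y ⋏ ξ y)
        ((-1 : ℝ) • (ω₂ x ⋏ ξ x : E [⋀^Fin 3]→L[ℝ] ℝ) + (-1 : ℝ) • (η x ⋏ W')) x := by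
      refine (hη.wedge_one_one hξ).congr_deriv ?_
      have e (A B : E [⋀^Fin 3]→L[ℝ] ℝ) : -A - B = (-1 : ℝ) • A + (-1 : ℝ) • B := by module
      rw [Ext.neg_wedge]
      exact e _ _
    have e₄ : (ω₃ x ⋏ ((-1 : ℝ) • (ω₂ x ⋏ ξ x : E [⋀^Fin 3]→L[ℝ] ℝ) + (-1 : ℝ) • (η x ⋏ W')) :
        E [⋀^Fin 5]→L[ℝ] ℝ) = 0 := by
      rw [Ext.wedge_add_right, Ext.wedge_smul, Ext.wedge_smul, e₁, e₂]
      simp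
    have h := h₃.wedge_two_two e₃ (Ext.zero_wedge _) e₄
    have e : (0 + 0 : E [⋀^Fin 5]→L[ℝ] ℝ) = 0 := add_zero 0
    exact h.congr_deriv e
  refine (((hA.sub hB).add hC).sub hD).congr_deriv ?_
  have e (A : E [⋀^Fin 5]→L[ℝ] ℝ) : ((2 * t * f + t ^ 2 * (2 * c)) / 2) • A - t ^ 2 • c • A
      + (t * f) • -A - 0 = 0 := by
    module
  exact e _

end Closedness

end Calculus

/-! ### Differential forms in charts -/

section PullbackSmooth

open Topology

variable {E F G : Type*} [NormedAddCommGroup E] [NormedSpace ℝ E] [NormedAddCommGroup F]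
  [NormedSpace ℝ F] [NormedAddCommGroup G] [NormedSpace ℝ G]

/-- The continuous linear projection of multilinear maps onto alternating maps. -/
def ContinuousMultilinearMap.alternatizationCLM (k : ℕ) :
    ContinuousMultilinearMap ℝ (fun _ : Fin k => G) ℝ →L[ℝ] G [⋀^Fin k]→L[ℝ] ℝ :=
  LinearMap.mkContinuous
    { toFun := fun f => (k.factorial : ℝ)⁻¹ • f.alternatization
      map_add' := fun f g => by rw [map_add, smul_add]
      map_smul' := fun c f => by
        ext v
        simp only [ContinuousAlternatingMap.smul_apply, Ext.alternatization_eq_altSum]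
        have h : altSum (⇑(c • f)) v = c * altSum f v := altSum_const_mul c f v
        rw [h]
        simp only [smul_eq_mul, RingHom.id_apply]
        ring } 1 fun f => by
    refine ContinuousAlternatingMap.opNorm_le_bound _ (by positivity) fun v => ?_
    have h : ‖f.alternatization v‖ ≤ k.factorial * (‖f‖ * ∏ i, ‖v i‖) := by
      rw [ContinuousMultilinearMap.alternatization_apply_apply]
      refine (norm_sum_le_of_le (f := fun σ : Equiv.Perm (Fin k) =>
        Equiv.Perm.sign σ • f (v ∘ σ)) (n := fun _ => ‖f‖ * ∏ i, ‖v i‖) Finset.univ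
          fun σ _ => ?_).trans ?_
      · rw [Units.smul_def, zsmul_eq_mul, norm_mul]
        have h₁ : ‖(((Equiv.Perm.sign σ : ℤˣ) : ℤ) : ℝ)‖ = 1 := by
          rcases Int.units_eq_one_or (Equiv.Perm.sign σ) with h | h <;> simp [h]
        rw [h₁, one_mul]
        refine (f.le_opNorm _).trans_eq ?_
        exact congrArg _ (Equiv.prod_comp σ fun i => ‖v i‖)
      · simp [Fintype.card_perm]
    change ‖(k.factorial : ℝ)⁻¹ • f.alternatization v‖ ≤ _
    rw [norm_smul, norm_inv, Real.norm_natCast, inv_mul_le_iff₀ (by positivity), one_mul]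
    exact h

/-- Together with linearity and continuity, this reduces smoothness of a pulled back alternating
form to that of its underlying multilinear map. -/
theorem ContinuousMultilinearMap.alternatizationCLM_coe {k : ℕ} (α : G [⋀^Fin k]→L[ℝ] ℝ) :
    ContinuousMultilinearMap.alternatizationCLM k α.toContinuousMultilinearMap = α := by
  ext v
  refine Eq.trans ?_ (Ext.apply_eq_altSum α v).symm
  change (k.factorial : ℝ)⁻¹ • α.toContinuousMultilinearMap.alternatization v = _
  rw [Ext.alternatization_eq_altSum]
  rfl

theorem ContDiffAt.alternatingCompContinuousLinearMap {k : ℕ} {n : WithTop ℕ∞}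
    {α : E → F [⋀^Fin k]→L[ℝ] ℝ} {L : E → G →L[ℝ] F} {x : E} (hα : ContDiffAt ℝ n α x)
    (hL : ContDiffAt ℝ n L x) :
    ContDiffAt ℝ n (fun y => (α y).compContinuousLinearMap (L y)) x := by
  have h₁ : ContDiffAt ℝ n (fun y =>
      (ContinuousMultilinearMap.compContinuousLinearMapContinuousMultilinear ℝ
        (fun _ : Fin k => G) (fun _ : Fin k => F) ℝ) (fun _ => L y)
        (ContinuousAlternatingMap.toContinuousMultilinearMapCLM ℝ (α y))) x :=
    ContDiffAt.clm_apply
      ((ContinuousMultilinearMap.contDiff _).contDiffAt.comp x (contDiffAt_pi.2 fun _ => hL))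
      ((ContinuousLinearMap.contDiff _).contDiffAt.comp x hα)
  have h₂ := (ContinuousMultilinearMap.alternatizationCLM (G := G) k).contDiff.contDiffAt.comp x h₁
  refine h₂.congr_of_eventuallyEq (Filter.Eventually.of_forall fun y => ?_)
  exact (ContinuousMultilinearMap.alternatizationCLM_coe
    ((α y).compContinuousLinearMap (L y))).symm

end PullbackSmooth

section Charts

open Topology Filter

variable {E : Type*} [NormedAddCommGroup E] [NormedSpace ℝ E]
  {H : Type*} [TopologicalSpace H] {I : ModelWithCorners ℝ E H}
  {X : Type*} [TopologicalSpace X] [ChartedSpace H X]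
  {E' : Type*} [NormedAddCommGroup E'] [NormedSpace ℝ E']
  {H' : Type*} [TopologicalSpace H'] {I' : ModelWithCorners ℝ E' H'}
  {X' : Type*} [TopologicalSpace X'] [ChartedSpace H' X']

/-- All tangent spaces are the model space by definition, so values of a form at different points
can be compared. -/
theorem DiffForm.congr_point {k : ℕ} (α : DiffForm I X k) {x x' : X} (h : x = x') :
    (α x : E [⋀^Fin k]→L[ℝ] ℝ) = α x' := by
  subst h; rfl

section Boundaryless

variable [I.Boundaryless]

theorem contDiffAt_writtenInCharts {f : X → X'} {z : X} (hf : ContMDiffAt I I' ∞ f z) :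
    ContDiffAt ℝ ∞ (fun y => extChartAt I' (f z) (f ((extChartAt I z).symm y)))
      (extChartAt I z z) := by
  have h := (contMDiffAt_iff.1 hf).2
  rwa [I.range_eq_univ, contDiffWithinAt_univ] at h

theorem fderiv_writtenInCharts {f : X → X'} {z : X} (hf : ContMDiffAt I I' ∞ f z) :
    (fderiv ℝ (fun y => extChartAt I' (f z) (f ((extChartAt I z).symm y))) (extChartAt I z z) :
      E →L[ℝ] E') = mfderiv I I' f z := by
  have h := (hf.mdifferentiableAt (by simp)).mfderiv
  rw [I.range_eq_univ, fderivWithin_univ] at h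
  exact h.symm

end Boundaryless

variable [IsManifold I ∞ X]

theorem mfderiv_extChartAt_self_eq (x : X) :
    mfderiv I 𝓘(ℝ, E) (extChartAt I x) x = ContinuousLinearMap.id ℝ E := by
  have : IsManifold I 1 X := IsManifold.of_le (n := ∞) (by norm_num)
  exact mfderiv_extChartAt_self

theorem DiffForm.d_eq {k : ℕ} (α : DiffForm I X k) (x : X) :
    α.d x = extDeriv (α.inChart x) (extChartAt I x x) := by
  rw [DiffForm.d, mfderiv_extChartAt_self_eq]
  rfl

theorem mdifferentiableAt_extChartAt' {x y : X} (hy : y ∈ (extChartAt I x).source) :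
    MDifferentiableAt I 𝓘(ℝ, E) (extChartAt I x) y := by
  have : IsManifold I 1 X := IsManifold.of_le (n := ∞) (by norm_num)
  exact mdifferentiableAt_extChartAt (by rwa [extChartAt_source] at hy)

variable [I.Boundaryless]

theorem mfderiv_extChartAt_symm_self (x : X) :
    mfderiv 𝓘(ℝ, E) I (extChartAt I x).symm (extChartAt I x x) = ContinuousLinearMap.id ℝ E := by
  have : IsManifold I 1 X := IsManifold.of_le (n := ∞) (by norm_num)
  have h := mfderivWithin_range_extChartAt_symm (I := I) (x := x)
  rwa [I.range_eq_univ, mfderivWithin_univ] at h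

theorem mdifferentiableAt_extChartAt_symm' {x : X} {y : E} (hy : y ∈ (extChartAt I x).target) :
    MDifferentiableAt 𝓘(ℝ, E) I (extChartAt I x).symm y := by
  have : IsManifold I 1 X := IsManifold.of_le (n := ∞) (by norm_num)
  have h := mdifferentiableWithinAt_extChartAt_symm (I := I) hy
  rwa [I.range_eq_univ, mdifferentiableWithinAt_univ] at h

namespace DiffForm

variable {k : ℕ}

theorem inChart_self (α : DiffForm I X k) (x : X) :
    α.inChart x (extChartAt I x x) = α x := by
  rw [inChart, mfderiv_extChartAt_symm_self]
  exact (congr_point α (extChartAt_to_inv x))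

variable [I'.Boundaryless] [IsManifold I' ∞ X']

/-- In charts, the pullback of a form is given by the usual formula. -/
theorem inChart_pullback {f : X → X'} {z : X} (hf : ContMDiffAt I I' ∞ f z)
    (α : DiffForm I' X' k) :
    (pullback (I := I) f α).inChart z =ᶠ[𝓝 (extChartAt I z z)] fun y =>
      (α.inChart (f z) (extChartAt I' (f z) (f ((extChartAt I z).symm y)))).compContinuousLinearMap
        (fderiv ℝ (fun y => extChartAt I' (f z) (f ((extChartAt I z).symm y))) y) := by
  have hsymm : Tendsto (extChartAt I z).symm (𝓝 (extChartAt I z z)) (𝓝 z) := by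
    have := (continuousAt_extChartAt_symm (I := I) z).tendsto
    rwa [extChartAt_to_inv] at this
  have h₁ : ∀ᶠ x in 𝓝 z, MDifferentiableAt I I' f x := by
    have h := (contMDiffAt_iff_contMDiffAt_nhds (n := 1) (by simp)).1 (hf.of_le (by norm_num))
    filter_upwards [h] with x hx using hx.mdifferentiableAt (by simp)
  have h₂ : ∀ᶠ x in 𝓝 z, f x ∈ (extChartAt I' (f z)).source :=
    hf.continuousAt.preimage_mem_nhds (extChartAt_source_mem_nhds (f z))
  have h₂' : ∀ᶠ y in 𝓝 (extChartAt I z z), ∀ᶠ y' in 𝓝 y,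
      f ((extChartAt I z).symm y') ∈ (extChartAt I' (f z)).source :=
    (hsymm.eventually h₂).eventually_nhds
  have h₃ : ∀ᶠ y in 𝓝 (extChartAt I z z), y ∈ (extChartAt I z).target :=
    extChartAt_target_mem_nhds z
  filter_upwards [hsymm.eventually h₁, h₂', h₃] with y hy₁ hy₂ hy₃
  have hy₂' := hy₂.self_of_nhds
  set φ := extChartAt I z
  set φ' := extChartAt I' (f z)
  have hs : MDifferentiableAt 𝓘(ℝ, E) I φ.symm y := mdifferentiableAt_extChartAt_symm' hy₃
  have hfs : MDifferentiableAt 𝓘(ℝ, E) I' (fun y => f (φ.symm y)) y := hy₁.comp y hs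
  have hF : MDifferentiableAt 𝓘(ℝ, E) 𝓘(ℝ, E') (fun y => φ' (f (φ.symm y))) y :=
    (mdifferentiableAt_extChartAt' hy₂').comp y hfs
  have hs' : MDifferentiableAt 𝓘(ℝ, E') I' φ'.symm (φ' (f (φ.symm y))) :=
    mdifferentiableAt_extChartAt_symm' (φ'.map_source hy₂')
  have e₁ : mfderiv 𝓘(ℝ, E) I' (fun y => f (φ.symm y)) y =
      (mfderiv I I' f (φ.symm y)).comp (mfderiv 𝓘(ℝ, E) I φ.symm y) := mfderiv_comp y hy₁ hs
  have e₂ : mfderiv 𝓘(ℝ, E) I' (fun y => φ'.symm (φ' (f (φ.symm y)))) y =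
      (mfderiv 𝓘(ℝ, E') I' φ'.symm (φ' (f (φ.symm y)))).comp
        (mfderiv 𝓘(ℝ, E) 𝓘(ℝ, E') (fun y => φ' (f (φ.symm y))) y) := mfderiv_comp y hs' hF
  have e₃ : (fun y => φ'.symm (φ' (f (φ.symm y)))) =ᶠ[𝓝 y] fun y => f (φ.symm y) := by
    filter_upwards [hy₂] with y' hy' using φ'.left_inv hy'
  rw [mfderiv_eq_fderiv] at e₂
  have e₄ : (mfderiv 𝓘(ℝ, E) I' (fun y => φ'.symm (φ' (f (φ.symm y)))) y : E →L[ℝ] E') =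
      mfderiv 𝓘(ℝ, E) I' (fun y => f (φ.symm y)) y := e₃.mfderiv_eq
  have e₅ : (α (f (φ.symm y)) : E' [⋀^Fin k]→L[ℝ] ℝ) = α (φ'.symm (φ' (f (φ.symm y)))) :=
    congr_point α (φ'.left_inv hy₂').symm
  ext v
  have e₆ (w : E) : (mfderiv I I' f (φ.symm y) (mfderiv 𝓘(ℝ, E) I φ.symm y w) : E') =
      mfderiv 𝓘(ℝ, E') I' φ'.symm (φ' (f (φ.symm y)))
        (fderiv ℝ (fun y => φ' (f (φ.symm y))) y w) :=
    (DFunLike.congr_fun e₁ w).symm.trans ((DFunLike.congr_fun e₄ w).symm.trans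
      (DFunLike.congr_fun e₂ w))
  change (α (f (φ.symm y)) : E' [⋀^Fin k]→L[ℝ] ℝ) (fun i => (mfderiv I I' f (φ.symm y)
    (mfderiv 𝓘(ℝ, E) I φ.symm y (v i)) : E')) = (α (φ'.symm (φ' (f (φ.symm y)))) :
      E' [⋀^Fin k]→L[ℝ] ℝ) fun i => (mfderiv 𝓘(ℝ, E') I' φ'.symm (φ' (f (φ.symm y)))
        (fderiv ℝ (fun y => φ' (f (φ.symm y))) y (v i)) : E')
  rw [e₅]
  exact congrArg _ (funext fun i => e₆ (v i))

/-- The pullback of a smooth form by a smooth map is smooth. -/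
theorem contDiffAt_inChart_pullback {f : X → X'} {z : X} (hf : ContMDiffAt I I' ∞ f z)
    {α : DiffForm I' X' k} (hα : ContDiffAt ℝ ∞ (α.inChart (f z)) (extChartAt I' (f z) (f z))) :
    ContDiffAt ℝ ∞ ((pullback (I := I) f α).inChart z) (extChartAt I z z) := by
  refine ContDiffAt.congr_of_eventuallyEq ?_ (inChart_pullback hf α)
  have hF := contDiffAt_writtenInCharts hf
  refine ContDiffAt.alternatingCompContinuousLinearMap ?_ (hF.fderiv_right (m := ∞) (by simp))
  refine ContDiffAt.comp (g := α.inChart (f z)) _ ?_ hF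
  rwa [extChartAt_to_inv]

/-- The exterior derivative commutes with pullback. -/
theorem hasExtDerivAt_inChart_pullback {f : X → X'} {z : X} (hf : ContMDiffAt I I' ∞ f z)
    {α : DiffForm I' X' k} (hα : ContDiffAt ℝ ∞ (α.inChart (f z)) (extChartAt I' (f z) (f z))) :
    HasExtDerivAt ((pullback (I := I) f α).inChart z)
      ((α.d (f z)).compContinuousLinearMap (mfderiv I I' f z)) (extChartAt I z z) := by
  refine ⟨(contDiffAt_inChart_pullback hf hα).differentiableAt (by simp), ?_⟩
  rw [(inChart_pullback hf α).extDeriv_eq, d_eq, ← fderiv_writtenInCharts hf]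
  have hα' : DifferentiableAt ℝ (α.inChart (f z))
      (extChartAt I' (f z) (f ((extChartAt I z).symm (extChartAt I z z)))) := by
    rw [extChartAt_to_inv]
    exact hα.differentiableAt (by simp)
  have h := extDeriv_pullback (r := ∞)
    (f := fun y => extChartAt I' (f z) (f ((extChartAt I z).symm y))) (x := extChartAt I z z)
    hα' (contDiffAt_writtenInCharts hf)
    (by rw [minSmoothness_of_isRCLikeNormedField]; exact WithTop.coe_le_coe.2 (le_top : (2 : ℕ∞) ≤ ⊤))
  rw [h, extChartAt_to_inv]
  rfl

theorem d_pullback {f : X → X'} {z : X} (hf : ContMDiffAt I I' ∞ f z)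
    {α : DiffForm I' X' k} (hα : ContDiffAt ℝ ∞ (α.inChart (f z)) (extChartAt I' (f z) (f z))) :
    (pullback (I := I) f α).d z = (α.d (f z)).compContinuousLinearMap (mfderiv I I' f z) := by
  rw [d_eq]
  exact (hasExtDerivAt_inChart_pullback hf hα).extDeriv_eq

end DiffForm

end Charts

/-! ### The Poincaré lemma for 2-forms -/

section ParametricIntegral

open MeasureTheory Topology Set

variable {P F : Type*} [NormedAddCommGroup P] [NormedSpace ℝ P] [NormedAddCommGroup F]
  [NormedSpace ℝ F]

/-- Smooth dependence of an integral over `[0, 1]` on parameters, obtained by writing it as a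
convolution with an indicator function. -/
theorem contDiff_integral_of_contDiff {g : P → ℝ → F} (hg : ContDiff ℝ ∞ (Function.uncurry g)) :
    ContDiff ℝ ∞ fun p => ∫ s in (0 : ℝ)..1, g p s := by
  -- the convolution at `0` integrates `g p (-t)` over the support `[-1, 0]` of `f`; the cut-off
  -- function is `1` there and provides the compact support required of the smooth factor
  let χ : ContDiffBump (0 : ℝ) := ⟨2, 3, by norm_num, by norm_num⟩
  let f : ℝ → ℝ := indicator (Icc (-1) 0) fun _ => 1
  have h := contDiffOn_convolution_right_with_param_comp (μ := volume) (n := ⊤)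
    (ContinuousLinearMap.lsmul ℝ ℝ : ℝ →L[ℝ] F →L[ℝ] F) (s := (univ : Set P))
    (v := fun _ => (0 : ℝ)) contDiffOn_const (f := f) (g := fun p x => χ x • g p x)
    (k := Metric.closedBall 0 3) isOpen_univ (isCompact_closedBall _ _)
    (fun p x _ hx => by
      rw [χ.zero_of_le_dist (by simpa [χ] using (not_le.1 (Metric.mem_closedBall.not.1 hx)).le), zero_smul])
    ((integrable_indicator_iff measurableSet_Icc).2 (by simp)).locallyIntegrable
    ((χ.contDiff.comp contDiff_snd).smul hg).contDiffOn
  rw [contDiffOn_univ] at h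
  convert h using 2 with p
  rw [convolution_def]
  have e : ∀ t : ℝ, ContinuousLinearMap.lsmul ℝ ℝ (f t) (χ (0 - t) • g p (0 - t)) =
      indicator (Icc (-1) 0) (fun t => g p (-t)) t := by
    intro t
    by_cases ht : t ∈ Icc (-1 : ℝ) 0
    · have h₁ : χ (0 - t) = 1 := χ.one_of_mem_closedBall (by
        rw [mem_closedBall_zero_iff, Real.norm_eq_abs, abs_le]
        exact ⟨by simp [χ]; linarith [ht.2], by simp [χ]; linarith [ht.1]⟩)
      rw [h₁]
      simp [f, ht]
    · simp [f, ht]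
  simp only [e]
  rw [integral_indicator measurableSet_Icc, integral_Icc_eq_integral_Ioc,
    ← intervalIntegral.integral_of_le (by norm_num), intervalIntegral.integral_comp_neg]
  simp

theorem continuous_fderiv_of_contDiff {g : P → ℝ → F}
    (hg : ContDiff ℝ ∞ (Function.uncurry g)) :
    Continuous fun q : P × ℝ => fderiv ℝ (fun p => g p q.2) q.1 :=
  (ContDiff.fderiv (f := fun (q : P × ℝ) p => g p q.2) (m := ∞) (n := 0)
    (hg.comp (contDiff_snd.prodMk (contDiff_snd.comp contDiff_fst))) contDiff_fst
    (by simp)).continuous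

/-- Differentiation under the integral sign; the derivative is bounded because it is continuous on
a compact product. -/
theorem hasFDerivAt_integral_of_contDiff [FiniteDimensional ℝ P] {g : P → ℝ → F}
    (hg : ContDiff ℝ ∞ (Function.uncurry g)) (p : P) :
    HasFDerivAt (fun p => ∫ s in (0 : ℝ)..1, g p s)
      (∫ s in (0 : ℝ)..1, fderiv ℝ (fun p => g p s) p) p := by
  have hc := continuous_fderiv_of_contDiff hg
  obtain ⟨C, hC⟩ := ((isCompact_closedBall p 1).prod (isCompact_Icc (a := (0 : ℝ)) (b := 1))
    ).exists_bound_of_continuousOn hc.continuousOn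
  have hgs (s : ℝ) : ContDiff ℝ ∞ (fun p => g p s) := hg.comp (contDiff_id.prodMk contDiff_const)
  have hgp (p : P) : Continuous (g p) := hg.continuous.comp (continuous_const.prodMk continuous_id)
  refine intervalIntegral.hasFDerivAt_integral_of_dominated_of_fderiv_le
    (F' := fun p s => fderiv ℝ (fun p => g p s) p) (bound := fun _ => C)
    (Metric.closedBall_mem_nhds p one_pos) (Filter.Eventually.of_forall fun p => ?_) ?_ ?_ ?_ ?_ ?_
  · exact (hgp p).aestronglyMeasurable
  · exact (hgp p).intervalIntegrable _ _
  · exact (hc.comp (continuous_const.prodMk continuous_id)).aestronglyMeasurable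
  · refine Filter.Eventually.of_forall fun s hs x hx => hC (x, s) ⟨hx, ?_⟩
    rw [uIoc_of_le zero_le_one] at hs
    exact Ioc_subset_Icc_self hs
  · exact intervalIntegrable_const
  · exact Filter.Eventually.of_forall fun s _ x _ =>
      ((hgs s).differentiable (by simp) x).hasFDerivAt

/-- Differentiation under the integral sign, followed by a continuous linear map: for the
alternatisation this says that the exterior derivative commutes with the integral. -/
theorem map_fderiv_integral_of_contDiff [FiniteDimensional ℝ P] [CompleteSpace F] {G : Type*}
    [NormedAddCommGroup G] [NormedSpace ℝ G] [CompleteSpace G] (C : (P →L[ℝ] F) →L[ℝ] G)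
    {g : P → ℝ → F} (hg : ContDiff ℝ ∞ (Function.uncurry g)) (p : P) :
    C (fderiv ℝ (fun p => ∫ s in (0 : ℝ)..1, g p s) p) =
      ∫ s in (0 : ℝ)..1, C (fderiv ℝ (fun p => g p s) p) := by
  rw [(hasFDerivAt_integral_of_contDiff hg p).fderiv]
  have hc : Continuous fun s => fderiv ℝ (fun p => g p s) p :=
    (continuous_fderiv_of_contDiff hg).comp (continuous_const.prodMk continuous_id)
  exact (C.intervalIntegral_comp_comm (hc.intervalIntegrable _ _)).symm

end ParametricIntegral

section Poincare

open Topology Set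

variable {E : Type*} [NormedAddCommGroup E] [NormedSpace ℝ E]

theorem isBoundedBilinearMap_curryLeft :
    IsBoundedBilinearMap ℝ fun p : (E [⋀^Fin 2]→L[ℝ] ℝ) × E =>
      (p.1.curryLeft p.2 : E [⋀^Fin 1]→L[ℝ] ℝ) where
  add_left _ _ _ := rfl
  smul_left _ _ _ := rfl
  add_right α v w := map_add _ v w
  smul_right c α v := map_smul _ c v
  bound := ⟨1, one_pos, fun α v => by
    rw [one_mul]
    refine (α.curryLeft.le_opNorm v).trans_eq ?_
    rw [ContinuousAlternatingMap.norm_curryLeft]⟩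

/-- The exterior derivative of the integrand `s (y - y₀) ⌟ b(y₀ + s (y - y₀))` of the homotopy
operator for the contraction to `y₀`. Closedness of `b` turns it into
`d/ds (s² b(y₀ + s (y - y₀)))`. -/
theorem hasExtDerivAt_homotopy {b : E → E [⋀^Fin 2]→L[ℝ] ℝ} {y₀ y : E} {s : ℝ}
    (hb : DifferentiableAt ℝ b (y₀ + s • (y - y₀))) (hcl : extDeriv b (y₀ + s • (y - y₀)) = 0) :
    HasExtDerivAt (fun y => s • (b (y₀ + s • (y - y₀))).curryLeft (y - y₀))
      ((2 * s) • b (y₀ + s • (y - y₀)) +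
        s ^ 2 • fderiv ℝ b (y₀ + s • (y - y₀)) (y - y₀)) y := by
  set z := y₀ + s • (y - y₀) with hz
  have h₁ : HasFDerivAt (fun y => y - y₀) (ContinuousLinearMap.id ℝ E) y :=
    (hasFDerivAt_id y).sub_const y₀
  have h₂ : HasFDerivAt (fun y => y₀ + s • (y - y₀)) (s • ContinuousLinearMap.id ℝ E) y :=
    (h₁.const_smul s).const_add y₀
  have h₃ := hb.hasFDerivAt.comp y h₂
  have h₄ := (isBoundedBilinearMap_curryLeft.hasFDerivAt (b z, y - y₀)).comp y (h₃.prodMk h₁)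
  have h₅ := h₄.const_smul s
  refine ⟨h₅.differentiableAt, ?_⟩
  rw [extDeriv]
  rw [show fderiv ℝ (fun y => s • (b (y₀ + s • (y - y₀))).curryLeft (y - y₀)) y = _ from h₅.fderiv]
  ext v
  have hc : extDeriv b z ![y - y₀, v 0, v 1] = 0 := by rw [hcl]; rfl
  rw [extDeriv, ContinuousAlternatingMap.alternatizeUncurryFin_apply, Fin.sum_univ_three] at hc
  rw [ContinuousAlternatingMap.alternatizeUncurryFin_apply, Fin.sum_univ_two]
  have r₀ : Fin.removeNth 0 ![y - y₀, v 0, v 1] = v := by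
    funext i; fin_cases i <;> rfl
  have r₁ : Fin.removeNth 1 ![y - y₀, v 0, v 1] = ![y - y₀, v 1] := by
    funext i; fin_cases i <;> rfl
  have r₂ : Fin.removeNth 2 ![y - y₀, v 0, v 1] = ![y - y₀, v 0] := by
    funext i; fin_cases i <;> rfl
  rw [r₀, r₁, r₂] at hc
  have t₀ : Fin.removeNth 0 v = ![v 1] := by
    funext i; fin_cases i; rfl
  have t₁ : Fin.removeNth 1 v = ![v 0] := by
    funext i; fin_cases i; rfl
  rw [t₀, t₁]
  have hswap : b z ![v 1, v 0] = -b z v := by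
    have h := (b z).toAlternatingMap.map_swap v (i := 0) (j := 1) (by decide)
    have e : v ∘ Equiv.swap 0 1 = ![v 1, v 0] := by funext i; fin_cases i <;> rfl
    rw [e] at h
    exact h
  have hv : ![v 0, v 1] = v := by funext i; fin_cases i <;> rfl
  have hD (w : E) (c : Fin 1 → E) : (s • (isBoundedBilinearMap_curryLeft.deriv (b z, y - y₀) ∘SL
      (fderiv ℝ b z ∘SL (s • ContinuousLinearMap.id ℝ E)).prod (ContinuousLinearMap.id ℝ E))) w c =
      s * (b z (Matrix.vecCons w c) + s * fderiv ℝ b z w (Matrix.vecCons (y - y₀) c)) := by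
    rw [smul_apply, ContinuousLinearMap.comp_apply,
      IsBoundedBilinearMap.deriv_apply]
    simp [-map_sub, ContinuousAlternatingMap.curryLeft_apply_apply]
    ring
  rw [hD, hD]
  simp only [ContinuousAlternatingMap.add_apply, ContinuousAlternatingMap.smul_apply, hswap, hv,
    smul_eq_mul] at hc ⊢
  have hc' : fderiv ℝ b z (y - y₀) v - fderiv ℝ b z (v 0) ![y - y₀, v 1] +
      fderiv ℝ b z (v 1) ![y - y₀, v 0] = 0 := by
    rw [← hc]
    simp [-map_sub]
    ring
  have s₀ : ((-1 : ℤ) ^ ((0 : Fin 2) : ℕ)) = 1 := rfl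
  have s₁ : ((-1 : ℤ) ^ ((1 : Fin 2) : ℕ)) = -1 := rfl
  rw [s₀, s₁, one_smul, neg_one_smul]
  linear_combination -s ^ 2 * hc'

/-- Joint smoothness in `y` and `s` of the integrand of the homotopy operator, for any bilinear
operation in the place of the contraction. -/
theorem contDiff_homotopy {A F : Type*} [NormedAddCommGroup A] [NormedSpace ℝ A]
    [NormedAddCommGroup F] [NormedSpace ℝ F] {Φ : A × E → F} (hΦ : IsBoundedBilinearMap ℝ Φ)
    {B : E → A} (hB : ContDiff ℝ ∞ B) (y₀ : E) :
    ContDiff ℝ ∞ (Function.uncurry fun (y : E) (s : ℝ) =>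
      s • Φ (B (y₀ + s • (y - y₀)), y - y₀)) := by
  have h₁ : ContDiff ℝ ∞ fun q : E × ℝ => q.1 - y₀ := contDiff_fst.sub contDiff_const
  have h₂ : ContDiff ℝ ∞ fun q : E × ℝ => B (y₀ + q.2 • (q.1 - y₀)) :=
    hB.comp (contDiff_const.add (contDiff_snd.smul h₁))
  exact contDiff_snd.smul (hΦ.contDiff.comp (h₂.prodMk h₁))

theorem contDiff_bump_smul {F : Type*} [NormedAddCommGroup F] [NormedSpace ℝ F]
    [HasContDiffBump E] [FiniteDimensional ℝ E] {y₀ : E} (χ : ContDiffBump y₀) {b : E → F}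
    (hb : ∀ y ∈ Metric.closedBall y₀ χ.rOut, ContDiffAt ℝ ∞ b y) :
    ContDiff ℝ ∞ fun y => χ y • b y := by
  refine contDiff_iff_contDiffAt.2 fun y => ?_
  by_cases hy : y ∈ Metric.closedBall y₀ χ.rOut
  · exact χ.contDiffAt.smul (hb y hy)
  · have h : (fun y => χ y • b y) =ᶠ[𝓝 y] fun _ => 0 := by
      have h' := Metric.isClosed_closedBall.isOpen_compl.mem_nhds hy
      filter_upwards [h'] with y' hy'
      rw [χ.zero_of_le_dist (by simpa using (not_le.1 (Metric.mem_closedBall.not.1 hy')).le),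
        zero_smul]
    exact contDiffAt_const.congr_of_eventuallyEq h

/-- The Poincaré lemma: a closed 2-form near `y₀` is exact near `y₀`. -/
theorem exists_extDeriv_eq [FiniteDimensional ℝ E] {b : E → E [⋀^Fin 2]→L[ℝ] ℝ} {y₀ : E}
    (hb : ∀ᶠ y in 𝓝 y₀, ContDiffAt ℝ ∞ b y) (hcl : ∀ᶠ y in 𝓝 y₀, extDeriv b y = 0) :
    ∃ ζ : E → E [⋀^Fin 1]→L[ℝ] ℝ, ContDiff ℝ ∞ ζ ∧ ∀ᶠ y in 𝓝 y₀, extDeriv ζ y = b y := by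
  obtain ⟨r, hr, hU⟩ := Metric.nhds_basis_closedBall.mem_iff.1 (hb.and hcl)
  -- cutting off makes the form smooth everywhere and does not change it on the ball of radius
  -- `r / 2`, which is star-shaped about `y₀`
  let χ : ContDiffBump y₀ := ⟨r / 2, r, by linarith, by linarith⟩
  have hB : ContDiff ℝ ∞ fun y => χ y • b y := contDiff_bump_smul χ fun y hy => (hU hy).1
  set B : E → E [⋀^Fin 2]→L[ℝ] ℝ := fun y => χ y • b y with hBdef
  have hBb {y : E} (hy : y ∈ Metric.ball y₀ (r / 2)) : B =ᶠ[𝓝 y] b := by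
    filter_upwards [χ.eventuallyEq_one_of_mem_ball hy] with y' hy'
    rw [hBdef]
    simp only [hy', Pi.one_apply, one_smul]
  let g : E → ℝ → E [⋀^Fin 1]→L[ℝ] ℝ := fun y s => s • (B (y₀ + s • (y - y₀))).curryLeft (y - y₀)
  have hg : ContDiff ℝ ∞ (Function.uncurry g) :=
    contDiff_homotopy isBoundedBilinearMap_curryLeft hB y₀
  refine ⟨fun y => ∫ s in (0 : ℝ)..1, g y s, contDiff_integral_of_contDiff hg, ?_⟩
  filter_upwards [Metric.ball_mem_nhds y₀ (half_pos hr)] with y hy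
  have hz {s : ℝ} (hs : s ∈ uIcc (0 : ℝ) 1) : y₀ + s • (y - y₀) ∈ Metric.ball y₀ (r / 2) := by
    rw [uIcc_of_le zero_le_one] at hs
    rw [mem_ball_iff_norm, add_sub_cancel_left, norm_smul, Real.norm_of_nonneg hs.1]
    rw [mem_ball_iff_norm] at hy
    nlinarith [norm_nonneg (y - y₀), hs.2]
  have hext {s : ℝ} (hs : s ∈ uIcc (0 : ℝ) 1) : extDeriv (fun y => g y s) y =
      (2 * s) • B (y₀ + s • (y - y₀)) + s ^ 2 • fderiv ℝ B (y₀ + s • (y - y₀)) (y - y₀) := by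
    refine (hasExtDerivAt_homotopy (hB.differentiable (by simp) _) ?_).extDeriv_eq
    rw [(hBb (hz hs)).extDeriv_eq]
    exact (hU (Metric.ball_subset_closedBall (Metric.ball_subset_ball (by linarith) (hz hs)))).2
  have hderiv (s : ℝ) : HasDerivAt (fun s => s ^ 2 • B (y₀ + s • (y - y₀)))
      (s ^ 2 • fderiv ℝ B (y₀ + s • (y - y₀)) (y - y₀) + (2 * s) • B (y₀ + s • (y - y₀))) s := by
    have h₁ : HasDerivAt (fun s : ℝ => y₀ + s • (y - y₀)) (y - y₀) s := by
      simpa using ((hasDerivAt_id s).smul_const (y - y₀)).const_add y₀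
    have h₂ := (hB.differentiable (by simp) (y₀ + s • (y - y₀))).hasFDerivAt.comp_hasDerivAt s h₁
    have h₃ : HasDerivAt (fun s : ℝ => s ^ 2) (2 * s) s := by simpa using hasDerivAt_pow 2 s
    exact h₃.smul h₂
  have hext' : extDeriv (fun y => ∫ s in (0 : ℝ)..1, g y s) y =
      ∫ s in (0 : ℝ)..1, extDeriv (fun y => g y s) y :=
    map_fderiv_integral_of_contDiff (ContinuousAlternatingMap.alternatizeUncurryFinCLM ℝ E ℝ) hg y
  have hcont : Continuous fun s : ℝ => (s ^ 2 • fderiv ℝ B (y₀ + s • (y - y₀)) (y - y₀) +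
      (2 * s) • B (y₀ + s • (y - y₀)) : E [⋀^Fin 2]→L[ℝ] ℝ) := by
    have h₁ : Continuous fun s : ℝ => y₀ + s • (y - y₀) := by fun_prop
    have h₂ : Continuous fun z => fderiv ℝ B z (y - y₀) :=
      (hB.continuous_fderiv (by simp)).clm_apply continuous_const
    exact ((continuous_pow 2).smul (h₂.comp h₁)).add
      ((continuous_const.mul continuous_id).smul (hB.continuous.comp h₁))
  rw [hext', intervalIntegral.integral_congr fun s hs => (hext hs).trans (add_comm _ _),
    intervalIntegral.integral_eq_sub_of_hasDerivAt (fun s _ => hderiv s)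
      (hcont.intervalIntegrable _ _)]
  simp [(hBb hy).self_of_nhds]

end Poincare

/-! ### Local primitives of closed 2-forms on a manifold -/

section LocalPrimitive

open Topology Filter

namespace DiffForm

variable {E : Type*} [NormedAddCommGroup E] [NormedSpace ℝ E]

/-- The preferred charts of a vector space are the identity. -/
theorem inChart_eq_self {k : ℕ} (α : E → E [⋀^Fin k]→L[ℝ] ℝ) (y : E) :
    inChart (I := 𝓘(ℝ, E)) (X := E) α y = α := by
  funext z
  have h : mfderiv 𝓘(ℝ, E) 𝓘(ℝ, E) (extChartAt 𝓘(ℝ, E) y).symm z = ContinuousLinearMap.id ℝ E := by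
    rw [mfderiv_eq_fderiv]
    exact fderiv_id
  change (α z).compContinuousLinearMap
    (mfderiv 𝓘(ℝ, E) 𝓘(ℝ, E) (extChartAt 𝓘(ℝ, E) y).symm z : E →L[ℝ] E) = α z
  rw [h]
  rfl

variable [FiniteDimensional ℝ E]
  {H : Type*} [TopologicalSpace H] {I : ModelWithCorners ℝ E H} [I.Boundaryless]
  {X : Type*} [TopologicalSpace X] [ChartedSpace H X] [IsManifold I ∞ X]

/-- The Poincaré lemma on a manifold: transport the form to a chart, take a primitive there, and
pull it back. -/
theorem exists_d_eq {β : DiffForm I X 2} (hβ : β.SmoothOn Set.univ) (hcl : ∀ x, β.d x = 0)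
    (m : X) : ∃ M' : Set X, IsOpen M' ∧ m ∈ M' ∧ ∃ ζ : DiffForm I X 1, ζ.SmoothOn M' ∧
      ∀ x ∈ M', ζ.d x = β x := by
  set φ := extChartAt I m with hφ
  have hsymm {y : E} (hy : y ∈ φ.target) : ContMDiffAt 𝓘(ℝ, E) I ∞ φ.symm y :=
    (contMDiffOn_extChartAt_symm m).contMDiffAt ((isOpen_extChartAt_target m).mem_nhds hy)
  have hchart {x : X} (hx : x ∈ φ.source) : ContMDiffAt I 𝓘(ℝ, E) ∞ φ x :=
    (contMDiffOn_extChartAt (n := ∞)).contMDiffAt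
      ((chartAt H m).open_source.mem_nhds (by rwa [hφ, extChartAt_source] at hx))
  let b : E → E [⋀^Fin 2]→L[ℝ] ℝ := pullback (I := 𝓘(ℝ, E)) φ.symm β
  have hb₁ {y : E} (hy : y ∈ φ.target) : ContDiffAt ℝ ∞ b y := by
    have h := contDiffAt_inChart_pullback (hsymm hy) (hβ (φ.symm y) trivial)
    exact (inChart_eq_self b y) ▸ h
  have hb₂ {y : E} (hy : y ∈ φ.target) : extDeriv b y = 0 := by
    have h := hasExtDerivAt_inChart_pullback (hsymm hy) (hβ (φ.symm y) trivial)
    rw [hcl] at h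
    exact (congrArg (extDeriv · y) (inChart_eq_self b y)).symm.trans h.extDeriv_eq
  have htarget : ∀ᶠ y in 𝓝 (φ m), y ∈ φ.target := extChartAt_target_mem_nhds m
  obtain ⟨ζ, hζ, hζb⟩ := exists_extDeriv_eq (htarget.mono fun y hy => hb₁ hy)
    (htarget.mono fun y hy => hb₂ hy)
  obtain ⟨V, hV, hVo, hmV⟩ := eventually_nhds_iff.1 hζb
  let ζ' : DiffForm 𝓘(ℝ, E) E 1 := ζ
  have hζ' (y : E) : ContDiffAt ℝ ∞ (ζ'.inChart y) (extChartAt 𝓘(ℝ, E) y y) := by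
    rw [inChart_eq_self ζ y]
    exact hζ.contDiffAt
  refine ⟨φ.source ∩ φ ⁻¹' V, (continuousOn_extChartAt m).isOpen_inter_preimage
    (isOpen_extChartAt_source m) hVo, ⟨mem_extChartAt_source m, hmV⟩, pullback φ ζ',
    fun x hx => contDiffAt_inChart_pullback (hchart hx.1) (hζ' _), fun x hx => ?_⟩
  have h₁ : ζ'.d (φ x) = b (φ x) := by
    rw [d_eq, inChart_eq_self ζ]
    exact hV _ hx.2
  rw [d_pullback (hchart hx.1) (hζ' _), h₁]
  have h₂ : (mfderiv I I (fun x => φ.symm (φ x)) x : E →L[ℝ] E) =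
      (mfderiv 𝓘(ℝ, E) I φ.symm (φ x)).comp (mfderiv I 𝓘(ℝ, E) φ x) :=
    mfderiv_comp x ((hsymm (φ.map_source hx.1)).mdifferentiableAt (by simp))
      ((hchart hx.1).mdifferentiableAt (by simp))
  have h₃ : (fun x => φ.symm (φ x)) =ᶠ[𝓝 x] id := by
    filter_upwards [(isOpen_extChartAt_source m).mem_nhds hx.1] with x' hx'
      using φ.left_inv hx'
  have h₄ : (mfderiv I I (fun x => φ.symm (φ x)) x : E →L[ℝ] E) = ContinuousLinearMap.id ℝ E :=
    h₃.mfderiv_eq.trans mfderiv_id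
  ext v
  have h₅ (w : E) : (mfderiv 𝓘(ℝ, E) I φ.symm (φ x) (mfderiv I 𝓘(ℝ, E) φ x w) : E) = w :=
    (DFunLike.congr_fun h₂ w).symm.trans (DFunLike.congr_fun h₄ w)
  change (β (φ.symm (φ x)) : E [⋀^Fin 2]→L[ℝ] ℝ) (fun i =>
    (mfderiv 𝓘(ℝ, E) I φ.symm (φ x) (mfderiv I 𝓘(ℝ, E) φ x (v i)) : E)) = _
  rw [congr_point β (φ.left_inv hx.1)]
  exact congrArg _ (funext fun i => h₅ (v i))

end DiffForm

end LocalPrimitive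

/-! ### The forms `φ` and `*φ` at a point -/

section Expressions

variable {V V' : Type*} [AddCommGroup V] [Module ℝ V] [TopologicalSpace V]
  [AddCommGroup V'] [Module ℝ V'] [TopologicalSpace V']

/-- The 3-form `φ` at a point, as an expression in `ω̃`, `ω₂`, `ω₃`, `dt`, `ξ = dx + ξ_P` and
`η = dy + η_N`. -/
def phiExpr (t u : ℝ) (W ω₂ ω₃ : V [⋀^Fin 2]→L[ℝ] ℝ) (τ ξ η : V [⋀^Fin 1]→L[ℝ] ℝ) :
    V [⋀^Fin 3]→L[ℝ] ℝ :=
  W ⋏ η + τ ⋏ ξ ⋏ η + t • (ω₂ ⋏ ξ + u • (ω₃ ⋏ τ))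

/-- The 4-form `*φ` at a point for `u = t f`, in the notation of `phiExpr`. -/
def psiExpr (t f : ℝ) (W ω₂ ω₃ : V [⋀^Fin 2]→L[ℝ] ℝ) (τ ξ η : V [⋀^Fin 1]→L[ℝ] ℝ) :
    V [⋀^Fin 4]→L[ℝ] ℝ :=
  (t ^ 2 * f / 2) • (ω₂ ⋏ ω₂) - t ^ 2 • (W ⋏ (ξ ⋏ τ)) + (t * f) • (ω₂ ⋏ (η ⋏ τ)) - ω₃ ⋏ (η ⋏ ξ)

theorem phiExpr_compContinuousLinearMap (t u : ℝ) (W ω₂ ω₃ : V [⋀^Fin 2]→L[ℝ] ℝ)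
    (τ ξ η : V [⋀^Fin 1]→L[ℝ] ℝ) (L : V' →L[ℝ] V) :
    (phiExpr t u W ω₂ ω₃ τ ξ η).compContinuousLinearMap L =
      phiExpr t u (W.compContinuousLinearMap L) (ω₂.compContinuousLinearMap L)
        (ω₃.compContinuousLinearMap L) (τ.compContinuousLinearMap L)
        (ξ.compContinuousLinearMap L) (η.compContinuousLinearMap L) := by
  simp only [phiExpr, ← Ext.wedge_compContinuousLinearMap]
  rfl

theorem psiExpr_compContinuousLinearMap (t f : ℝ) (W ω₂ ω₃ : V [⋀^Fin 2]→L[ℝ] ℝ)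
    (τ ξ η : V [⋀^Fin 1]→L[ℝ] ℝ) (L : V' →L[ℝ] V) :
    (psiExpr t f W ω₂ ω₃ τ ξ η).compContinuousLinearMap L =
      psiExpr t f (W.compContinuousLinearMap L) (ω₂.compContinuousLinearMap L)
        (ω₃.compContinuousLinearMap L) (τ.compContinuousLinearMap L)
        (ξ.compContinuousLinearMap L) (η.compContinuousLinearMap L) := by
  simp only [psiExpr, ← Ext.wedge_compContinuousLinearMap]
  rfl

theorem ContDiffAt.phiExpr {E : Type*} [NormedAddCommGroup E] [NormedSpace ℝ E]
    {W ω₂ ω₃ : E → E [⋀^Fin 2]→L[ℝ] ℝ} {τ ξ η : E → E [⋀^Fin 1]→L[ℝ] ℝ} {t u : E → ℝ} {x : E}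
    (ht : ContDiffAt ℝ ∞ t x) (hu : ContDiffAt ℝ ∞ u x) (hW : ContDiffAt ℝ ∞ W x)
    (h₂ : ContDiffAt ℝ ∞ ω₂ x) (h₃ : ContDiffAt ℝ ∞ ω₃ x) (hτ : ContDiffAt ℝ ∞ τ x)
    (hξ : ContDiffAt ℝ ∞ ξ x) (hη : ContDiffAt ℝ ∞ η x) :
    ContDiffAt ℝ ∞ (fun y => phiExpr (t y) (u y) (W y) (ω₂ y) (ω₃ y) (τ y) (ξ y) (η y)) x :=
  ((hW.wedge hη).add ((hτ.wedge hξ).wedge hη)).add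
    (ht.smul ((h₂.wedge hξ).add (hu.smul (h₃.wedge hτ))))

theorem ContDiffAt.psiExpr {E : Type*} [NormedAddCommGroup E] [NormedSpace ℝ E]
    {W ω₂ ω₃ : E → E [⋀^Fin 2]→L[ℝ] ℝ} {τ ξ η : E → E [⋀^Fin 1]→L[ℝ] ℝ} {t f : E → ℝ} {x : E}
    (ht : ContDiffAt ℝ ∞ t x) (hf : ContDiffAt ℝ ∞ f x) (hW : ContDiffAt ℝ ∞ W x)
    (h₂ : ContDiffAt ℝ ∞ ω₂ x) (h₃ : ContDiffAt ℝ ∞ ω₃ x) (hτ : ContDiffAt ℝ ∞ τ x)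
    (hξ : ContDiffAt ℝ ∞ ξ x) (hη : ContDiffAt ℝ ∞ η x) :
    ContDiffAt ℝ ∞ (fun y => psiExpr (t y) (f y) (W y) (ω₂ y) (ω₃ y) (τ y) (ξ y) (η y)) x :=
  (((((ht.pow 2).mul hf).div_const 2).smul (h₂.wedge h₂)).sub
    ((ht.pow 2).smul (hW.wedge (hξ.wedge hτ)))).add
      ((ht.mul hf).smul (h₂.wedge (hη.wedge hτ))) |>.sub (h₃.wedge (hη.wedge hξ))

end Expressions

/-! ### Wedge products of the model 2-forms -/

namespace G2Model

theorem smul_σ₀_add_smul_σ₁ (a b : ℝ) :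
    a • σ₀ + b • σ₁ = skewForm (a + b) 0 0 0 0 (b - a) := by
  ext v
  simp only [σ₀, σ₁, skewForm, ContinuousAlternatingMap.add_apply,
    ContinuousAlternatingMap.sub_apply, ContinuousAlternatingMap.smul_apply, smul_eq_mul]
  ring

theorem combination_wedge_σ₂ (a b : ℝ) : (a • σ₀ + b • σ₁) ⋏ σ₂ = 0 := by
  rw [smul_σ₀_add_smul_σ₁, σ₂_eq, skewForm_wedge]
  simp

theorem σ₂_wedge_combination (a b : ℝ) : σ₂ ⋏ (a • σ₀ + b • σ₁) = 0 := by
  rw [smul_σ₀_add_smul_σ₁, σ₂_eq, skewForm_wedge]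
  simp

theorem σ₃_wedge_combination (a b : ℝ) : σ₃ ⋏ (a • σ₀ + b • σ₁) = 0 := by
  rw [smul_σ₀_add_smul_σ₁, σ₃_eq, skewForm_wedge]
  simp

theorem σ₃_wedge_σ₂ : σ₃ ⋏ σ₂ = 0 := by
  rw [σ₂_eq, σ₃_eq, skewForm_wedge]
  simp

theorem combination_wedge_combination (a b a' b' : ℝ) :
    (a • σ₀ + b • σ₁) ⋏ (a' • σ₀ + b' • σ₁) = (b' * b - a' * a) • (σ₂ ⋏ σ₂) := by
  rw [smul_σ₀_add_smul_σ₁, smul_σ₀_add_smul_σ₁, σ₂_eq, skewForm_wedge, skewForm_wedge, smul_smul]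
  congr 1
  ring

end G2Model

/-! ### Sums of forms and differentials of coordinate functions -/

section CoordinateForms

open Topology Filter

variable {E : Type*} [NormedAddCommGroup E] [NormedSpace ℝ E]
  {H : Type*} [TopologicalSpace H] {I : ModelWithCorners ℝ E H}
  {X : Type*} [TopologicalSpace X] [ChartedSpace H X]

namespace DiffForm

theorem SmoothOn.add {k : ℕ} {α β : DiffForm I X k} {U : Set X} (hα : α.SmoothOn U)
    (hβ : β.SmoothOn U) : (α + β).SmoothOn U :=
  fun x hx => (hα x hx).add (hβ x hx)

theorem SmoothOn.const_smul {k : ℕ} {α : DiffForm I X k} {U : Set X} (c : ℝ)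
    (hα : α.SmoothOn U) : (c • α).SmoothOn U :=
  fun x hx => (hα x hx).const_smul c

variable [IsManifold I ∞ X]

theorem SmoothOn.hasExtDerivAt {k : ℕ} {α : DiffForm I X k} {U : Set X} (hα : α.SmoothOn U)
    {x : X} (hx : x ∈ U) : HasExtDerivAt (α.inChart x) (α.d x) (extChartAt I x x) :=
  ⟨(hα x hx).differentiableAt (by simp), (d_eq α x).symm⟩

theorem d_add {k : ℕ} {α β : DiffForm I X k} {U : Set X} (hα : α.SmoothOn U)
    (hβ : β.SmoothOn U) {x : X} (hx : x ∈ U) : (α + β).d x = α.d x + β.d x := by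
  rw [d_eq]
  exact ((hα.hasExtDerivAt hx).add (hβ.hasExtDerivAt hx)).extDeriv_eq

theorem d_const_smul {k : ℕ} {α : DiffForm I X k} {U : Set X} (c : ℝ) (hα : α.SmoothOn U)
    {x : X} (hx : x ∈ U) : (c • α).d x = c • α.d x := by
  rw [d_eq]
  exact ((hα.hasExtDerivAt hx).const_smul c).extDeriv_eq

/-- The chart expression of the differential of a function which is linear in the chart. -/
theorem inChart_ofFun [I.Boundaryless] {f : X → ℝ} {z : X} (hf : ContMDiffAt I 𝓘(ℝ, ℝ) ∞ f z)
    (ℓ : E →L[ℝ] ℝ) (hℓ : ∀ y, f ((extChartAt I z).symm y) = ℓ y) :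
    (ofFun I f).inChart z =ᶠ[𝓝 (extChartAt I z z)] fun _ =>
      ContinuousAlternatingMap.ofSubsingleton ℝ E ℝ (0 : Fin 1) ℓ := by
  let κ : ℝ → ℝ [⋀^Fin 1]→L[ℝ] ℝ := fun _ =>
    ContinuousAlternatingMap.ofSubsingleton ℝ ℝ ℝ (0 : Fin 1) (ContinuousLinearMap.id ℝ ℝ)
  have h := inChart_pullback hf (k := 1) κ
  have hκ := inChart_eq_self κ (f z)
  filter_upwards [h] with y hy
  refine Eq.trans ?_ (hy.trans ?_)
  · rfl
  · rw [hκ]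
    have e : (fun y => extChartAt 𝓘(ℝ, ℝ) (f z) (f ((extChartAt I z).symm y))) = ℓ := funext hℓ
    rw [e, ℓ.fderiv]
    rfl

end DiffForm

end CoordinateForms

/-! ### The forms `φ` and `*φ` on `ℝ³ × M` -/

section Total

open Topology Filter

variable {M : Type*} [TopologicalSpace M] [ChartedSpace (EuclideanSpace ℝ (Fin 4)) M]

/-- The model space of `ℝ_t × ℝ_x × ℝ_y × M`. -/
abbrev EY := ℝ × ℝ × ℝ × EuclideanSpace ℝ (Fin 4)

/-- The projection of the model space to that of `M`. -/
def projE : EY →L[ℝ] EuclideanSpace ℝ (Fin 4) :=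
  (ContinuousLinearMap.snd ℝ ℝ (EuclideanSpace ℝ (Fin 4))).comp
    ((ContinuousLinearMap.snd ℝ ℝ (ℝ × EuclideanSpace ℝ (Fin 4))).comp
      (ContinuousLinearMap.snd ℝ ℝ (ℝ × ℝ × EuclideanSpace ℝ (Fin 4))))

theorem contMDiff_projM : ContMDiff IY (𝓡 4) ∞ (projM (M := M)) :=
  contMDiff_snd.comp (contMDiff_snd.comp contMDiff_snd)

theorem contMDiff_projP : ContMDiff IY IP ∞ (projP (M := M)) :=
  contMDiff_fst.prodMk contMDiff_projM

theorem contMDiff_projN : ContMDiff IY IN ∞ (projN (M := M)) :=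
  contMDiff_fst.prodMk ((contMDiff_fst.comp contMDiff_snd).prodMk contMDiff_projM)

theorem contMDiff_coord_t : ContMDiff IY 𝓘(ℝ, ℝ) ∞ fun z : ℝ × ℝ × ℝ × M => z.1 :=
  contMDiff_fst

theorem contMDiff_coord_x : ContMDiff IY 𝓘(ℝ, ℝ) ∞ fun z : ℝ × ℝ × ℝ × M => z.2.1 :=
  contMDiff_fst.comp contMDiff_snd

theorem contMDiff_coord_y : ContMDiff IY 𝓘(ℝ, ℝ) ∞ fun z : ℝ × ℝ × ℝ × M => z.2.2.1 :=
  contMDiff_fst.comp (contMDiff_snd.comp contMDiff_snd)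

theorem hasMFDerivAt_projM (z : ℝ × ℝ × ℝ × M) :
    HasMFDerivAt IY (𝓡 4) projM z (projE : EY →L[ℝ] EuclideanSpace ℝ (Fin 4)) :=
  (hasMFDerivAt_snd z.2.2).comp z ((hasMFDerivAt_snd z.2).comp z (hasMFDerivAt_snd z))

theorem mfderiv_projM (z : ℝ × ℝ × ℝ × M) :
    (mfderiv IY (𝓡 4) projM z : EY →L[ℝ] EuclideanSpace ℝ (Fin 4)) = projE :=
  (hasMFDerivAt_projM z).mfderiv

theorem mfderiv_projP_apply (z : ℝ × ℝ × ℝ × M) (v : EY) :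
    (mfderiv IY IP projP z v : ℝ × EuclideanSpace ℝ (Fin 4)) = (v.1, v.2.2.2) :=
  DFunLike.congr_fun ((hasMFDerivAt_fst z).prodMk (hasMFDerivAt_projM z)).mfderiv v

theorem mfderiv_projN_apply (z : ℝ × ℝ × ℝ × M) (v : EY) :
    (mfderiv IY IN projN z v : ℝ × ℝ × EuclideanSpace ℝ (Fin 4)) = (v.1, v.2.1, v.2.2.2) :=
  DFunLike.congr_fun ((hasMFDerivAt_fst z).prodMk
    (((hasMFDerivAt_fst z.2).comp z (hasMFDerivAt_snd z)).prodMk (hasMFDerivAt_projM z))).mfderiv v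

theorem mfderiv_coord_t_apply (z : ℝ × ℝ × ℝ × M) (v : EY) :
    (mfderiv IY 𝓘(ℝ, ℝ) (fun z : ℝ × ℝ × ℝ × M => z.1) z v : ℝ) = v.1 :=
  DFunLike.congr_fun (hasMFDerivAt_fst z).mfderiv v

theorem mfderiv_coord_x_apply (z : ℝ × ℝ × ℝ × M) (v : EY) :
    (mfderiv IY 𝓘(ℝ, ℝ) (fun z : ℝ × ℝ × ℝ × M => z.2.1) z v : ℝ) = v.2.1 :=
  DFunLike.congr_fun ((hasMFDerivAt_fst z.2).comp z (hasMFDerivAt_snd z)).mfderiv v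

theorem mfderiv_coord_y_apply (z : ℝ × ℝ × ℝ × M) (v : EY) :
    (mfderiv IY 𝓘(ℝ, ℝ) (fun z : ℝ × ℝ × ℝ × M => z.2.2.1) z v : ℝ) = v.2.2.1 :=
  DFunLike.congr_fun ((hasMFDerivAt_fst z.2.2).comp z
    ((hasMFDerivAt_snd z.2).comp z (hasMFDerivAt_snd z))).mfderiv v

theorem mfderiv_snd_comp_projP (z : ℝ × ℝ × ℝ × M) (v : EY) :
    (mfderiv IP (𝓡 4) (fun z' : ℝ × M => z'.2) (projP z) (mfderiv IY IP projP z v) :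
      EuclideanSpace ℝ (Fin 4)) = projE v := by
  have h := DFunLike.congr_fun (hasMFDerivAt_snd (I := 𝓘(ℝ, ℝ)) (I' := 𝓡 4) (projP z)).mfderiv
    (mfderiv IY IP projP z v)
  refine h.trans ?_
  rw [mfderiv_projP_apply]
  rfl

theorem mfderiv_snd_comp_projN (z : ℝ × ℝ × ℝ × M) (v : EY) :
    (mfderiv IN (𝓡 4) (fun z' : ℝ × ℝ × M => z'.2.2) (projN z) (mfderiv IY IN projN z v) :
      EuclideanSpace ℝ (Fin 4)) = projE v := by
  have h := DFunLike.congr_fun ((hasMFDerivAt_snd (I := 𝓘(ℝ, ℝ)) (I' := 𝓡 4) (projN z).2).comp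
    (projN z) (hasMFDerivAt_snd (I := 𝓘(ℝ, ℝ)) (projN z))).mfderiv (mfderiv IY IN projN z v)
  refine h.trans ?_
  rw [mfderiv_projN_apply]
  rfl

/-- The 4-form `*φ` on `ℝ_t × ℝ_x × ℝ_y × M`, for `u = t f`. -/
def psiForm (ωt : ℝ → DiffForm (𝓡 4) M 2) (f : ℝ → ℝ) (ω₂ ω₃ : DiffForm (𝓡 4) M 2)
    (ξ : DiffForm IP (ℝ × M) 1) (η : DiffForm IN (ℝ × ℝ × M) 1) :
    DiffForm IY (ℝ × ℝ × ℝ × M) 4 := fun z =>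
  psiExpr z.1 (f z.1) (DiffForm.pullback (I := IY) projM (ωt z.1) z)
    (DiffForm.pullback (I := IY) projM ω₂ z) (DiffForm.pullback (I := IY) projM ω₃ z)
    (DiffForm.ofFun IY (fun z' : ℝ × ℝ × ℝ × M => z'.1) z)
    (DiffForm.ofFun IY (fun z' : ℝ × ℝ × ℝ × M => z'.2.1) z +
      DiffForm.pullback (I := IY) projP ξ z)
    (DiffForm.ofFun IY (fun z' : ℝ × ℝ × ℝ × M => z'.2.2.1) z +
      DiffForm.pullback (I := IY) projN η z)

variable (p q k l : ℝ) (ω₀ ω₁ ω₂ ω₃ : DiffForm (𝓡 4) M 2) (ξ : DiffForm IP (ℝ × M) 1)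
  (η : DiffForm IN (ℝ × ℝ × M) 1) (z : ℝ × ℝ × ℝ × M) (y : EY)

/-- In the chart at any point, `φ` is the same expression in the chart expressions of its
constituents; the charts of `ℝ³ × M` do not change the coordinate `t`. -/
theorem inChart_phiForm :
    (phiForm (fun t => (p + q * t) • ω₀ + (k + l * t) • ω₁)
      (fun t => t * ((k + l * t) ^ 2 - (p + q * t) ^ 2)) ω₂ ω₃ ξ η).inChart z y =
    phiExpr y.1 (y.1 * ((k + l * y.1) ^ 2 - (p + q * y.1) ^ 2))
      ((p + q * y.1) • (DiffForm.pullback (I := IY) projM ω₀).inChart z y +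
        (k + l * y.1) • (DiffForm.pullback (I := IY) projM ω₁).inChart z y)
      ((DiffForm.pullback (I := IY) projM ω₂).inChart z y)
      ((DiffForm.pullback (I := IY) projM ω₃).inChart z y)
      ((DiffForm.ofFun IY (fun z' : ℝ × ℝ × ℝ × M => z'.1)).inChart z y)
      ((DiffForm.ofFun IY (fun z' : ℝ × ℝ × ℝ × M => z'.2.1)).inChart z y +
        (DiffForm.pullback (I := IY) projP ξ).inChart z y)
      ((DiffForm.ofFun IY (fun z' : ℝ × ℝ × ℝ × M => z'.2.2.1)).inChart z y +
        (DiffForm.pullback (I := IY) projN η).inChart z y) :=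
  phiExpr_compContinuousLinearMap _ _ _ _ _ _ _ _ _

theorem inChart_psiForm :
    (psiForm (fun t => (p + q * t) • ω₀ + (k + l * t) • ω₁)
      (fun t => (k + l * t) ^ 2 - (p + q * t) ^ 2) ω₂ ω₃ ξ η).inChart z y =
    psiExpr y.1 ((k + l * y.1) ^ 2 - (p + q * y.1) ^ 2)
      ((p + q * y.1) • (DiffForm.pullback (I := IY) projM ω₀).inChart z y +
        (k + l * y.1) • (DiffForm.pullback (I := IY) projM ω₁).inChart z y)
      ((DiffForm.pullback (I := IY) projM ω₂).inChart z y)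
      ((DiffForm.pullback (I := IY) projM ω₃).inChart z y)
      ((DiffForm.ofFun IY (fun z' : ℝ × ℝ × ℝ × M => z'.1)).inChart z y)
      ((DiffForm.ofFun IY (fun z' : ℝ × ℝ × ℝ × M => z'.2.1)).inChart z y +
        (DiffForm.pullback (I := IY) projP ξ).inChart z y)
      ((DiffForm.ofFun IY (fun z' : ℝ × ℝ × ℝ × M => z'.2.2.1)).inChart z y +
        (DiffForm.pullback (I := IY) projN η).inChart z y) :=
  psiExpr_compContinuousLinearMap _ _ _ _ _ _ _ _ _

/-- The family `ω̃` in an adapted coframe. The normal form of `w₀` is required only after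
multiplication by `p` and by `q`, so that nothing is required if both vanish. -/
theorem combination_eq {V : Type*} [AddCommGroup V] [Module ℝ V] [TopologicalSpace V]
    {p q : ℝ} {w₀ w₁ : V [⋀^Fin 2]→L[ℝ] ℝ} {K : V →L[ℝ] (Fin 7 → ℝ)}
    (hp : p • w₀ = p • σ₀.compContinuousLinearMap K)
    (hq : q • w₀ = q • σ₀.compContinuousLinearMap K)
    (h₁ : w₁ = σ₁.compContinuousLinearMap K) (t b : ℝ) :
    (p + q * t) • w₀ + b • w₁ = ((p + q * t) • σ₀ + b • σ₁).compContinuousLinearMap K := by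
  have h : (p + q * t) • w₀ = (p + q * t) • σ₀.compContinuousLinearMap K := by
    rw [add_smul, add_smul, hp, mul_comm q t, mul_smul, mul_smul, hq]
  rw [h, h₁]
  rfl

/-- Admissibility of `φ` at a point of `ℝ³ × M`. The forms `dt`, `dx + ξ`, `dy + η` complete a
coframe of `M` to one of the product, since `ξ` does not involve `dx`, `dy`, nor `η` involve
`dy`. -/
theorem isG2Pair_phiForm_psiForm (F : EuclideanSpace ℝ (Fin 4) ≃L[ℝ] (Fin 4 → ℝ))
    (ht : 0 < z.1) (hpk : |p + q * z.1| < k + l * z.1)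
    (hp : p • ω₀ (projM z) = p • σ₀.compContinuousLinearMap (coframeMap F.toContinuousLinearMap))
    (hq : q • ω₀ (projM z) = q • σ₀.compContinuousLinearMap (coframeMap F.toContinuousLinearMap))
    (h₁ : ω₁ (projM z) = σ₁.compContinuousLinearMap (coframeMap F.toContinuousLinearMap))
    (h₂ : ω₂ (projM z) = σ₂.compContinuousLinearMap (coframeMap F.toContinuousLinearMap))
    (h₃ : ω₃ (projM z) = σ₃.compContinuousLinearMap (coframeMap F.toContinuousLinearMap)) :
    IsG2Pair (phiForm (fun t => (p + q * t) • ω₀ + (k + l * t) • ω₁)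
      (fun t => t * ((k + l * t) ^ 2 - (p + q * t) ^ 2)) ω₂ ω₃ ξ η z)
      (psiForm (fun t => (p + q * t) • ω₀ + (k + l * t) • ω₁)
      (fun t => (k + l * t) ^ 2 - (p + q * t) ^ 2) ω₂ ω₃ ξ η z) := by
  have hfin : Module.finrank ℝ EY = 7 := by simp [EY]
  have hcomp : coframeMap (F.toContinuousLinearMap.comp projE) =
      (coframeMap F.toContinuousLinearMap).comp projE := by
    refine ContinuousLinearMap.ext fun v => funext fun j => ?_
    fin_cases j <;> rfl
  refine isG2Pair_of_coframe (V := EY) hfin _ _ _ (F.toContinuousLinearMap.comp projE) ?_ ht hpk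
    ?_ ?_ ?_
  · intro v h0 h1 h2 h3
    have e₄ : v.2.2.2 = 0 := by
      have h : F (v.2.2.2) = 0 := h3
      simpa using h
    have e₁ : v.1 = 0 := (mfderiv_coord_t_apply z v).symm.trans h0
    have e₂ : v.2.1 = 0 := by
      have hP : (mfderiv IY IP projP z v : ℝ × EuclideanSpace ℝ (Fin 4)) = 0 := by
        rw [mfderiv_projP_apply, e₁, e₄]
        rfl
      have h := (congrArg (· + toFunctional (ξ (projP z)) (mfderiv IY IP projP z v))
        (mfderiv_coord_x_apply z v)).symm.trans h1
      refine (add_zero _).symm.trans (Eq.trans ?_ h)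
      exact congrArg (v.2.1 + ·)
        ((congrArg (toFunctional (ξ (projP z))) hP).trans (map_zero _)).symm
    have e₃ : v.2.2.1 = 0 := by
      have hN : (mfderiv IY IN projN z v : ℝ × ℝ × EuclideanSpace ℝ (Fin 4)) = 0 := by
        rw [mfderiv_projN_apply, e₁, e₂, e₄]
        rfl
      have h := (congrArg (· + toFunctional (η (projN z)) (mfderiv IY IN projN z v))
        (mfderiv_coord_y_apply z v)).symm.trans h2
      refine (add_zero _).symm.trans (Eq.trans ?_ h)
      exact congrArg (v.2.2.1 + ·)
        ((congrArg (toFunctional (η (projN z))) hN).trans (map_zero _)).symm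
    exact Prod.ext e₁ (Prod.ext e₂ (Prod.ext e₃ e₄))
  · have h := combination_eq (w₀ := (ω₀ (projM z) : EuclideanSpace ℝ (Fin 4) [⋀^Fin 2]→L[ℝ] ℝ))
      hp hq h₁ z.1 (k + l * z.1)
    refine (congrArg (fun θ : EuclideanSpace ℝ (Fin 4) [⋀^Fin 2]→L[ℝ] ℝ =>
      θ.compContinuousLinearMap (mfderiv IY (𝓡 4) projM z : EY →L[ℝ] EuclideanSpace ℝ (Fin 4))) h
      ).trans ?_
    rw [mfderiv_projM, hcomp]
    rfl
  · refine (congrArg (fun θ : EuclideanSpace ℝ (Fin 4) [⋀^Fin 2]→L[ℝ] ℝ =>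
      θ.compContinuousLinearMap (mfderiv IY (𝓡 4) projM z : EY →L[ℝ] EuclideanSpace ℝ (Fin 4))) h₂
      ).trans ?_
    rw [mfderiv_projM, hcomp]
    rfl
  · refine (congrArg (fun θ : EuclideanSpace ℝ (Fin 4) [⋀^Fin 2]→L[ℝ] ℝ =>
      θ.compContinuousLinearMap (mfderiv IY (𝓡 4) projM z : EY →L[ℝ] EuclideanSpace ℝ (Fin 4))) h₃
      ).trans ?_
    rw [mfderiv_projM, hcomp]
    rfl

end Total

/-! ### Wedge identities in an adapted coframe -/

section WedgeIdentities

variable {V : Type*} [AddCommGroup V] [Module ℝ V] [TopologicalSpace V] {p q k l : ℝ}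
  {w₀ w₁ w₂ w₃ : V [⋀^Fin 2]→L[ℝ] ℝ} {K : V →L[ℝ] (Fin 7 → ℝ)}

theorem derivative_eq (hq : q • w₀ = q • σ₀.compContinuousLinearMap K)
    (h₁ : w₁ = σ₁.compContinuousLinearMap K) :
    q • w₀ + l • w₁ = (q • σ₀ + l • σ₁).compContinuousLinearMap K := by
  rw [hq, h₁]
  rfl

theorem family_wedge_second (hp : p • w₀ = p • σ₀.compContinuousLinearMap K)
    (hq : q • w₀ = q • σ₀.compContinuousLinearMap K) (h₁ : w₁ = σ₁.compContinuousLinearMap K)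
    (h₂ : w₂ = σ₂.compContinuousLinearMap K) (t : ℝ) :
    ((p + q * t) • w₀ + (k + l * t) • w₁) ⋏ w₂ = 0 := by
  rw [combination_eq hp hq h₁, h₂, ← Ext.wedge_compContinuousLinearMap, combination_wedge_σ₂]
  rfl

theorem second_wedge_derivative (hq : q • w₀ = q • σ₀.compContinuousLinearMap K)
    (h₁ : w₁ = σ₁.compContinuousLinearMap K) (h₂ : w₂ = σ₂.compContinuousLinearMap K) :
    w₂ ⋏ (q • w₀ + l • w₁) = 0 := by
  rw [derivative_eq hq h₁, h₂, ← Ext.wedge_compContinuousLinearMap, σ₂_wedge_combination]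
  rfl

theorem third_wedge_derivative (hq : q • w₀ = q • σ₀.compContinuousLinearMap K)
    (h₁ : w₁ = σ₁.compContinuousLinearMap K) (h₃ : w₃ = σ₃.compContinuousLinearMap K) :
    w₃ ⋏ (q • w₀ + l • w₁) = 0 := by
  rw [derivative_eq hq h₁, h₃, ← Ext.wedge_compContinuousLinearMap, σ₃_wedge_combination]
  rfl

theorem third_wedge_second (h₂ : w₂ = σ₂.compContinuousLinearMap K)
    (h₃ : w₃ = σ₃.compContinuousLinearMap K) : w₃ ⋏ w₂ = 0 := by
  rw [h₂, h₃, ← Ext.wedge_compContinuousLinearMap, σ₃_wedge_σ₂]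
  rfl

theorem family_wedge_derivative (hp : p • w₀ = p • σ₀.compContinuousLinearMap K)
    (hq : q • w₀ = q • σ₀.compContinuousLinearMap K) (h₁ : w₁ = σ₁.compContinuousLinearMap K)
    (h₂ : w₂ = σ₂.compContinuousLinearMap K) (t : ℝ) :
    ((p + q * t) • w₀ + (k + l * t) • w₁) ⋏ (q • w₀ + l • w₁) =
      (l * (k + l * t) - q * (p + q * t)) • (w₂ ⋏ w₂) := by
  rw [combination_eq hp hq h₁, derivative_eq hq h₁, h₂, ← Ext.wedge_compContinuousLinearMap,
    ← Ext.wedge_compContinuousLinearMap, combination_wedge_combination]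
  rfl

end WedgeIdentities

/-! ### Torsion-freeness -/

section TorsionFree

open Topology Filter

variable {M : Type*} [TopologicalSpace M] [ChartedSpace (EuclideanSpace ℝ (Fin 4)) M]
  [IsManifold (𝓡 4) ∞ M]

theorem HasExtDerivAt.congr_of_eventuallyEq {E : Type*} [NormedAddCommGroup E] [NormedSpace ℝ E]
    {k : ℕ} {α β : E → E [⋀^Fin k]→L[ℝ] ℝ} {α' : E [⋀^Fin (k + 1)]→L[ℝ] ℝ} {x : E}
    (hα : HasExtDerivAt α α' x) (h : β =ᶠ[𝓝 x] α) : HasExtDerivAt β α' x :=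
  ⟨hα.1.congr_of_eventuallyEq h, h.extDeriv_eq.trans hα.2⟩

/-- The data at a point of `M` on which the construction depends: a coframe in which the four
2-forms are the model ones. The form `ω₀` matters only up to the factors `p` and `q`, which may
both vanish. -/
structure AdaptedCoframe (p q : ℝ) {V : Type*} [AddCommGroup V] [Module ℝ V] [TopologicalSpace V]
    (w₀ w₁ w₂ w₃ : V [⋀^Fin 2]→L[ℝ] ℝ) where
  /-- the coframe -/
  F : V ≃L[ℝ] (Fin 4 → ℝ)
  smul_p : p • w₀ = p • σ₀.compContinuousLinearMap (coframeMap F.toContinuousLinearMap)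
  smul_q : q • w₀ = q • σ₀.compContinuousLinearMap (coframeMap F.toContinuousLinearMap)
  first : w₁ = σ₁.compContinuousLinearMap (coframeMap F.toContinuousLinearMap)
  second : w₂ = σ₂.compContinuousLinearMap (coframeMap F.toContinuousLinearMap)
  third : w₃ = σ₃.compContinuousLinearMap (coframeMap F.toContinuousLinearMap)

/-- The computations at a point and in a chart combine to torsion-freeness of `φ`, for any closed
2-forms on `M` which admit adapted coframes. -/
theorem isTorsionFreeG2On_phiForm {p q k l : ℝ} {ω₀ ω₁ ω₂ ω₃ : DiffForm (𝓡 4) M 2}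
    {ξ : DiffForm IP (ℝ × M) 1} {η : DiffForm IN (ℝ × ℝ × M) 1} {T : Set ℝ} {M' : Set M}
    (hT : ∀ t ∈ T, 0 < t ∧ |p + q * t| < k + l * t)
    (hF : ∀ m, Nonempty (AdaptedCoframe p q (ω₀ m) (ω₁ m) (ω₂ m) (ω₃ m)))
    (s₀ : ω₀.SmoothOn Set.univ) (s₁ : ω₁.SmoothOn Set.univ) (s₂ : ω₂.SmoothOn Set.univ)
    (s₃ : ω₃.SmoothOn Set.univ) (c₀ : ∀ m, ω₀.d m = 0) (c₁ : ∀ m, ω₁.d m = 0)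
    (c₂ : ∀ m, ω₂.d m = 0) (c₃ : ∀ m, ω₃.d m = 0)
    (h : AreConnectionForms T M' (q • ω₀ + l • ω₁) ω₂ ξ η) :
    IsTorsionFreeG2On (phiForm (fun t => (p + q * t) • ω₀ + (k + l * t) • ω₁)
      (fun t => t * ((k + l * t) ^ 2 - (p + q * t) ^ 2)) ω₂ ω₃ ξ η)
      {z | z.1 ∈ T ∧ z.2.2.2 ∈ M'} := by
  let ℓ : EY →L[ℝ] ℝ := ContinuousLinearMap.fst ℝ ℝ (ℝ × ℝ × EuclideanSpace ℝ (Fin 4))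
  let ℓx : EY →L[ℝ] ℝ := (ContinuousLinearMap.fst ℝ ℝ (ℝ × EuclideanSpace ℝ (Fin 4))).comp
    (ContinuousLinearMap.snd ℝ ℝ (ℝ × ℝ × EuclideanSpace ℝ (Fin 4)))
  let ℓy : EY →L[ℝ] ℝ := (ContinuousLinearMap.fst ℝ ℝ (EuclideanSpace ℝ (Fin 4))).comp
    ((ContinuousLinearMap.snd ℝ ℝ (ℝ × EuclideanSpace ℝ (Fin 4))).comp
      (ContinuousLinearMap.snd ℝ ℝ (ℝ × ℝ × EuclideanSpace ℝ (Fin 4))))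
  let τ (ℓ : EY →L[ℝ] ℝ) : EY [⋀^Fin 1]→L[ℝ] ℝ :=
    ContinuousAlternatingMap.ofSubsingleton ℝ EY ℝ (0 : Fin 1) ℓ
  -- the pullbacks of the 2-forms on `M`, in the chart at `z`
  let w (θ : DiffForm (𝓡 4) M 2) (z : ℝ × ℝ × ℝ × M) : EY → EY [⋀^Fin 2]→L[ℝ] ℝ :=
    (DiffForm.pullback (I := IY) projM θ).inChart z
  have hw {θ : DiffForm (𝓡 4) M 2} (hθ : θ.SmoothOn Set.univ) (z : ℝ × ℝ × ℝ × M) :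
      ContDiffAt ℝ ∞ (w θ z) (extChartAt IY z z) :=
    DiffForm.contDiffAt_inChart_pullback contMDiff_projM.contMDiffAt (hθ _ trivial)
  have hdw {θ : DiffForm (𝓡 4) M 2} (hθ : θ.SmoothOn Set.univ) (hc : ∀ m, θ.d m = 0)
      (z : ℝ × ℝ × ℝ × M) : HasExtDerivAt (w θ z) 0 (extChartAt IY z z) := by
    have h := DiffForm.hasExtDerivAt_inChart_pullback (I := IY) (z := z)
      contMDiff_projM.contMDiffAt (hθ (projM z) trivial)
    rw [hc] at h
    exact h
  have hw_self (θ : DiffForm (𝓡 4) M 2) (z : ℝ × ℝ × ℝ × M) : w θ z (extChartAt IY z z) =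
      (θ (projM z) : EuclideanSpace ℝ (Fin 4) [⋀^Fin 2]→L[ℝ] ℝ).compContinuousLinearMap projE := by
    refine (DiffForm.inChart_self _ z).trans ?_
    rw [← mfderiv_projM z]
    rfl
  have hK (z : ℝ × ℝ × ℝ × M) : ∃ K : EY →L[ℝ] (Fin 7 → ℝ),
      p • w ω₀ z (extChartAt IY z z) = p • σ₀.compContinuousLinearMap K ∧
      q • w ω₀ z (extChartAt IY z z) = q • σ₀.compContinuousLinearMap K ∧
      w ω₁ z (extChartAt IY z z) = σ₁.compContinuousLinearMap K ∧
      w ω₂ z (extChartAt IY z z) = σ₂.compContinuousLinearMap K ∧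
      w ω₃ z (extChartAt IY z z) = σ₃.compContinuousLinearMap K := by
    obtain ⟨⟨F, hp, hq, h₁, h₂, h₃⟩⟩ := hF (projM z)
    let pb (θ : EuclideanSpace ℝ (Fin 4) [⋀^Fin 2]→L[ℝ] ℝ) := θ.compContinuousLinearMap projE
    refine ⟨(coframeMap F.toContinuousLinearMap).comp projE, ?_⟩
    simp only [hw_self]
    exact ⟨congrArg pb hp, congrArg pb hq, congrArg pb h₁, congrArg pb h₂, congrArg pb h₃⟩
  -- the forms `dx + ξ` and `dy + η` in the chart at `z`
  let Ξ (z : ℝ × ℝ × ℝ × M) (y : EY) : EY [⋀^Fin 1]→L[ℝ] ℝ :=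
    (DiffForm.ofFun IY (fun z' : ℝ × ℝ × ℝ × M => z'.2.1)).inChart z y +
      (DiffForm.pullback (I := IY) projP ξ).inChart z y
  let Η (z : ℝ × ℝ × ℝ × M) (y : EY) : EY [⋀^Fin 1]→L[ℝ] ℝ :=
    (DiffForm.ofFun IY (fun z' : ℝ × ℝ × ℝ × M => z'.2.2.1)).inChart z y +
      (DiffForm.pullback (I := IY) projN η).inChart z y
  have ht (z : ℝ × ℝ × ℝ × M) : (DiffForm.ofFun IY (fun z' : ℝ × ℝ × ℝ × M => z'.1)).inChart z
      =ᶠ[𝓝 (extChartAt IY z z)] fun _ => τ ℓ :=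
    DiffForm.inChart_ofFun contMDiff_coord_t.contMDiffAt ℓ fun _ => rfl
  have hx (z : ℝ × ℝ × ℝ × M) : (DiffForm.ofFun IY (fun z' : ℝ × ℝ × ℝ × M => z'.2.1)).inChart z
      =ᶠ[𝓝 (extChartAt IY z z)] fun _ => τ ℓx :=
    DiffForm.inChart_ofFun contMDiff_coord_x.contMDiffAt ℓx fun _ => rfl
  have hy (z : ℝ × ℝ × ℝ × M) : (DiffForm.ofFun IY (fun z' : ℝ × ℝ × ℝ × M => z'.2.2.1)).inChart z
      =ᶠ[𝓝 (extChartAt IY z z)] fun _ => τ ℓy :=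
    DiffForm.inChart_ofFun contMDiff_coord_y.contMDiffAt ℓy fun _ => rfl
  have hτ (z : ℝ × ℝ × ℝ × M) : ContDiffAt ℝ ∞
      ((DiffForm.ofFun IY (fun z' : ℝ × ℝ × ℝ × M => z'.1)).inChart z) (extChartAt IY z z) :=
    contDiffAt_const.congr_of_eventuallyEq (ht z)
  have hΞ {z : ℝ × ℝ × ℝ × M} (hz : z.1 ∈ T ∧ z.2.2.2 ∈ M') :
      ContDiffAt ℝ ∞ (Ξ z) (extChartAt IY z z) :=
    (contDiffAt_const.congr_of_eventuallyEq (hx z)).add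
      (DiffForm.contDiffAt_inChart_pullback contMDiff_projP.contMDiffAt (h.smooth_ξ (projP z) hz))
  have hΗ {z : ℝ × ℝ × ℝ × M} (hz : z.1 ∈ T ∧ z.2.2.2 ∈ M') :
      ContDiffAt ℝ ∞ (Η z) (extChartAt IY z z) :=
    (contDiffAt_const.congr_of_eventuallyEq (hy z)).add
      (DiffForm.contDiffAt_inChart_pullback contMDiff_projN.contMDiffAt (h.smooth_η (projN z) hz))
  have hdΞ {z : ℝ × ℝ × ℝ × M} (hz : z.1 ∈ T ∧ z.2.2.2 ∈ M') : HasExtDerivAt (Ξ z)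
      (q • w ω₀ z (extChartAt IY z z) + l • w ω₁ z (extChartAt IY z z)) (extChartAt IY z z) := by
    have h₁ := ((HasExtDerivAt.const (τ ℓx)).congr_of_eventuallyEq (hx z)).add
      (DiffForm.hasExtDerivAt_inChart_pullback contMDiff_projP.contMDiffAt
        (h.smooth_ξ (projP z) hz))
    refine h₁.congr_deriv ((zero_add _).trans ?_)
    rw [hw_self, hw_self, h.d_ξ (projP z) hz.1 hz.2]
    ext v
    exact congrArg (fun u => ((q • ω₀ + l • ω₁) (projM z) :
      EuclideanSpace ℝ (Fin 4) [⋀^Fin 2]→L[ℝ] ℝ) u)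
      (funext fun i => mfderiv_snd_comp_projP z (v i))
  have hdΗ {z : ℝ × ℝ × ℝ × M} (hz : z.1 ∈ T ∧ z.2.2.2 ∈ M') : HasExtDerivAt (Η z)
      (-w ω₂ z (extChartAt IY z z)) (extChartAt IY z z) := by
    have h₁ := ((HasExtDerivAt.const (τ ℓy)).congr_of_eventuallyEq (hy z)).add
      (DiffForm.hasExtDerivAt_inChart_pullback contMDiff_projN.contMDiffAt
        (h.smooth_η (projN z) hz))
    refine h₁.congr_deriv ((zero_add _).trans ?_)
    rw [hw_self, h.d_η (projN z) hz.1 hz.2]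
    ext v
    exact congrArg (fun u => -(ω₂ (projM z) : EuclideanSpace ℝ (Fin 4) [⋀^Fin 2]→L[ℝ] ℝ) u)
      (funext fun i => mfderiv_snd_comp_projN z (v i))
  -- the coefficient functions in the chart
  have ha (a b : ℝ) (y : EY) : ContDiffAt ℝ ∞ (fun y : EY => a + b * y.1) y :=
    (contDiff_const.add (contDiff_const.mul contDiff_fst)).contDiffAt
  have hf (y : EY) : ContDiffAt ℝ ∞
      (fun y : EY => (k + l * y.1) ^ 2 - (p + q * y.1) ^ 2) y :=
    ((ha k l y).pow 2).sub ((ha p q y).pow 2)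
  have hW (z : ℝ × ℝ × ℝ × M) : ContDiffAt ℝ ∞
      (fun y => (p + q * y.1) • w ω₀ z y + (k + l * y.1) • w ω₁ z y) (extChartAt IY z z) :=
    ((ha p q _).smul (hw s₀ z)).add ((ha k l _).smul (hw s₁ z))
  refine ⟨fun z hz => ?_, fun z hz => ?_, psiForm (fun t => (p + q * t) • ω₀ + (k + l * t) • ω₁)
    (fun t => (k + l * t) ^ 2 - (p + q * t) ^ 2) ω₂ ω₃ ξ η, fun z hz => ?_, fun z hz => ?_,
    fun z hz => ?_⟩
  · rw [funext (inChart_phiForm p q k l ω₀ ω₁ ω₂ ω₃ ξ η z)]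
    exact ContDiffAt.phiExpr contDiffAt_fst (contDiffAt_fst.mul (hf _)) (hW z) (hw s₂ z) (hw s₃ z)
      (hτ z) (hΞ hz) (hΗ hz)
  · obtain ⟨K, hp, hq, h₁, h₂, -⟩ := hK z
    rw [DiffForm.d_eq]
    refine (EventuallyEq.extDeriv_eq ?_).trans (hasExtDerivAt_phi (ℓ := ℓ) (p := p) (q := q)
      (k := k) (l := l) (u := fun t => t * ((k + l * t) ^ 2 - (p + q * t) ^ 2)) (by fun_prop)
      (hdw s₀ c₀ z) (hdw s₁ c₁ z) (hdw s₂ c₂ z) (hdw s₃ c₃ z) (hdΞ hz) (hdΗ hz)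
      (family_wedge_second hp hq h₁ h₂ _) (second_wedge_derivative hq h₁ h₂)).extDeriv_eq
    filter_upwards [ht z] with y hy
    rw [inChart_phiForm, hy]
    rfl
  · obtain ⟨⟨F, hp, hq, h₁, h₂, h₃⟩⟩ := hF (projM z)
    exact isG2Pair_phiForm_psiForm p q k l ω₀ ω₁ ω₂ ω₃ ξ η z F (hT _ hz.1).1 (hT _ hz.1).2
      hp hq h₁ h₂ h₃
  · rw [funext (inChart_psiForm p q k l ω₀ ω₁ ω₂ ω₃ ξ η z)]
    exact ContDiffAt.psiExpr contDiffAt_fst (hf _) (hW z) (hw s₂ z) (hw s₃ z)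
      (hτ z) (hΞ hz) (hΗ hz)
  · obtain ⟨K, hp, hq, h₁, h₂, h₃⟩ := hK z
    rw [DiffForm.d_eq]
    refine (EventuallyEq.extDeriv_eq ?_).trans (hasExtDerivAt_starPhi (ℓ := ℓ) (p := p) (q := q)
      (k := k) (l := l) (hdw s₀ c₀ z) (hdw s₁ c₁ z) (hdw s₂ c₂ z) (hdw s₃ c₃ z) (hdΞ hz) (hdΗ hz)
      (family_wedge_derivative hp hq h₁ h₂ _) (third_wedge_second h₂ h₃)
      (third_wedge_derivative hq h₁ h₃)).extDeriv_eq
    filter_upwards [ht z] with y hy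
    rw [inChart_psiForm, hy]
    rfl

end TorsionFree

/-! ### Existence of the 1-forms -/

section Existence

variable {M : Type*} [TopologicalSpace M] [ChartedSpace (EuclideanSpace ℝ (Fin 4)) M]
  [IsManifold (𝓡 4) ∞ M]

/-- Local existence of the 1-forms: pull back local primitives of `ω̃'` and `-ω₂` from `M`. -/
theorem exists_areConnectionForms {β ω₂ : DiffForm (𝓡 4) M 2} (hβ : β.SmoothOn Set.univ)
    (h₂ : ω₂.SmoothOn Set.univ) (cβ : ∀ m, β.d m = 0) (c₂ : ∀ m, ω₂.d m = 0) (T : Set ℝ) (m : M) :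
    ∃ M' : Set M, IsOpen M' ∧ m ∈ M' ∧
      ∃ (ξ : DiffForm IP (ℝ × M) 1) (η : DiffForm IN (ℝ × ℝ × M) 1),
        AreConnectionForms T M' β ω₂ ξ η := by
  obtain ⟨U, hU, hmU, ζ, hζ, dζ⟩ := DiffForm.exists_d_eq hβ cβ m
  obtain ⟨U', hU', hmU', ζ', hζ', dζ'⟩ := DiffForm.exists_d_eq (h₂.const_smul (-1))
    (fun x => by rw [DiffForm.d_const_smul _ h₂ trivial, c₂, smul_zero]) m
  have hsnd (z : ℝ × M) : ContMDiffAt IP (𝓡 4) ∞ (fun z : ℝ × M => z.2) z := contMDiffAt_snd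
  have hsnd' (z : ℝ × ℝ × M) : ContMDiffAt IN (𝓡 4) ∞ (fun z : ℝ × ℝ × M => z.2.2) z :=
    (contMDiff_snd.comp contMDiff_snd).contMDiffAt
  refine ⟨U ∩ U', hU.inter hU', ⟨hmU, hmU'⟩, DiffForm.pullback (fun z : ℝ × M => z.2) ζ,
    DiffForm.pullback (fun z : ℝ × ℝ × M => z.2.2) ζ', ?_, ?_, ?_, ?_⟩
  · exact fun z hz => DiffForm.contDiffAt_inChart_pullback (hsnd z) (hζ z.2 hz.2.1)
  · exact fun z hz => DiffForm.contDiffAt_inChart_pullback (hsnd' z) (hζ' z.2.2 hz.2.2)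
  · intro z _ hz
    rw [DiffForm.d_pullback (hsnd z) (hζ z.2 hz.1), dζ _ hz.1]
    rfl
  · intro z _ hz
    rw [DiffForm.d_pullback (hsnd' z) (hζ' z.2.2 hz.2), dζ' _ hz.2]
    ext v
    exact neg_one_smul ℝ (ω₂ z.2.2 _)

/-- The common form of both assertions: the 2-forms enter only through smoothness, closedness and
the existence of adapted coframes. -/
theorem yieldsTorsionFreeG2 {p q k l : ℝ} {ω₀ ω₁ ω₂ ω₃ : DiffForm (𝓡 4) M 2} {T : Set ℝ}
    (hT : ∀ t ∈ T, 0 < t ∧ |p + q * t| < k + l * t)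
    (hF : ∀ m, Nonempty (AdaptedCoframe p q (ω₀ m) (ω₁ m) (ω₂ m) (ω₃ m)))
    (s₀ : ω₀.SmoothOn Set.univ) (s₁ : ω₁.SmoothOn Set.univ) (s₂ : ω₂.SmoothOn Set.univ)
    (s₃ : ω₃.SmoothOn Set.univ) (c₀ : ∀ m, ω₀.d m = 0) (c₁ : ∀ m, ω₁.d m = 0)
    (c₂ : ∀ m, ω₂.d m = 0) (c₃ : ∀ m, ω₃.d m = 0) :
    YieldsTorsionFreeG2 T (fun t => (p + q * t) • ω₀ + (k + l * t) • ω₁) (q • ω₀ + l • ω₁)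
      (fun t => t * ((k + l * t) ^ 2 - (p + q * t) ^ 2)) ω₂ ω₃ := by
  refine ⟨exists_areConnectionForms ((s₀.const_smul q).add (s₁.const_smul l)) s₂ (fun m => ?_) c₂ T,
    fun M' _ ξ η h => isTorsionFreeG2On_phiForm hT hF s₀ s₁ s₂ s₃ c₀ c₁ c₂ c₃ h⟩
  rw [DiffForm.d_add (s₀.const_smul q) (s₁.const_smul l) trivial,
    DiffForm.d_const_smul q s₀ trivial, DiffForm.d_const_smul l s₁ trivial, c₀, c₁, smul_zero,
    smul_zero, add_zero]

end Existence

end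

theorem theorem2 {M : Type*} [TopologicalSpace M] [ChartedSpace (EuclideanSpace ℝ (Fin 4)) M]
    [IsManifold (𝓡 4) ∞ M] (S : HyperkahlerStructure M)
    (a : ℝ) (b : EReal) (ha : 0 < a) (hab : (a : EReal) < b) :
    (∀ k l : ℝ, (∀ t : ℝ, a < t → (t : EReal) < b → 0 < k + l * t) →
      YieldsTorsionFreeG2 {t : ℝ | a < t ∧ (t : EReal) < b}
        (fun t => (k + l * t) • S.K₁.Ω) (l • S.K₁.Ω)
        (fun t => t * (k + l * t) ^ 2) S.K₂.Ω S.K₃.Ω) ∧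
    (∀ A : AlmostKahlerStructure S.g₀, A.OppositelyOriented S.K₁ →
      ∀ p q k l : ℝ, (∀ t : ℝ, a < t → (t : EReal) < b → |p + q * t| < k + l * t) →
        YieldsTorsionFreeG2 {t : ℝ | a < t ∧ (t : EReal) < b}
          (fun t => (p + q * t) • A.Ω + (k + l * t) • S.K₁.Ω) (q • A.Ω + l • S.K₁.Ω)
          (fun t => t * ((k + l * t) ^ 2 - (p + q * t) ^ 2)) S.K₂.Ω S.K₃.Ω) := by
  refine ⟨fun k l h => ?_, fun A hA p q k l h => ?_⟩
  · -- the case `p = q = 0`, where any form may stand for `ω₀`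
    have h₀ := yieldsTorsionFreeG2 (p := 0) (q := 0) (k := k) (l := l) (ω₀ := S.K₁.Ω)
      (T := {t : ℝ | a < t ∧ (t : EReal) < b})
      (fun t ht => ⟨ha.trans ht.1, by simpa using h t ht.1 ht.2⟩)
      (fun m => by
        obtain ⟨F, h₁, h₂, h₃⟩ := S.exists_coframe m
        exact ⟨⟨F, by rw [zero_smul, zero_smul], by rw [zero_smul, zero_smul], h₁, h₂, h₃⟩⟩)
      S.K₁.smooth S.K₁.smooth S.K₂.smooth S.K₃.smooth S.K₁.closed S.K₁.closed S.K₂.closed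
      S.K₃.closed
    simpa using h₀
  · exact yieldsTorsionFreeG2 (fun t ht => ⟨ha.trans ht.1, h t ht.1 ht.2⟩)
      (fun m => by
        obtain ⟨F, h₀, h₁, h₂, h₃⟩ := S.exists_coframe_of_oppositelyOriented A hA m
        exact ⟨⟨F, congrArg _ h₀, congrArg _ h₀, h₁, h₂, h₃⟩⟩)
      A.smooth S.K₁.smooth S.K₂.smooth S.K₃.smooth A.closed S.K₁.closed S.K₂.closed S.K₃.closed
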